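/- All graphs are finite, simple and undirected. **Definitions.** For odd $r\ge 3$, the *elementary $r$-wall* is obtained from the grid on $\{1,\dots,2r\}\times\{1,\dots,r\}$ by deleting the vertical edges $\{(x,y),(x,y+1)\}$ with $x+y$ odd and then all vertices of degree one; its *perimeter* is the cycle bounding its infinite face. An *$r$-wall* $W$ (a wall of *height* $r$) is a graph obtained from an elementary $r$-wall $\bar W$ by subdividing edges; the vertices of $\bar W$ are the *branch vertices* of $W$, and $\mathsf{perim}(W)$ is the cycle of $W$ corresponding to the perimeter of $\bar W$. A wall *of* $G$ is a subgraph of $G$ that is a wall. An *in-peg* of $\mathsf{perim}(W)$ is a vertex of $\mathsf{perim}(W)$ of degree three in $W$. Put $W^{(1)}=W$, and for $1\le i<(r-1)/2$ let $W^{(i+1)}$ be the wall obtained from $W^{(i)}$ by removing its perimeter and (repeatedly) all occurring vertices of degree one. For a wall $W$ of $G$, let $\mathsf{inn}(W)$ be the connected component of $G\setminus V(\mathsf{perim}(W))$ that contains $W\setminus V(\mathsf{perim}(W))$, and let $\mathsf{compass}(W)=G[V(\mathsf{inn}(W))\cup V(\mathsf{perim}(W))]$. **Lemma.** Let $G$ be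 a planar graph, let $k\ge 0$ be an integer, and let $W$ be a wall of $G$ of height at least $2k+3$. Let $s,t$ be two distinct vertices of $G$ that do not belong to $\mathsf{compass}(W)$. Let $e_i=\{v_i,u_i\}$ for $i\in\{1,\dots,k\}$, $e_{k+1}=\{v_{k+1},s\}$ and $e_{k+2}=\{v_{k+2},t\}$ be edges of $G$ no two of which share an endpoint, and let $X=\{v_{k+1},v_{k+2}\}\cup\bigcup_{i=1}^{k}\{v_i,u_i\}$. If every vertex of $X$ is an in-peg of $\mathsf{perim}(W)$, then there is an $(s,t)$-path in $G$ that contains the edges $e_1,\dots,e_{k+2}$ and whose intersection with $\mathsf{compass}(W^{(k+1)})$ is a path of $\mathsf{perim}(W^{(k+1)})$ whose endpoints are two distinct branch vertices of $W$. -/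

import Mathlib

/-! ### Planar graphs: drawings in the plane whose edges are polygonal arcs -/

/-- `A` is a (simple) polygonal arc between `x` and `y`: a chain of finitely many straight line
segments, consecutive ones meeting exactly in their common corner, all others disjoint. -/
def IsPolygonalArc (A : Set (ℝ × ℝ)) (x y : ℝ × ℝ) : Prop :=
  ∃ (n : ℕ) (p : ℕ → ℝ × ℝ), 0 < n ∧ p 0 = x ∧ p n = y ∧
    (∀ i < n, p i ≠ p (i + 1)) ∧
    (∀ i, i + 1 < n →
      segment ℝ (p i) (p (i + 1)) ∩ segment ℝ (p (i + 1)) (p (i + 2)) = {p (i + 1)}) ∧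
    (∀ i j, i + 1 < j → j < n →
      Disjoint (segment ℝ (p i) (p (i + 1))) (segment ℝ (p j) (p (j + 1)))) ∧
    A = ⋃ i < n, segment ℝ (p i) (p (i + 1))

/-- A plane drawing of `G`: vertices are distinct points, an edge is a polygonal arc between its
ends, and the interior of an edge contains no vertex and no point of any other edge. -/
structure PlaneDrawing {V : Type*} (G : SimpleGraph V) where
  pos : V → ℝ × ℝ
  arc : Sym2 V → Set (ℝ × ℝ)
  pos_injective : Function.Injective pos
  isPolygonalArc : ∀ u v, G.Adj u v → IsPolygonalArc (arc s(u, v)) (pos u) (pos v)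
  mem_of_pos_mem_arc : ∀ e ∈ G.edgeSet, ∀ w, pos w ∈ arc e → w ∈ e
  arc_inter : ∀ e ∈ G.edgeSet, ∀ f ∈ G.edgeSet, e ≠ f →
    ∀ z ∈ arc e, z ∈ arc f → ∃ w ∈ e, z = pos w

/-- A graph is planar if it has a plane drawing. -/
def IsPlanar {V : Type*} (G : SimpleGraph V) : Prop := Nonempty (PlaneDrawing G)

/-! ### Elementary walls and their layers -/

/-- The grid on `ℕ × ℕ` without the vertical edges `{(x, y), (x, y + 1)}` with `x + y` odd. -/
def brickGraph : SimpleGraph (ℕ × ℕ) where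
  Adj p q :=
    (p.2 = q.2 ∧ (p.1 + 1 = q.1 ∨ q.1 + 1 = p.1)) ∨
    (p.1 = q.1 ∧ ((p.2 + 1 = q.2 ∧ Even (p.1 + p.2)) ∨ (q.2 + 1 = p.2 ∧ Even (q.1 + q.2))))
  symm := ⟨fun p q h => by tauto⟩
  loopless := ⟨fun p h => by omega⟩

/-- Remove from the subgraph of `brickGraph` induced by `S` all vertices of degree one. -/
def prune (S : Set (ℕ × ℕ)) : Set (ℕ × ℕ) :=
  {p ∈ S | (brickGraph.neighborSet p ∩ S).ncard ≠ 1}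

/-- `window r 1` is `{1, …, 2r} × {1, …, r}`; each step `i → i + 1` takes away two columns on the
left and on the right, and one row at the bottom and at the top. -/
def window (r i : ℕ) : Set (ℕ × ℕ) :=
  {p | 2 * i ≤ p.1 + 1 ∧ p.1 + 2 * i ≤ 2 * r + 2 ∧ i ≤ p.2 ∧ p.2 + i ≤ r + 1}

/-- The vertices of `W̄⁽ⁱ⁾`, where `W̄` is the elementary `r`-wall and `1 ≤ i ≤ (r - 1) / 2`.
In particular `wallVerts r 1` is the vertex set of `W̄`. See also `wallVerts_succ`. -/
def wallVerts (r i : ℕ) : Set (ℕ × ℕ) := prune (window r i)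

/-- The vertices of the `i`-th layer of the elementary `r`-wall, that is, of the perimeter of
`W̄⁽ⁱ⁾`: those in the two outermost columns on each side or in the bottom or top row of
`window r i`. The subgraph that they induce is the cycle bounding the infinite face of `W̄⁽ⁱ⁾`. -/
def layerVerts (r i : ℕ) : Set (ℕ × ℕ) := wallVerts r i \ window r (i + 1)

/-- The elementary `r`-wall. The points of `ℕ × ℕ` outside `wallVerts r 1` are isolated here and
do not belong to the wall. -/
def elementaryWall (r : ℕ) : SimpleGraph (ℕ × ℕ) where
  Adj p q := p ∈ wallVerts r 1 ∧ q ∈ wallVerts r 1 ∧ brickGraph.Adj p q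
  symm := ⟨fun _ _ h => ⟨h.2.1, h.1, h.2.2.symm⟩⟩
  loopless := ⟨fun p h => brickGraph.loopless.irrefl p h.2.2⟩

/-- `W̄⁽ⁱ⁺¹⁾` arises from `W̄⁽ⁱ⁾` by removing its perimeter and then all vertices of degree one. -/
theorem wallVerts_succ (r i : ℕ) (hi : 1 ≤ i) :
    wallVerts r (i + 1) = prune (wallVerts r i \ layerVerts r i) := by
  have key : wallVerts r i \ layerVerts r i = window r (i + 1) := by
    ext ⟨x, y⟩
    constructor
    · rintro ⟨h1, h2⟩
      by_contra h3
      exact h2 ⟨h1, h3⟩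
    · intro h
      refine ⟨?_, fun h2 => h2.2 h⟩
      simp only [window, Set.mem_ofPred_eq] at h
      refine ⟨by simp only [window, Set.mem_ofPred_eq]; omega, ?_⟩
      intro h1
      obtain ⟨a, ha⟩ := Set.ncard_eq_one.mp h1
      have hl : ((x - 1, y) : ℕ × ℕ) ∈ ({a} : Set (ℕ × ℕ)) := by
        rw [← ha]
        refine ⟨?_, ?_⟩
        · exact Or.inl ⟨rfl, Or.inr (show x - 1 + 1 = x by omega)⟩
        · simp only [window, Set.mem_ofPred_eq]; omega
      have hr : ((x + 1, y) : ℕ × ℕ) ∈ ({a} : Set (ℕ × ℕ)) := by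
        rw [← ha]
        refine ⟨?_, ?_⟩
        · exact Or.inl ⟨rfl, Or.inl rfl⟩
        · simp only [window, Set.mem_ofPred_eq]; omega
      have := (Set.mem_singleton_iff.mp hl).trans (Set.mem_singleton_iff.mp hr).symm
      simp only [Prod.mk.injEq] at this
      omega
  rw [key]
  rfl

/-! ### Walls of a graph -/

/-- An `r`-wall of `G`: a subgraph of `G` obtained from the elementary `r`-wall by subdividing
edges. `branch` gives the branch vertices (its values outside `wallVerts r 1` play no role), and
`seg p q h` is the subdivided edge that replaces the edge `pq` of the elementary wall. -/
structure Wall {V : Type*} (G : SimpleGraph V) (r : ℕ) where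
  odd : Odd r
  three_le : 3 ≤ r
  branch : ℕ × ℕ → V
  branch_injOn : Set.InjOn branch (wallVerts r 1)
  seg : ∀ p q, (elementaryWall r).Adj p q → G.Walk (branch p) (branch q)
  seg_isPath : ∀ p q h, (seg p q h).IsPath
  seg_symm : ∀ p q h, seg q p h.symm = (seg p q h).reverse
  /-- the internal vertices of a subdivided edge are not branch vertices -/
  branch_mem_seg : ∀ p q h, ∀ a ∈ wallVerts r 1,
    branch a ∈ (seg p q h).support → a = p ∨ a = q
  /-- different subdivided edges have no internal vertex in common -/
  seg_inter : ∀ p q h p' q' h', s(p, q) ≠ s(p', q') →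
    ∀ v ∈ (seg p q h).support, v ∈ (seg p' q' h').support → ∃ a ∈ wallVerts r 1, v = branch a

namespace Wall

variable {V : Type*} {G : SimpleGraph V} {r : ℕ} (W : Wall G r)

/-- The set of branch vertices of `W`. -/
def branchVerts : Set V := W.branch '' wallVerts r 1

/-- The union of the subdivided edges of `W` that replace edges with both ends in `S`. -/
def part (S : Set (ℕ × ℕ)) : G.Subgraph :=
  ⨆ (p : ℕ × ℕ) (q : ℕ × ℕ) (h : (elementaryWall r).Adj p q) (_ : p ∈ S) (_ : q ∈ S),
    (W.seg p q h).toSubgraph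

/-- The wall `W⁽ⁱ⁾`, obtained from `W` by removing the first `i - 1` layers and all occurring
vertices of degree one; `W.nested 1` is `W` itself, as a subgraph of `G`. -/
def nested (i : ℕ) : G.Subgraph := W.part (wallVerts r i)

/-- The perimeter of `W⁽ⁱ⁾`, which is the `i`-th layer of `W`. -/
def perim (i : ℕ) : G.Subgraph := W.part (layerVerts r i)

/-- The vertices of the connected component of `G - V(perim(W⁽ⁱ⁾))` that contains
`W⁽ⁱ⁾ - V(perim(W⁽ⁱ⁾))`. -/
def innVerts (i : ℕ) : Set V :=
  {v | ∃ w ∈ (W.nested i).verts, ∃ c : G.Walk w v, ∀ x ∈ c.support, x ∉ (W.perim i).verts}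

/-- The compass of `W⁽ⁱ⁾`: the subgraph of `G` induced by `inn(W⁽ⁱ⁾)` and the perimeter. -/
def compass (i : ℕ) : G.Subgraph :=
  (⊤ : G.Subgraph).induce (W.innVerts i ∪ (W.perim i).verts)

/-- `v` is an in-peg of the perimeter of `W`: it lies on the perimeter and has degree three
in `W`. -/
def IsInPeg (v : V) : Prop :=
  v ∈ (W.perim 1).verts ∧ ((W.nested 1).neighborSet v).ncard = 3

end Wall

open Filter Topology

/-! ### Parity of the crossings of a polygonal curve with a vertical ray -/

namespace RayParity

/-- Whether `a` lies weakly to the left of `p`. -/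
noncomputable def leftInd (a p : ℝ × ℝ) : ZMod 2 := if a.1 ≤ p.1 then 1 else 0

/-- The orientation determinant of `a`, `b`, `p`. -/
def det (a b p : ℝ × ℝ) : ℝ := (b.1 - a.1) * (p.2 - a.2) - (b.2 - a.2) * (p.1 - a.1)

/-- The parity of the crossings of the upward vertical ray at `p` with the segment `ab`. -/
noncomputable def cross (a b p : ℝ × ℝ) : ZMod 2 :=
  if det a b p * (b.1 - a.1) < 0 then leftInd a p + leftInd b p else 0

/-- The contribution of an end `a` that lies vertically above `q`. -/
noncomputable def endTerm (q a p : ℝ × ℝ) : ZMod 2 := if a.1 = q.1 ∧ q.2 < a.2 then leftInd a p else 0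

theorem add_self (x : ZMod 2) : x + x = 0 := CharTwo.add_self_eq_zero x

theorem cross_comm (a b p : ℝ × ℝ) : cross a b p = cross b a p := by
  have h : det a b p * (b.1 - a.1) = det b a p * (a.1 - b.1) := by simp only [det]; ring
  simp only [cross, h, add_comm]

theorem continuous_det (a b : ℝ × ℝ) : Continuous (det a b) := by
  unfold det; fun_prop

theorem leftInd_eventually_eq {a q : ℝ × ℝ} (h : a.1 ≠ q.1) :
    ∀ᶠ p in 𝓝 q, leftInd a p = leftInd a q := by
  have hc : Continuous (fun p : ℝ × ℝ => p.1) := continuous_fst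
  rcases lt_or_gt_of_ne h with h | h
  · filter_upwards [hc.continuousAt.eventually (lt_mem_nhds h)] with p hp
    simp [leftInd, hp.le, h.le]
  · filter_upwards [hc.continuousAt.eventually (gt_mem_nhds h)] with p hp
    simp [leftInd, hp.not_ge, h.not_ge]

theorem det_sign_eventually {a b q : ℝ × ℝ} (h : det a b q * (b.1 - a.1) ≠ 0) :
    ∀ᶠ p in 𝓝 q, (det a b p * (b.1 - a.1) < 0 ↔ det a b q * (b.1 - a.1) < 0) := by
  have hc : Continuous (fun p => det a b p * (b.1 - a.1)) := (continuous_det a b).mul_const _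
  rcases lt_or_gt_of_ne h with h | h
  · filter_upwards [hc.continuousAt.eventually (gt_mem_nhds h)] with p hp
    exact iff_of_true hp h
  · filter_upwards [hc.continuousAt.eventually (lt_mem_nhds h)] with p hp
    exact iff_of_false hp.not_gt h.not_gt

theorem mem_segment_of_det_eq_zero {a b q : ℝ × ℝ} (hab : a.1 < b.1) (h1 : a.1 ≤ q.1)
    (h2 : q.1 ≤ b.1) (h : det a b q = 0) : q ∈ segment ℝ a b := by
  rw [segment_eq_image']
  have hpos : 0 < b.1 - a.1 := sub_pos.2 hab
  refine ⟨(q.1 - a.1) / (b.1 - a.1), ⟨by apply div_nonneg <;> linarith, ?_⟩, ?_⟩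
  · rw [div_le_one hpos]; linarith
  · have h3 : q.2 - a.2 = (q.1 - a.1) / (b.1 - a.1) * (b.2 - a.2) := by
      field_simp
      simp only [det] at h
      linarith
    ext
    · simp; field_simp; ring
    · simp only [Prod.snd_add, Prod.smul_snd, Prod.snd_sub, smul_eq_mul]; linarith

theorem cross_add_endTerm_aux {a b q : ℝ × ℝ} (hq : q ∉ segment ℝ a b) (ha : a.1 = q.1)
    (hb : b.1 ≠ q.1) : ∀ᶠ p in 𝓝 q, cross a b p + endTerm q a p + endTerm q b p =
      cross a b q + endTerm q a q + endTerm q b q := by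
  have hqa : a.2 ≠ q.2 := by
    intro h
    have : a = q := Prod.ext ha h
    exact hq (this ▸ left_mem_segment ℝ a b)
  have hdet : det a b q * (b.1 - a.1) = (b.1 - a.1) ^ 2 * (q.2 - a.2) := by
    simp only [det, ha]; ring
  have hsq : 0 < (b.1 - a.1) ^ 2 := by
    have : b.1 - a.1 ≠ 0 := by rw [ha]; exact sub_ne_zero.2 hb
    positivity
  have hne : det a b q * (b.1 - a.1) ≠ 0 := by
    rw [hdet]; exact mul_ne_zero hsq.ne' (sub_ne_zero.2 hqa.symm)
  have hneg : det a b q * (b.1 - a.1) < 0 ↔ q.2 < a.2 := by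
    rw [hdet, mul_neg_iff]
    constructor
    · rintro (h | h) <;> linarith
    · intro h; left; constructor <;> linarith
  filter_upwards [det_sign_eventually hne, leftInd_eventually_eq hb] with p h1 h2
  rw [cross, cross, if_congr (h1.trans hneg) rfl rfl, if_congr hneg rfl rfl]
  simp only [endTerm, hb, false_and, if_false, add_zero, ha, true_and]
  by_cases h3 : q.2 < a.2
  · simp only [h3, if_true, h2]
    rw [add_right_comm, add_self, add_right_comm, add_self]
  · simp [h3]

theorem cross_add_endTerm {a b q : ℝ × ℝ} (hq : q ∉ segment ℝ a b) :
    ∀ᶠ p in 𝓝 q, cross a b p + endTerm q a p + endTerm q b p =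
      cross a b q + endTerm q a q + endTerm q b q := by
  by_cases ha : a.1 = q.1
  · by_cases hb : b.1 = q.1
    · have hab : a.1 = b.1 := ha.trans hb.symm
      have hs : (q.2 < a.2 ∧ q.2 < b.2) ∨ (a.2 < q.2 ∧ b.2 < q.2) := by
        by_contra hcon
        apply hq
        have key : ∀ c d : ℝ × ℝ, c.1 = q.1 → d.1 = q.1 → c.2 ≤ q.2 → q.2 ≤ d.2 →
            q ∈ segment ℝ c d := by
          intro c d hc hd h1 h2
          have : q.2 ∈ segment ℝ c.2 d.2 := by
            rw [segment_eq_Icc (h1.trans h2)]; exact ⟨h1, h2⟩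
          obtain ⟨s, t, hs, ht, hst, h⟩ := this
          refine ⟨s, t, hs, ht, hst, Prod.ext ?_ h⟩
          simp only [Prod.fst_add, Prod.smul_fst, hc, hd, ← add_smul, hst, one_smul]
        rcases le_total a.2 q.2 with h1 | h1
        · rcases le_total q.2 b.2 with h2 | h2
          · exact key a b ha hb h1 h2
          · rcases eq_or_lt_of_le h1 with h3 | h3
            · exact (Prod.ext ha h3 : a = q) ▸ left_mem_segment ℝ a b
            · rcases eq_or_lt_of_le h2 with h4 | h4
              · exact (Prod.ext hb h4 : b = q) ▸ right_mem_segment ℝ a b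
              · exact absurd (Or.inr ⟨h3, h4⟩) hcon
        · rcases le_total b.2 q.2 with h2 | h2
          · rw [segment_symm]; exact key b a hb ha h2 h1
          · rcases eq_or_lt_of_le h1 with h3 | h3
            · exact (Prod.ext ha h3.symm : a = q) ▸ left_mem_segment ℝ a b
            · rcases eq_or_lt_of_le h2 with h4 | h4
              · exact (Prod.ext hb h4.symm : b = q) ▸ right_mem_segment ℝ a b
              · exact absurd (Or.inl ⟨h3, h4⟩) hcon
      have hz : ∀ p, cross a b p + endTerm q a p + endTerm q b p = 0 := by
        intro p
        have h0 : cross a b p = 0 := by simp [cross, hab]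
        have hl : leftInd a p = leftInd b p := by simp [leftInd, hab]
        rw [h0, zero_add]
        rcases hs with ⟨h1, h2⟩ | ⟨h1, h2⟩
        · simp only [endTerm, ha, hb, h1, h2, true_and, if_true, hl, add_self]
        · simp only [endTerm, h1.not_gt, h2.not_gt, and_false, if_false, add_zero]
      exact Eventually.of_forall fun p => by rw [hz, hz]
    · exact cross_add_endTerm_aux hq ha hb
  · by_cases hb : b.1 = q.1
    · rw [segment_symm] at hq
      filter_upwards [cross_add_endTerm_aux hq hb ha] with p hp
      rw [cross_comm a b p, cross_comm a b q, add_right_comm, hp, add_right_comm]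
    · have key : ∀ᶠ p in 𝓝 q, cross a b p = cross a b q := by
        filter_upwards [leftInd_eventually_eq ha, leftInd_eventually_eq hb,
          (show ∀ᶠ p in 𝓝 q, leftInd a q + leftInd b q ≠ 0 →
            (det a b p * (b.1 - a.1) < 0 ↔ det a b q * (b.1 - a.1) < 0) by
            by_cases h : leftInd a q + leftInd b q = 0
            · exact Eventually.of_forall fun p hp => absurd h hp
            · have hne : det a b q * (b.1 - a.1) ≠ 0 := by
                by_cases h1 : a.1 ≤ q.1
                · by_cases h2 : b.1 ≤ q.1
                  · exact absurd (by simp only [leftInd, h1, h2, if_true, add_self]) h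
                  · have hab : a.1 < b.1 := by linarith
                    refine mul_ne_zero (fun h0 => hq ?_) (sub_ne_zero.2 hab.ne')
                    exact mem_segment_of_det_eq_zero hab h1 (not_le.1 h2).le h0
                · by_cases h2 : b.1 ≤ q.1
                  · have hab : b.1 < a.1 := by linarith
                    refine mul_ne_zero (fun h0 => hq ?_) (sub_ne_zero.2 hab.ne)
                    rw [segment_symm]
                    refine mem_segment_of_det_eq_zero hab h2 (not_le.1 h1).le ?_
                    simp only [det] at h0 ⊢; linarith
                  · exact absurd (by simp only [leftInd, h1, h2, if_false, add_zero]) h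
              filter_upwards [det_sign_eventually hne] with p hp _ using hp)] with p h1 h2 h3
        simp only [cross, h1, h2]
        by_cases h : leftInd a q + leftInd b q = 0
        · simp [h]
        · simp only [h3 h]
      filter_upwards [key] with p hp
      simp only [endTerm, ha, hb, false_and, if_false, hp]

/-! ### Directions at a common end -/

/-- The local parity at a point of a segment in direction `d`, seen in direction `e`. -/
noncomputable def dirTerm (d e : ℝ × ℝ) : ZMod 2 :=
  if 0 < d.1 then (if 0 ≤ e.1 ∧ d.1 * e.2 - d.2 * e.1 < 0 then 1 else 0)
  else if d.1 < 0 then (if e.1 < 0 ∧ 0 < d.1 * e.2 - d.2 * e.1 then 1 else 0)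
  else (if 0 < d.2 ∧ 0 ≤ e.1 then 1 else 0)

theorem cross_ray (u b e : ℝ × ℝ) :
    ∀ᶠ t in 𝓝[>] (0 : ℝ), cross u b (u + t • e) + endTerm u b (u + t • e) = dirTerm (b - u) e := by
  have hcont : Continuous fun t : ℝ => u + t • e := by fun_prop
  have hlim : Tendsto (fun t : ℝ => u + t • e) (𝓝[>] 0) (𝓝 u) := by
    have := hcont.tendsto 0
    simp only [zero_smul, add_zero] at this
    exact this.mono_left nhdsWithin_le_nhds
  have hu : ∀ t : ℝ, 0 < t → leftInd u (u + t • e) = if 0 ≤ e.1 then 1 else 0 := by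
    intro t ht
    have : u.1 ≤ (u + t • e).1 ↔ 0 ≤ e.1 := by
      simp only [Prod.fst_add, Prod.smul_fst, smul_eq_mul, le_add_iff_nonneg_right]
      exact mul_nonneg_iff_of_pos_left ht
    simp only [leftInd, this]
  have hdet : ∀ t : ℝ, det u b (u + t • e) * (b.1 - u.1) =
      t * (((b - u).1 * e.2 - (b - u).2 * e.1) * (b - u).1) := by
    intro t; simp [det]; ring
  rcases lt_trichotomy (b.1 - u.1) 0 with h | h | h
  · have hb := hlim.eventually (leftInd_eventually_eq (a := b) (q := u) (by intro h'; linarith))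
    filter_upwards [hb, self_mem_nhdsWithin] with t h1 ht
    have ht' : (0 : ℝ) < t := ht
    have e1 : endTerm u b (u + t • e) = 0 := by
      rw [endTerm, if_neg]; rintro ⟨h2, -⟩; linarith
    have e2 : leftInd b u = 1 := by rw [leftInd, if_pos (by linarith)]
    have h3 : (b - u).1 < 0 := h
    have e3 : det u b (u + t • e) * (b.1 - u.1) < 0 ↔ 0 < (b - u).1 * e.2 - (b - u).2 * e.1 := by
      rw [hdet, mul_neg_iff]
      constructor
      · rintro (⟨-, h4⟩ | ⟨h4, -⟩)
        · by_contra h5; nlinarith [mul_nonneg_of_nonpos_of_nonpos (not_lt.1 h5) h3.le]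
        · linarith
      · intro h4; exact Or.inl ⟨ht', mul_neg_of_pos_of_neg h4 h3⟩
    rw [e1, add_zero, cross, hu t ht', h1, e2, dirTerm, if_neg h3.not_gt, if_pos h3]
    simp only [e3]
    by_cases h6 : 0 ≤ e.1
    · simp [h6, h6.not_gt, add_self]
    · simp [h6, not_le.1 h6]
  · filter_upwards [self_mem_nhdsWithin] with t ht
    have ht' : (0 : ℝ) < t := ht
    have h3 : (b - u).1 = 0 := h
    have hbu : b.1 = u.1 := by linarith
    have e1 : cross u b (u + t • e) = 0 := by simp [cross, h]
    have e2 : leftInd b (u + t • e) = leftInd u (u + t • e) := by simp [leftInd, hbu]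
    rw [e1, zero_add, endTerm, e2, hu t ht', dirTerm, if_neg h3.not_gt, if_neg h3.not_lt]
    have e3 : (0 < (b - u).2) ↔ u.2 < b.2 := by simp
    simp only [hbu, true_and, e3]
    by_cases h6 : u.2 < b.2 <;> simp [h6]
  · have hb := hlim.eventually (leftInd_eventually_eq (a := b) (q := u) (by intro h'; linarith))
    filter_upwards [hb, self_mem_nhdsWithin] with t h1 ht
    have ht' : (0 : ℝ) < t := ht
    have e1 : endTerm u b (u + t • e) = 0 := by
      rw [endTerm, if_neg]; rintro ⟨h2, -⟩; linarith
    have e2 : leftInd b u = 0 := by rw [leftInd, if_neg (by linarith)]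
    have h3 : 0 < (b - u).1 := h
    have e3 : det u b (u + t • e) * (b.1 - u.1) < 0 ↔ (b - u).1 * e.2 - (b - u).2 * e.1 < 0 := by
      rw [hdet, mul_neg_iff]
      constructor
      · rintro (⟨-, h4⟩ | ⟨h4, -⟩)
        · by_contra h5; nlinarith [mul_nonneg (not_lt.1 h5) h3.le]
        · linarith
      · intro h4; exact Or.inl ⟨ht', mul_neg_of_neg_of_pos h4 h3⟩
    rw [e1, add_zero, cross, hu t ht', h1, e2, dirTerm, if_pos h3]
    simp only [e3, add_zero]
    by_cases h6 : 0 ≤ e.1 <;> simp [h6]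

/-- `d` and `e` do not point in the same direction. -/
def NotParallel (d e : ℝ × ℝ) : Prop := ∀ s : ℝ, 0 < s → d ≠ s • e

theorem dirTerm_add_dirTerm {d e : ℝ × ℝ} (hd : d ≠ 0) (he : e ≠ 0) (h : NotParallel d e) :
    dirTerm d e + dirTerm e d = if (d.1 < 0 ↔ e.1 < 0) then 1 else 0 := by
  have hdet : (0 < d.1 ∧ 0 < e.1) ∨ (d.1 < 0 ∧ e.1 < 0) → d.1 * e.2 - d.2 * e.1 ≠ 0 := by
    intro hs h0
    have he1 : e.1 ≠ 0 := by rcases hs with ⟨-, h⟩ | ⟨-, h⟩ <;> [exact h.ne'; exact h.ne]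
    refine h (d.1 / e.1) ?_ ?_
    · rcases hs with ⟨h1, h2⟩ | ⟨h1, h2⟩
      · exact div_pos h1 h2
      · exact div_pos_of_neg_of_neg h1 h2
    · ext
      · simp [he1]
      · simp only [Prod.smul_snd, smul_eq_mul]; field_simp; linarith
  have hd2 : d.1 = 0 → d.2 ≠ 0 := fun h1 h2 => hd (Prod.ext h1 h2)
  have he2 : e.1 = 0 → e.2 ≠ 0 := fun h1 h2 => he (Prod.ext h1 h2)
  have hv : d.1 = 0 → e.1 = 0 → (0 < d.2 ↔ e.2 < 0) := by
    intro h1 h2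
    have hs : ¬ 0 < d.2 / e.2 := by
      intro hs
      refine h _ hs (Prod.ext (by simp [h1, h2]) ?_)
      have := he2 h2
      simp only [Prod.smul_snd, smul_eq_mul]; field_simp
    rcases lt_or_gt_of_ne (hd2 h1) with h3 | h3 <;> rcases lt_or_gt_of_ne (he2 h2) with h4 | h4
    · exact absurd (div_pos_of_neg_of_neg h3 h4) hs
    · exact iff_of_false h3.not_gt h4.not_gt
    · exact iff_of_true h3 h4
    · exact absurd (div_pos h3 h4) hs
  have hsw : e.1 * d.2 - e.2 * d.1 = -(d.1 * e.2 - d.2 * e.1) := by ring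
  simp only [dirTerm, hsw]
  rcases lt_trichotomy d.1 0 with h1 | h1 | h1 <;> rcases lt_trichotomy e.1 0 with h2 | h2 | h2
  · have := hdet (Or.inr ⟨h1, h2⟩)
    generalize d.1 * e.2 - d.2 * e.1 = D at this
    rcases lt_or_gt_of_ne this with h3 | h3 <;>
      simp [h1, h2, h1.not_gt, h2.not_gt, h3, h3.not_gt]
  · simp [h1, h2, h1.not_gt, h1.not_ge]
  · simp [h1, h2, h1.not_gt, h2.not_gt, h1.not_ge]
  · simp [h1, h2, h2.not_gt, h2.not_ge]
  · have := hv h1 h2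
    rcases lt_or_gt_of_ne (he2 h2) with h3 | h3
    · simp [h1, h2, this.2 h3, h3.not_gt]
    · simp [h1, h2, h3, not_lt.1 fun h => h3.not_gt (this.1 h)]
  · rcases lt_or_gt_of_ne (hd2 h1) with h3 | h3
    · simp [h1, h2, h2.not_gt, h2.le, h3.not_gt, mul_neg_of_neg_of_pos h3 h2]
    · have := mul_pos h3 h2
      simp [h1, h2, h2.not_gt, h2.le, h3, this.not_gt]
  · simp [h1, h2, h1.not_gt, h2.not_gt, h2.not_ge]
  · rcases lt_or_gt_of_ne (he2 h2) with h3 | h3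
    · simp [h1, h2, h1.not_gt, h1.le, h3.not_gt, mul_neg_of_pos_of_neg h1 h3]
    · have := mul_pos h1 h3
      simp [h1, h2, h1.not_gt, h1.le, h3, this.not_gt]
  · have := hdet (Or.inl ⟨h1, h2⟩)
    generalize d.1 * e.2 - d.2 * e.1 = D at this
    rcases lt_or_gt_of_ne this with h3 | h3 <;>
      simp [h1, h2, h1.not_gt, h2.not_gt, h3, h3.not_gt, h1.le, h2.le]

theorem sum_dirTerm {d₁ d₂ d₃ : ℝ × ℝ} (h1 : d₁ ≠ 0) (h2 : d₂ ≠ 0) (h3 : d₃ ≠ 0)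
    (h12 : NotParallel d₁ d₂) (h13 : NotParallel d₁ d₃) (h23 : NotParallel d₂ d₃) :
    (dirTerm d₁ d₂ + dirTerm d₂ d₁) + (dirTerm d₁ d₃ + dirTerm d₃ d₁) +
      (dirTerm d₂ d₃ + dirTerm d₃ d₂) = 1 := by
  rw [dirTerm_add_dirTerm h1 h2 h12, dirTerm_add_dirTerm h1 h3 h13, dirTerm_add_dirTerm h2 h3 h23]
  by_cases a : d₁.1 < 0 <;> by_cases b : d₂.1 < 0 <;> by_cases c : d₃.1 < 0 <;>
    simp [a, b, c] <;> decide

end RayParity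

open Filter Topology

namespace RayParity

/-- The corners of a simple polygonal chain with `n` segments. -/
structure IsChain (n : ℕ) (p : ℕ → ℝ × ℝ) : Prop where
  pos : 0 < n
  ne : ∀ i < n, p i ≠ p (i + 1)
  inter : ∀ i, i + 1 < n →
    segment ℝ (p i) (p (i + 1)) ∩ segment ℝ (p (i + 1)) (p (i + 2)) = {p (i + 1)}
  disj : ∀ i j, i + 1 < j → j < n →
    Disjoint (segment ℝ (p i) (p (i + 1))) (segment ℝ (p j) (p (j + 1)))

/-- The union of the segments of a chain. -/
def carrier (n : ℕ) (p : ℕ → ℝ × ℝ) : Set (ℝ × ℝ) := ⋃ i < n, segment ℝ (p i) (p (i + 1))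

/-- The parity of the crossings of a chain with the upward vertical ray at a point. -/
noncomputable def chainCross (n : ℕ) (p : ℕ → ℝ × ℝ) (q : ℝ × ℝ) : ZMod 2 :=
  ∑ i ∈ Finset.range n, cross (p i) (p (i + 1)) q

theorem mem_carrier {n : ℕ} {p : ℕ → ℝ × ℝ} {q : ℝ × ℝ} :
    q ∈ carrier n p ↔ ∃ i < n, q ∈ segment ℝ (p i) (p (i + 1)) := by
  simp [carrier]

theorem segment_reflect {n : ℕ} (p : ℕ → ℝ × ℝ) {i : ℕ} (hi : i < n) :
    segment ℝ (p (n - i)) (p (n - (i + 1))) =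
      segment ℝ (p (n - 1 - i)) (p (n - 1 - i + 1)) := by
  rw [segment_symm, show n - (i + 1) = n - 1 - i by omega, show n - i = n - 1 - i + 1 by omega]

theorem IsChain.reflect {n : ℕ} {p : ℕ → ℝ × ℝ} (h : IsChain n p) :
    IsChain n fun i => p (n - i) where
  pos := h.pos
  ne i hi := by
    have := h.ne (n - (i + 1)) (by omega)
    rw [show n - (i + 1) + 1 = n - i by omega] at this
    exact this.symm
  inter i hi := by
    have := h.inter (n - (i + 2)) (by omega)
    rw [show n - (i + 2) + 1 = n - (i + 1) by omega,
      show n - (i + 2) + 2 = n - i by omega] at this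
    rw [Set.inter_comm, segment_symm, segment_symm ℝ (p (n - i))]
    exact this
  disj i j hij hj := by
    rw [segment_reflect p (by omega), segment_reflect p hj]
    exact (h.disj (n - 1 - j) (n - 1 - i) (by omega) (by omega)).symm

theorem carrier_reflect (n : ℕ) (p : ℕ → ℝ × ℝ) :
    carrier n (fun i => p (n - i)) = carrier n p := by
  ext q
  simp only [mem_carrier]
  constructor
  · rintro ⟨i, hi, h⟩
    rw [segment_reflect p hi] at h
    exact ⟨n - 1 - i, by omega, h⟩
  · rintro ⟨i, hi, h⟩
    refine ⟨n - 1 - i, by omega, ?_⟩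
    rw [segment_reflect p (by omega), show n - 1 - (n - 1 - i) = i by omega]
    exact h

theorem chainCross_reflect (n : ℕ) (p : ℕ → ℝ × ℝ) (q : ℝ × ℝ) :
    chainCross n (fun i => p (n - i)) q = chainCross n p q := by
  rw [chainCross, chainCross, ← Finset.sum_range_reflect]
  refine Finset.sum_congr rfl fun i hi => ?_
  have hi' := Finset.mem_range.1 hi
  rw [show n - (n - 1 - i) = i + 1 by omega, show n - (n - 1 - i + 1) = i by omega, cross_comm]

theorem chainCross_add_endTerm {n : ℕ} {p : ℕ → ℝ × ℝ} {q : ℝ × ℝ} (hq : q ∉ carrier n p) :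
    ∀ᶠ z in 𝓝 q, chainCross n p z + endTerm q (p 0) z + endTerm q (p n) z =
      chainCross n p q + endTerm q (p 0) q + endTerm q (p n) q := by
  induction n with
  | zero =>
    refine Eventually.of_forall fun z => ?_
    simp only [chainCross, Finset.range_zero, Finset.sum_empty, zero_add, add_self]
  | succ n ih =>
    have h1 : q ∉ carrier n p := fun h => by
      obtain ⟨i, hi, h⟩ := mem_carrier.1 h
      exact hq (mem_carrier.2 ⟨i, by omega, h⟩)
    have h2 : q ∉ segment ℝ (p n) (p (n + 1)) := fun h => hq (mem_carrier.2 ⟨n, by omega, h⟩)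
    filter_upwards [ih h1, cross_add_endTerm h2] with z e1 e2
    have e3 : ∀ z, chainCross (n + 1) p z + endTerm q (p 0) z + endTerm q (p (n + 1)) z =
        (chainCross n p z + endTerm q (p 0) z + endTerm q (p n) z) +
        (cross (p n) (p (n + 1)) z + endTerm q (p n) z + endTerm q (p (n + 1)) z) := by
      intro z
      have h0 := add_self (endTerm q (p n) z)
      rw [chainCross, Finset.sum_range_succ]
      change chainCross n p z + _ + _ + _ = _
      linear_combination -h0
    rw [e3, e3, e1, e2]

theorem isPreconnected_segments (p : ℕ → ℝ × ℝ) (j m : ℕ) :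
    IsPreconnected (⋃ i, ⋃ (_ : j ≤ i ∧ i < j + m), segment ℝ (p i) (p (i + 1))) := by
  have key : IsPreconnected
      ({p j} ∪ ⋃ i, ⋃ (_ : j ≤ i ∧ i < j + m), segment ℝ (p i) (p (i + 1))) ∧
      p (j + m) ∈ {p j} ∪ ⋃ i, ⋃ (_ : j ≤ i ∧ i < j + m), segment ℝ (p i) (p (i + 1)) := by
    induction m with
    | zero =>
      have : (⋃ i, ⋃ (_ : j ≤ i ∧ i < j + 0), segment ℝ (p i) (p (i + 1))) = ∅ := by
        ext z; simp
      rw [this]; simp [isPreconnected_singleton]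
    | succ m ih =>
      have e : ({p j} ∪ ⋃ i, ⋃ (_ : j ≤ i ∧ i < j + (m + 1)), segment ℝ (p i) (p (i + 1))) =
          ({p j} ∪ ⋃ i, ⋃ (_ : j ≤ i ∧ i < j + m), segment ℝ (p i) (p (i + 1))) ∪
            segment ℝ (p (j + m)) (p (j + m + 1)) := by
        ext z
        simp only [Set.mem_union, Set.mem_iUnion, Set.mem_singleton_iff]
        constructor
        · rintro (h | ⟨i, hi, h⟩)
          · exact Or.inl (Or.inl h)
          · by_cases h' : i = j + m
            · exact Or.inr (h' ▸ h)
            · exact Or.inl (Or.inr ⟨i, by omega, h⟩)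
        · rintro ((h | ⟨i, hi, h⟩) | h)
          · exact Or.inl h
          · exact Or.inr ⟨i, by omega, h⟩
          · exact Or.inr ⟨j + m, by omega, h⟩
      rw [e]
      exact ⟨ih.1.union _ ih.2 (left_mem_segment ℝ _ _) (convex_segment _ _).isPreconnected,
        Or.inr (right_mem_segment ℝ _ _)⟩
  rcases Nat.eq_zero_or_pos m with rfl | hm
  · have : (⋃ i, ⋃ (_ : j ≤ i ∧ i < j + 0), segment ℝ (p i) (p (i + 1))) = ∅ := by
      ext z; simp
    rw [this]; exact isPreconnected_empty
  · have : p j ∈ ⋃ i, ⋃ (_ : j ≤ i ∧ i < j + m), segment ℝ (p i) (p (i + 1)) :=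
      Set.mem_iUnion₂.2 ⟨j, ⟨le_rfl, by omega⟩, left_mem_segment ℝ _ _⟩
    rw [Set.union_eq_self_of_subset_left (Set.singleton_subset_iff.2 this)] at key
    exact key.1

theorem isPreconnected_segment_diff {x y : ℝ × ℝ} (h : x ≠ y) :
    IsPreconnected (segment ℝ x y \ {x}) := by
  have : segment ℝ x y \ {x} = (fun θ : ℝ => x + θ • (y - x)) '' Set.Ioc 0 1 := by
    rw [segment_eq_image']
    ext z
    constructor
    · rintro ⟨⟨θ, ⟨h0, h1⟩, rfl⟩, hz⟩
      refine ⟨θ, ⟨lt_of_le_of_ne h0 ?_, h1⟩, rfl⟩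
      rintro rfl
      simp at hz
    · rintro ⟨θ, ⟨h0, h1⟩, rfl⟩
      refine ⟨⟨θ, ⟨h0.le, h1⟩, rfl⟩, ?_⟩
      simp only [Set.mem_singleton_iff, add_eq_left, smul_eq_zero, sub_eq_zero, not_or]
      exact ⟨h0.ne', h.symm⟩
  rw [this]
  exact isPreconnected_Ioc.image _ (by fun_prop)

theorem IsChain.isPreconnected_diff {n : ℕ} {p : ℕ → ℝ × ℝ} (h : IsChain n p) :
    IsPreconnected (carrier n p \ {p 0}) := by
  have hp := h.pos
  have hne := h.ne 0 hp
  have e : carrier n p \ {p 0} = (segment ℝ (p 0) (p 1) \ {p 0}) ∪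
      ⋃ i, ⋃ (_ : 1 ≤ i ∧ i < 1 + (n - 1)), segment ℝ (p i) (p (i + 1)) := by
    ext z
    simp only [Set.mem_sdiff, mem_carrier, Set.mem_union, Set.mem_iUnion, Set.mem_singleton_iff]
    constructor
    · rintro ⟨⟨i, hi, hz⟩, hz0⟩
      rcases Nat.eq_zero_or_pos i with rfl | hi0
      · exact Or.inl ⟨hz, hz0⟩
      · exact Or.inr ⟨i, by omega, hz⟩
    · rintro (⟨hz, hz0⟩ | ⟨i, hi, hz⟩)
      · exact ⟨⟨0, hp, hz⟩, hz0⟩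
      · refine ⟨⟨i, by omega, hz⟩, ?_⟩
        rintro rfl
        have h0 : p 0 ∈ segment ℝ (p 0) (p 1) := left_mem_segment ℝ _ _
        by_cases hi1 : i = 1
        · subst hi1
          have := (h.inter 0 (by omega)).subset ⟨h0, hz⟩
          exact hne this
        · exact Set.disjoint_left.1 (h.disj 0 i (by omega) (by omega)) h0 hz
  rw [e]
  rcases Nat.lt_or_ge 1 n with hn | hn
  · exact (isPreconnected_segment_diff hne).union (p 1)
      ⟨right_mem_segment ℝ _ _, hne.symm⟩
      (Set.mem_iUnion₂.2 ⟨1, by omega, left_mem_segment ℝ _ _⟩)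
      (isPreconnected_segments p 1 (n - 1))
  · have : (⋃ i, ⋃ (_ : 1 ≤ i ∧ i < 1 + (n - 1)), segment ℝ (p i) (p (i + 1))) = ∅ := by
      ext z; simp; omega
    rw [this, Set.union_empty]
    exact isPreconnected_segment_diff hne

theorem tendsto_ray (u e : ℝ × ℝ) :
    Tendsto (fun t : ℝ => u + t • e) (𝓝[>] 0) (𝓝 u) := by
  have hcont : Continuous fun t : ℝ => u + t • e := by fun_prop
  have := hcont.tendsto 0
  simp only [zero_smul, add_zero] at this
  exact this.mono_left nhdsWithin_le_nhds

/-- Near its end `x` the curve `A` is a segment in direction `d`, and `c` varies accordingly. -/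
def HasDir (A : Set (ℝ × ℝ)) (c : ℝ × ℝ → ZMod 2) (x y d : ℝ × ℝ) : Prop :=
  d ≠ 0 ∧ (∀ s ∈ Set.Icc (0 : ℝ) 1, x + s • d ∈ A) ∧
    ∃ K, ∀ e, ∀ᶠ t in 𝓝[>] (0 : ℝ),
      c (x + t • e) + endTerm x y (x + t • e) = dirTerm d e + K

theorem IsChain.hasDir {n : ℕ} {p : ℕ → ℝ × ℝ} (h : IsChain n p) :
    HasDir (carrier n p) (chainCross n p) (p 0) (p n) (p 1 - p 0) := by
  have hp := h.pos
  have hne := h.ne 0 hp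
  obtain ⟨m, rfl⟩ : ∃ m, n = m + 1 := ⟨n - 1, by omega⟩
  refine ⟨sub_ne_zero.2 hne.symm, fun s hs => mem_carrier.2 ⟨0, hp, ?_⟩, ?_⟩
  · rw [segment_eq_image']; exact ⟨s, hs, rfl⟩
  · have hq : p 0 ∉ carrier m fun i => p (i + 1) := by
      intro hz
      obtain ⟨i, hi, hz⟩ := mem_carrier.1 hz
      have h0 : p 0 ∈ segment ℝ (p 0) (p 1) := left_mem_segment ℝ _ _
      rcases Nat.eq_zero_or_pos i with rfl | hi0
      · exact hne ((h.inter 0 (by omega)).subset ⟨h0, hz⟩)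
      · exact Set.disjoint_left.1 (h.disj 0 (i + 1) (by omega) (by omega)) h0 hz
    refine ⟨chainCross m (fun i => p (i + 1)) (p 0) + endTerm (p 0) (p 1) (p 0) +
      endTerm (p 0) (p (m + 1)) (p 0), fun e => ?_⟩
    filter_upwards [(tendsto_ray (p 0) e).eventually (chainCross_add_endTerm hq),
      cross_ray (p 0) (p 1) e] with t e1 e2
    have e3 : chainCross (m + 1) p (p 0 + t • e) =
        chainCross m (fun i => p (i + 1)) (p 0 + t • e) + cross (p 0) (p 1) (p 0 + t • e) := by
      rw [chainCross, Finset.sum_range_succ']; rfl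
    rw [e3, ← e2, ← e1]
    have h0 := add_self (endTerm (p 0) (p 1) (p 0 + t • e))
    linear_combination -h0

/-- The properties of a simple polygonal arc `A` with crossing parity `c` that are used below. -/
structure RayArc (A : Set (ℝ × ℝ)) (x y : ℝ × ℝ) (c : ℝ × ℝ → ZMod 2) : Prop where
  left_mem : x ∈ A
  right_mem : y ∈ A
  preconn : IsPreconnected A
  preconn_left : IsPreconnected (A \ {x})
  preconn_right : IsPreconnected (A \ {y})
  locConst : ∀ q ∉ A, ∀ᶠ z in 𝓝 q, c z + endTerm q x z + endTerm q y z =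
    c q + endTerm q x q + endTerm q y q
  dir_left : ∃ d, HasDir A c x y d
  dir_right : ∃ d, HasDir A c y x d

theorem RayArc.symm {A : Set (ℝ × ℝ)} {x y : ℝ × ℝ} {c : ℝ × ℝ → ZMod 2} (h : RayArc A x y c) :
    RayArc A y x c :=
  ⟨h.right_mem, h.left_mem, h.preconn, h.preconn_right, h.preconn_left, fun q hq => by
    simpa only [add_right_comm] using h.locConst q hq, h.dir_right, h.dir_left⟩

theorem exists_rayArc {A : Set (ℝ × ℝ)} {x y : ℝ × ℝ} (h : IsPolygonalArc A x y) :
    ∃ c, RayArc A x y c := by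
  obtain ⟨n, p, hn, rfl, rfl, h1, h2, h3, rfl⟩ := h
  have hc : IsChain n p := ⟨hn, h1, h2, h3⟩
  change ∃ c, RayArc (carrier n p) _ _ c
  refine ⟨chainCross n p, mem_carrier.2 ⟨0, hn, left_mem_segment ℝ _ _⟩,
    mem_carrier.2 ⟨n - 1, by omega, ?_⟩, ?_, hc.isPreconnected_diff, ?_,
    fun q hq => chainCross_add_endTerm hq, ⟨_, hc.hasDir⟩, ?_⟩
  · rw [show n - 1 + 1 = n by omega]; exact right_mem_segment ℝ _ _
  · have := isPreconnected_segments p 0 n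
    simpa [carrier] using this
  · have := hc.reflect.isPreconnected_diff
    rwa [carrier_reflect, Nat.sub_zero] at this
  · have := hc.reflect.hasDir
    rw [carrier_reflect, Nat.sub_zero, Nat.sub_self,
      funext (chainCross_reflect n p)] at this
    exact ⟨_, this⟩

end RayParity

open Filter Topology

namespace PlaneDrawing

open RayParity SimpleGraph

variable {V : Type*} {G : SimpleGraph V} (D : PlaneDrawing G)

theorem exists_arcCross : ∃ c : Sym2 V → ℝ × ℝ → ZMod 2, ∀ u v, G.Adj u v →
    RayArc (D.arc s(u, v)) (D.pos u) (D.pos v) (c s(u, v)) := by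
  have key : ∀ e : Sym2 V, ∃ c : ℝ × ℝ → ZMod 2, ∀ u v, G.Adj u v → e = s(u, v) →
      RayArc (D.arc s(u, v)) (D.pos u) (D.pos v) c := by
    intro e
    induction e using Sym2.ind with
    | _ x y =>
      by_cases h : G.Adj x y
      · obtain ⟨c, hc⟩ := exists_rayArc (D.isPolygonalArc x y h)
        refine ⟨c, fun u v _ he => ?_⟩
        rcases Sym2.eq_iff.1 he with ⟨rfl, rfl⟩ | ⟨rfl, rfl⟩
        · exact hc
        · rw [Sym2.eq_swap]; exact hc.symm
      · refine ⟨0, fun u v huv he => absurd ?_ h⟩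
        rwa [← mem_edgeSet, he, mem_edgeSet]
  choose c hc using key
  exact ⟨c, fun u v h => hc _ u v h rfl⟩

/-- A crossing parity for each edge of the drawing. -/
noncomputable def arcCross : Sym2 V → ℝ × ℝ → ZMod 2 := D.exists_arcCross.choose

theorem rayArc {u v : V} (h : G.Adj u v) :
    RayArc (D.arc s(u, v)) (D.pos u) (D.pos v) (D.arcCross s(u, v)) :=
  D.exists_arcCross.choose_spec u v h

/-- The points of the drawing of a walk. -/
def walkCarrier : ∀ {u v : V}, G.Walk u v → Set (ℝ × ℝ)
  | u, _, .nil => {D.pos u}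
  | u, _, .cons (v := u') _ p => D.arc s(u, u') ∪ walkCarrier p

/-- The crossing parity of a walk. -/
noncomputable def walkCross : ∀ {u v : V}, G.Walk u v → ℝ × ℝ → ZMod 2
  | _, _, .nil => fun _ => 0
  | u, _, .cons (v := u') _ p => fun q => D.arcCross s(u, u') q + walkCross p q

theorem pos_start_mem_walkCarrier {u v : V} (w : G.Walk u v) : D.pos u ∈ D.walkCarrier w := by
  cases w with
  | nil => exact rfl
  | cons h p => exact Or.inl (D.rayArc h).left_mem

theorem pos_mem_walkCarrier {u v x : V} (w : G.Walk u v) (hx : x ∈ w.support) :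
    D.pos x ∈ D.walkCarrier w := by
  induction w with
  | nil => simp only [Walk.support_nil, List.mem_singleton] at hx; exact hx ▸ rfl
  | cons h p ih =>
    rcases List.mem_cons.1 hx with rfl | hx
    · exact Or.inl (D.rayArc h).left_mem
    · exact Or.inr (ih hx)

theorem mem_walkCarrier {u v : V} (w : G.Walk u v) {z : ℝ × ℝ} (hz : z ∈ D.walkCarrier w) :
    (∃ x ∈ w.support, z = D.pos x) ∨ ∃ e ∈ w.edges, z ∈ D.arc e := by
  induction w with
  | nil => exact Or.inl ⟨_, by simp, hz⟩
  | cons h p ih =>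
    rcases hz with hz | hz
    · exact Or.inr ⟨_, by simp, hz⟩
    · rcases ih hz with ⟨x, hx, rfl⟩ | ⟨e, he, hz⟩
      · exact Or.inl ⟨x, by simp [hx], rfl⟩
      · exact Or.inr ⟨e, by simp [he], hz⟩

theorem mem_support_of_pos_mem {u v x : V} (w : G.Walk u v) (hx : D.pos x ∈ D.walkCarrier w) :
    x ∈ w.support := by
  rcases D.mem_walkCarrier w hx with ⟨y, hy, h⟩ | ⟨e, he, h⟩
  · exact D.pos_injective h ▸ hy
  · exact w.mem_support_of_mem_edges he (D.mem_of_pos_mem_arc e (w.edges_subset_edgeSet he) x h)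

theorem mem_walkCarrier_inter {u v u' v' : V} (w : G.Walk u v) (w' : G.Walk u' v') {z : ℝ × ℝ}
    (hz : z ∈ D.walkCarrier w) (hz' : z ∈ D.walkCarrier w') :
    (∃ x ∈ w.support, x ∈ w'.support ∧ z = D.pos x) ∨ ∃ e ∈ w.edges, e ∈ w'.edges := by
  rcases D.mem_walkCarrier w hz with ⟨x, hx, rfl⟩ | ⟨e, he, h⟩
  · exact Or.inl ⟨x, hx, D.mem_support_of_pos_mem w' hz', rfl⟩
  · rcases D.mem_walkCarrier w' hz' with ⟨x, hx, rfl⟩ | ⟨e', he', h'⟩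
    · exact Or.inl ⟨x, D.mem_support_of_pos_mem w hz, hx, rfl⟩
    · by_cases hee : e = e'
      · exact Or.inr ⟨e, he, hee ▸ he'⟩
      · obtain ⟨x, hx, rfl⟩ := D.arc_inter e (w.edges_subset_edgeSet he) e'
          (w'.edges_subset_edgeSet he') hee z h h'
        exact Or.inl ⟨x, w.mem_support_of_mem_edges he hx, D.mem_support_of_pos_mem w' hz', rfl⟩

theorem walkCross_add_endTerm {u v : V} (w : G.Walk u v) {q : ℝ × ℝ} (hq : q ∉ D.walkCarrier w) :
    ∀ᶠ z in 𝓝 q, D.walkCross w z + endTerm q (D.pos u) z + endTerm q (D.pos v) z =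
      D.walkCross w q + endTerm q (D.pos u) q + endTerm q (D.pos v) q := by
  induction w with
  | nil =>
    refine Eventually.of_forall fun z => ?_
    simp only [walkCross, zero_add, add_self]
  | @cons a b c h p ih =>
    filter_upwards [ih fun hh => hq (Or.inr hh), (D.rayArc h).locConst q fun hh => hq (Or.inl hh)]
      with z e1 e2
    have e3 : ∀ z, D.walkCross (.cons h p) z + endTerm q (D.pos a) z + endTerm q (D.pos c) z =
        (D.walkCross p z + endTerm q (D.pos b) z + endTerm q (D.pos c) z) +
        (D.arcCross s(a, b) z + endTerm q (D.pos a) z + endTerm q (D.pos b) z) := by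
      intro z
      have h0 := add_self (endTerm q (D.pos b) z)
      rw [walkCross]
      linear_combination -h0
    rw [e3, e3, e1, e2]

theorem isPreconnected_walkCarrier {u v : V} (w : G.Walk u v) :
    IsPreconnected (D.walkCarrier w) := by
  induction w with
  | nil => exact isPreconnected_singleton
  | cons h p ih =>
    exact (D.rayArc h).preconn.union _ (D.rayArc h).right_mem (D.pos_start_mem_walkCarrier p) ih

theorem isPreconnected_walkCarrier_diff {u v : V} {w : G.Walk u v} (hw : w.IsPath) :
    IsPreconnected (D.walkCarrier w \ {D.pos u}) := by
  cases w with
  | nil => simp [walkCarrier, isPreconnected_empty]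
  | @cons _ b _ h p =>
    obtain ⟨-, hu⟩ := (Walk.cons_isPath_iff h p).1 hw
    have hu' : D.pos u ∉ D.walkCarrier p := fun h => hu (D.mem_support_of_pos_mem p h)
    rw [walkCarrier, Set.union_sdiff_distrib, Set.sdiff_singleton_eq_self hu']
    refine (D.rayArc h).preconn_left.union (D.pos b) ⟨(D.rayArc h).right_mem, ?_⟩
      (D.pos_start_mem_walkCarrier p) (D.isPreconnected_walkCarrier p)
    exact fun hh => h.ne (D.pos_injective hh).symm

theorem eq_of_locConst {S : Set (ℝ × ℝ)} (hS : IsPreconnected S) {f : ℝ × ℝ → ZMod 2}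
    (hf : ∀ q ∈ S, ∀ᶠ z in 𝓝 q, f z = f q) {x y : ℝ × ℝ} (hx : x ∈ S) (hy : y ∈ S) :
    f x = f y := by
  refine hS.constant (fun q hq => ?_) hx hy
  have : f =ᶠ[𝓝 q] fun _ => f q := hf q hq
  exact (continuousAt_const.congr this.symm).continuousWithinAt

theorem walkCross_add_walkCross {u v : V} (w w' : G.Walk u v) {q : ℝ × ℝ}
    (h : q ∉ D.walkCarrier w) (h' : q ∉ D.walkCarrier w') :
    ∀ᶠ z in 𝓝 q, D.walkCross w z + D.walkCross w' z = D.walkCross w q + D.walkCross w' q := by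
  filter_upwards [D.walkCross_add_endTerm w h, D.walkCross_add_endTerm w' h'] with z e e'
  have a1 := add_self (endTerm q (D.pos u) z)
  have a2 := add_self (endTerm q (D.pos v) z)
  have a3 := add_self (endTerm q (D.pos u) q)
  have a4 := add_self (endTerm q (D.pos v) q)
  linear_combination e + e' - a1 - a2 + a3 + a4

theorem walkCarrier_takeUntil_subset [DecidableEq V] {u v x : V} (w : G.Walk u v)
    (hx : x ∈ w.support) : D.walkCarrier (w.takeUntil x hx) ⊆ D.walkCarrier w := by
  intro z hz
  induction w with
  | nil =>
    have hx' := hx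
    simp only [Walk.support_nil, List.mem_singleton] at hx'
    subst hx'
    simpa [Walk.takeUntil] using hz
  | @cons a b c h p ih =>
    by_cases hax : a = x
    · subst hax
      simp only [Walk.takeUntil_first] at hz
      rw [Set.mem_singleton_iff.1 hz]
      exact D.pos_start_mem_walkCarrier _
    · have hx' : x ∈ p.support := by
        rcases List.mem_cons.1 hx with h | h
        · exact absurd h.symm hax
        · exact h
      rw [Walk.takeUntil_cons hx' hax] at hz
      rcases hz with hz | hz
      · exact Or.inl hz
      · exact Or.inr (ih hx' hz)

/-- The initial direction of a path, with the behaviour of its crossing parity. -/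
theorem exists_dir {a b n : V} {w : G.Walk a b} (hw : w.IsPath) (hn : n ∈ w.support)
    (hna : n ≠ a) (hnb : n ≠ b) :
    ∃ (a' : V) (d : ℝ × ℝ), s(a, a') ∈ w.edges ∧ d ≠ 0 ∧
      (∀ s ∈ Set.Icc (0 : ℝ) 1, D.pos a + s • d ∈ D.arc s(a, a')) ∧
      (∃ K, ∀ e, ∀ᶠ t in 𝓝[>] (0 : ℝ), D.walkCross w (D.pos a + t • e) +
        endTerm (D.pos a) (D.pos b) (D.pos a + t • e) = dirTerm d e + K) ∧
      ∀ f : ℝ × ℝ → ZMod 2, (∀ z ∈ D.walkCarrier w, z ≠ D.pos a → z ≠ D.pos b →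
        ∀ᶠ z' in 𝓝 z, f z' = f z) → ∀ᶠ t in 𝓝[>] (0 : ℝ), f (D.pos a + t • d) = f (D.pos n) := by
  classical
  cases w with
  | nil => simp only [Walk.support_nil, List.mem_singleton] at hn; exact absurd hn hna
  | @cons _ a' _ h p =>
    obtain ⟨d, hd0, hd1, K, hK⟩ := (D.rayArc h).dir_left
    obtain ⟨hp, ha⟩ := (Walk.cons_isPath_iff h p).1 hw
    have ha' : D.pos a ∉ D.walkCarrier p := fun h => ha (D.mem_support_of_pos_mem p h)
    have hn' : n ∈ p.support := by
      rcases List.mem_cons.1 hn with h | h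
      · exact absurd h hna
      · exact h
    refine ⟨a', d, by simp, hd0, hd1, ?_, fun f hf => ?_⟩
    · refine ⟨K + (D.walkCross p (D.pos a) + endTerm (D.pos a) (D.pos a') (D.pos a) +
        endTerm (D.pos a) (D.pos b) (D.pos a)), fun e => ?_⟩
      filter_upwards [hK e, (tendsto_ray (D.pos a) e).eventually (D.walkCross_add_endTerm p ha')]
        with t e1 e2
      rw [← e2, ← add_assoc, ← e1, walkCross]
      have h0 := add_self (endTerm (D.pos a) (D.pos a') (D.pos a + t • e))
      linear_combination -h0
    · have hA : ((Walk.cons h p).takeUntil n hn).IsPath := hw.takeUntil hn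
      have hsub := D.walkCarrier_takeUntil_subset _ hn
      have hpre := D.isPreconnected_walkCarrier_diff hA
      have hb : b ∉ ((Walk.cons h p).takeUntil n hn).support :=
        Walk.endpoint_notMem_support_takeUntil hw hn hnb.symm
      have hmem : ∀ t ∈ Set.Ioc (0 : ℝ) 1,
          D.pos a + t • d ∈ D.walkCarrier ((Walk.cons h p).takeUntil n hn) \ {D.pos a} := by
        rintro t ⟨h0, h1⟩
        refine ⟨?_, ?_⟩
        · rw [Walk.takeUntil_cons hn' hna.symm]
          exact Or.inl (hd1 t ⟨h0.le, h1⟩)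
        · simp only [Set.mem_singleton_iff, add_eq_left, smul_eq_zero, not_or]
          exact ⟨h0.ne', hd0⟩
      filter_upwards [Ioc_mem_nhdsGT (zero_lt_one' ℝ)] with t ht
      refine eq_of_locConst hpre (fun q hq => hf q (hsub hq.1) hq.2 ?_) (hmem t ht)
        ⟨D.pos_mem_walkCarrier _ (Walk.end_mem_support _), fun hh => hna (D.pos_injective hh)⟩
      rintro rfl
      exact hb (D.mem_support_of_pos_mem _ hq.1)

theorem notParallel {a a₁ a₂ : V} {d₁ d₂ : ℝ × ℝ} (h1 : G.Adj a a₁) (h2 : G.Adj a a₂)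
    (hne : a₁ ≠ a₂) (hd : d₁ ≠ 0)
    (hd1 : ∀ s ∈ Set.Icc (0 : ℝ) 1, D.pos a + s • d₁ ∈ D.arc s(a, a₁))
    (hd2 : ∀ s ∈ Set.Icc (0 : ℝ) 1, D.pos a + s • d₂ ∈ D.arc s(a, a₂)) : NotParallel d₁ d₂ := by
  intro s hs h
  obtain ⟨t, t', ht, ht1, ht', htt⟩ : ∃ t t' : ℝ, 0 < t ∧ t ≤ 1 ∧ t' ∈ Set.Icc (0 : ℝ) 1 ∧
      t • d₁ = t' • d₂ := by
    rcases le_total s 1 with hs1 | hs1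
    · exact ⟨1, s, one_pos, le_rfl, ⟨hs.le, hs1⟩, by rw [one_smul, h]⟩
    · refine ⟨1 / s, 1, by positivity, (div_le_one hs).2 hs1, ⟨zero_le_one, le_rfl⟩, ?_⟩
      rw [h, smul_smul, one_div_mul_cancel hs.ne']
  have hne' : s(a, a₁) ≠ s(a, a₂) := by
    intro h
    rcases Sym2.eq_iff.1 h with ⟨-, h⟩ | ⟨h3, h4⟩
    · exact hne h
    · exact h1.ne h4.symm
  have m1 := hd1 t ⟨ht.le, ht1⟩
  have m2 : D.pos a + t • d₁ ∈ D.arc s(a, a₂) := htt ▸ hd2 t' ht'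
  obtain ⟨w, hw, hw'⟩ := D.arc_inter _ h1 _ h2 hne' _ m1 m2
  have hw2 := D.mem_of_pos_mem_arc _ h2 w (hw' ▸ m2)
  have : w = a := by
    rcases Sym2.mem_iff.1 hw with h | h
    · exact h
    · rcases Sym2.mem_iff.1 hw2 with h' | h'
      · exact h'
      · exact absurd (h.symm.trans h') hne
  rw [this, add_eq_left, smul_eq_zero] at hw'
  rcases hw' with h | h
  · exact ht.ne' h
  · exact hd h

end PlaneDrawing

open Filter Topology

namespace SimpleGraph.Walk

variable {V : Type*} {G : SimpleGraph V}

theorem IsPath.support_subset_of_mem_edges {a b : V} {w : G.Walk a b} (hw : w.IsPath)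
    (h : s(a, b) ∈ w.edges) : ∀ x ∈ w.support, x = a ∨ x = b := by
  cases w with
  | nil => simp at h
  | @cons _ c _ hac p =>
    obtain ⟨hp, ha⟩ := (cons_isPath_iff hac p).1 hw
    rw [edges_cons, List.mem_cons] at h
    rcases h with h | h
    · have hbc : b = c := by
        rcases Sym2.eq_iff.1 h with ⟨-, h⟩ | ⟨h1, h2⟩
        · exact h
        · exact absurd h1 hac.ne
      subst hbc
      rw [isPath_iff_nil] at hp
      rw [hp.eq_nil]
      simp
    · exact absurd (p.fst_mem_support_of_mem_edges h) ha

/-- Two paths with the same ends and no other common vertex. -/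
def InternallyDisjoint {a b : V} (w w' : G.Walk a b) : Prop :=
  ∀ x ∈ w.support, x ∈ w'.support → x = a ∨ x = b

theorem InternallyDisjoint.symm {a b : V} {w w' : G.Walk a b} (h : w.InternallyDisjoint w') :
    w'.InternallyDisjoint w := fun x hx hx' => h x hx' hx

theorem InternallyDisjoint.notMem_edges {a b n : V} {w w' : G.Walk a b}
    (h : w.InternallyDisjoint w') (hw : w.IsPath) (hn : n ∈ w.support) (hna : n ≠ a)
    (hnb : n ≠ b) {e : Sym2 V} (he : e ∈ w.edges) : e ∉ w'.edges := by
  intro he'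
  induction e using Sym2.ind with
  | _ x y =>
    have hxy : x ≠ y := (w.adj_of_mem_edges he).ne
    have key : s(x, y) = s(a, b) := by
      rcases h x (w.fst_mem_support_of_mem_edges he) (w'.fst_mem_support_of_mem_edges he') with
        rfl | rfl <;>
      rcases h y (w.snd_mem_support_of_mem_edges he) (w'.snd_mem_support_of_mem_edges he') with
        rfl | rfl
      · exact absurd rfl hxy
      · rfl
      · exact Sym2.eq_swap
      · exact absurd rfl hxy
    rcases hw.support_subset_of_mem_edges (key ▸ he) n hn with h | h
    · exact hna h
    · exact hnb h

end SimpleGraph.Walk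

namespace PlaneDrawing

open RayParity SimpleGraph

variable {V : Type*} {G : SimpleGraph V} (D : PlaneDrawing G)

/-- The crossing parity of the closed curve formed by two walks with common ends. -/
noncomputable def pairCross {a b : V} (w w' : G.Walk a b) (q : ℝ × ℝ) : ZMod 2 :=
  D.walkCross w q + D.walkCross w' q

theorem notMem_walkCarrier {a b n : V} {w w' : G.Walk a b} (h : w.InternallyDisjoint w')
    (hw : w.IsPath) (hn : n ∈ w.support) (hna : n ≠ a) (hnb : n ≠ b) {z : ℝ × ℝ}
    (hz : z ∈ D.walkCarrier w) (hza : z ≠ D.pos a) (hzb : z ≠ D.pos b) :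
    z ∉ D.walkCarrier w' := by
  intro hz'
  rcases D.mem_walkCarrier_inter w w' hz hz' with ⟨x, hx, hx', rfl⟩ | ⟨e, he, he'⟩
  · rcases h x hx hx' with rfl | rfl
    · exact hza rfl
    · exact hzb rfl
  · exact h.notMem_edges hw hn hna hnb he he'

theorem theta {a b n₁ n₂ n₃ : V} {w₁ w₂ w₃ : G.Walk a b} (h₁ : w₁.IsPath) (h₂ : w₂.IsPath)
    (h₃ : w₃.IsPath) (h12 : w₁.InternallyDisjoint w₂) (h13 : w₁.InternallyDisjoint w₃)
    (h23 : w₂.InternallyDisjoint w₃) (m₁ : n₁ ∈ w₁.support) (m₂ : n₂ ∈ w₂.support)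
    (m₃ : n₃ ∈ w₃.support) (a₁ : n₁ ≠ a) (a₂ : n₂ ≠ a) (a₃ : n₃ ≠ a) (b₁ : n₁ ≠ b)
    (b₂ : n₂ ≠ b) (b₃ : n₃ ≠ b) :
    D.pairCross w₂ w₃ (D.pos n₁) + D.pairCross w₁ w₃ (D.pos n₂) +
      D.pairCross w₁ w₂ (D.pos n₃) = 1 := by
  obtain ⟨a₁', d₁, e₁, hd₁, hs₁, ⟨K₁, hK₁⟩, c₁⟩ := D.exists_dir h₁ m₁ a₁ b₁
  obtain ⟨a₂', d₂, e₂, hd₂, hs₂, ⟨K₂, hK₂⟩, c₂⟩ := D.exists_dir h₂ m₂ a₂ b₂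
  obtain ⟨a₃', d₃, e₃, hd₃, hs₃, ⟨K₃, hK₃⟩, c₃⟩ := D.exists_dir h₃ m₃ a₃ b₃
  have p12 : NotParallel d₁ d₂ := D.notParallel (w₁.adj_of_mem_edges e₁) (w₂.adj_of_mem_edges e₂)
    (fun h => h12.notMem_edges h₁ m₁ a₁ b₁ e₁ (h ▸ e₂)) hd₁ hs₁ hs₂
  have p13 : NotParallel d₁ d₃ := D.notParallel (w₁.adj_of_mem_edges e₁) (w₃.adj_of_mem_edges e₃)
    (fun h => h13.notMem_edges h₁ m₁ a₁ b₁ e₁ (h ▸ e₃)) hd₁ hs₁ hs₃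
  have p23 : NotParallel d₂ d₃ := D.notParallel (w₂.adj_of_mem_edges e₂) (w₃.adj_of_mem_edges e₃)
    (fun h => h23.notMem_edges h₂ m₂ a₂ b₂ e₂ (h ▸ e₃)) hd₂ hs₂ hs₃
  have f₁ := c₁ (D.pairCross w₂ w₃) fun z hz hza hzb => D.walkCross_add_walkCross w₂ w₃
    (D.notMem_walkCarrier h12 h₁ m₁ a₁ b₁ hz hza hzb)
    (D.notMem_walkCarrier h13 h₁ m₁ a₁ b₁ hz hza hzb)
  have f₂ := c₂ (D.pairCross w₁ w₃) fun z hz hza hzb => D.walkCross_add_walkCross w₁ w₃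
    (D.notMem_walkCarrier h12.symm h₂ m₂ a₂ b₂ hz hza hzb)
    (D.notMem_walkCarrier h23 h₂ m₂ a₂ b₂ hz hza hzb)
  have f₃ := c₃ (D.pairCross w₁ w₂) fun z hz hza hzb => D.walkCross_add_walkCross w₁ w₂
    (D.notMem_walkCarrier h13.symm h₃ m₃ a₃ b₃ hz hza hzb)
    (D.notMem_walkCarrier h23.symm h₃ m₃ a₃ b₃ hz hza hzb)
  have hsum := sum_dirTerm hd₁ hd₂ hd₃ p12 p13 p23
  obtain ⟨t, ht⟩ := (f₁.and (f₂.and (f₃.and ((hK₁ d₂).and ((hK₁ d₃).and ((hK₂ d₁).and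
    ((hK₂ d₃).and ((hK₃ d₁).and (hK₃ d₂))))))))).exists
  obtain ⟨g₁, g₂, g₃, k12, k13, k21, k23, k31, k32⟩ := ht
  rw [← g₁, ← g₂, ← g₃, ← hsum, pairCross, pairCross, pairCross]
  have s1 := add_self (endTerm (D.pos a) (D.pos b) (D.pos a + t • d₁))
  have s2 := add_self (endTerm (D.pos a) (D.pos b) (D.pos a + t • d₂))
  have s3 := add_self (endTerm (D.pos a) (D.pos b) (D.pos a + t • d₃))
  have t1 := add_self K₁
  have t2 := add_self K₂
  have t3 := add_self K₃
  linear_combination k12 + k13 + k21 + k23 + k31 + k32 - s1 - s2 - s3 + t1 + t2 + t3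

theorem pairCross_eq_of_path {a b x y : V} {w w' : G.Walk a b} {p : G.Walk x y} (hp : p.IsPath)
    (hw : ∀ z ∈ p.support, z ∈ w.support → z = x) (hw' : ∀ z ∈ p.support, z ∈ w'.support → z = x)
    {m : V} (hm : m ∈ p.support) (hmx : m ≠ x) :
    D.pairCross w w' (D.pos m) = D.pairCross w w' (D.pos y) := by
  have hyx : y ≠ x := by
    rintro rfl
    rw [Walk.isPath_iff_nil] at hp
    rw [hp.eq_nil] at hm
    exact hmx (by simpa using hm)
  have key : ∀ v : G.Walk a b, (∀ z ∈ p.support, z ∈ v.support → z = x) →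
      ∀ q ∈ D.walkCarrier p \ {D.pos x}, q ∉ D.walkCarrier v := by
    rintro v hv q ⟨hq, hqx⟩ hq'
    rcases D.mem_walkCarrier_inter p v hq hq' with ⟨z, hz, hz', rfl⟩ | ⟨e, he, he'⟩
    · exact hqx (by rw [hv z hz hz']; rfl)
    · induction e using Sym2.ind with
      | _ z z' =>
        refine (p.adj_of_mem_edges he).ne ?_
        rw [hv z (p.fst_mem_support_of_mem_edges he) (v.fst_mem_support_of_mem_edges he'),
          hv z' (p.snd_mem_support_of_mem_edges he) (v.snd_mem_support_of_mem_edges he')]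
  exact eq_of_locConst (D.isPreconnected_walkCarrier_diff hp)
    (fun q hq => D.walkCross_add_walkCross w w' (key w hw q hq) (key w' hw' q hq))
    ⟨D.pos_mem_walkCarrier p hm, fun h => hmx (D.pos_injective h)⟩
    ⟨D.pos_mem_walkCarrier p p.end_mem_support, fun h => hyx (D.pos_injective h)⟩

theorem pairCross_eq_of_walk {a b x y : V} {w w' : G.Walk a b} {p : G.Walk x y}
    (hw : ∀ z ∈ p.support, z ∉ w.support) (hw' : ∀ z ∈ p.support, z ∉ w'.support) :
    D.pairCross w w' (D.pos x) = D.pairCross w w' (D.pos y) := by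
  have key : ∀ v : G.Walk a b, (∀ z ∈ p.support, z ∉ v.support) →
      ∀ q ∈ D.walkCarrier p, q ∉ D.walkCarrier v := by
    intro v hv q hq hq'
    rcases D.mem_walkCarrier_inter p v hq hq' with ⟨z, hz, hz', rfl⟩ | ⟨e, he, he'⟩
    · exact hv z hz hz'
    · induction e using Sym2.ind with
      | _ z z' =>
        exact hv z (p.fst_mem_support_of_mem_edges he) (v.fst_mem_support_of_mem_edges he')
  exact eq_of_locConst (D.isPreconnected_walkCarrier p)
    (fun q hq => D.walkCross_add_walkCross w w' (key w hw q hq) (key w' hw' q hq))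
    (D.pos_start_mem_walkCarrier p) (D.pos_mem_walkCarrier p p.end_mem_support)

/-- A cycle of a plane graph, formed by `w₁` and `w₂`, separates two disjoint chords `c` and `d`
with interleaved ends. -/
theorem exists_mem_of_chords (D : PlaneDrawing G) {a b x y m n : V} {w₁ w₂ d : G.Walk a b} {c : G.Walk x y}
    (h₁ : w₁.IsPath) (h₂ : w₂.IsPath) (hd : d.IsPath) (hc : c.IsPath)
    (h12 : w₁.InternallyDisjoint w₂) (hd1 : d.InternallyDisjoint w₁)
    (hd2 : d.InternallyDisjoint w₂) (hx : x ∈ w₁.support) (hxa : x ≠ a) (hxb : x ≠ b)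
    (hy : y ∈ w₂.support) (hya : y ≠ a) (hyb : y ≠ b) (hc1 : ∀ z ∈ c.support, z ∈ w₁.support → z = x)
    (hc2 : ∀ z ∈ c.support, z ∈ w₂.support → z = y) (hcd : ∀ z ∈ c.support, z ∉ d.support)
    (hm : m ∈ c.support) (hmx : m ≠ x) (hmy : m ≠ y) (hn : n ∈ d.support) (hna : n ≠ a)
    (hnb : n ≠ b) (p : G.Walk m n) : ∃ z ∈ p.support, z ∈ w₁.support ∨ z ∈ w₂.support := by
  by_contra hcon
  push Not at hcon
  have e := D.theta hd h₁ h₂ hd1 hd2 h12 hn hx hy hna hxa hya hnb hxb hyb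
  have e1 := D.pairCross_eq_of_walk (w := w₁) (w' := w₂) (p := p) (fun z hz => (hcon z hz).1)
    (fun z hz => (hcon z hz).2)
  have e2 := D.pairCross_eq_of_path (w := d) (w' := w₁) hc (fun z hz hz' => absurd hz' (hcd z hz))
    hc1 hm hmx
  have e3 := D.pairCross_eq_of_path (w := d) (w' := w₂) (p := c.reverse) hc.reverse
    (fun z hz hz' => absurd hz' (hcd z (by simpa using hz)))
    (fun z hz => hc2 z (by simpa using hz)) (m := m) (by simpa using hm) hmy
  rw [← e1, ← e2, ← e3, pairCross, pairCross, pairCross] at e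
  have s1 := add_self (D.walkCross w₁ (D.pos m))
  have s2 := add_self (D.walkCross w₂ (D.pos m))
  have s3 := add_self (D.walkCross d (D.pos m))
  have : (1 : ZMod 2) = 0 := by linear_combination -e + s1 + s2 + s3
  exact absurd this (by decide)

end PlaneDrawing

/-! ### Lifting from the elementary wall to a wall -/

/-- `p` and `q` are joined by a walk of the elementary `r`-wall within `S`. -/
def Linked (r : ℕ) (S : Set (ℕ × ℕ)) : ℕ × ℕ → ℕ × ℕ → Prop :=
  Relation.ReflTransGen fun a b => (elementaryWall r).Adj a b ∧ a ∈ S ∧ b ∈ S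

namespace Linked

variable {r : ℕ} {S T : Set (ℕ × ℕ)} {p q s : ℕ × ℕ}

theorem refl : Linked r S p p := Relation.ReflTransGen.refl

theorem trans (h : Linked r S p q) (h' : Linked r S q s) : Linked r S p s :=
  Relation.ReflTransGen.trans h h'

theorem symm (h : Linked r S p q) : Linked r S q p := by
  induction h with
  | refl => exact refl
  | tail _ h ih => exact Relation.ReflTransGen.head ⟨h.1.symm, h.2.2, h.2.1⟩ ih

theorem mono (hST : S ⊆ T) (h : Linked r S p q) : Linked r T p q := by
  induction h with
  | refl => exact refl
  | tail _ h ih => exact Relation.ReflTransGen.tail ih ⟨h.1, hST h.2.1, hST h.2.2⟩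

theorem of_adj (h : (elementaryWall r).Adj p q) (hp : p ∈ S) (hq : q ∈ S) : Linked r S p q :=
  Relation.ReflTransGen.single ⟨h, hp, hq⟩

end Linked

namespace Wall

open SimpleGraph

variable {V : Type*} {G : SimpleGraph V} {r : ℕ} (W : Wall G r)

theorem mem_part_verts {S : Set (ℕ × ℕ)} {v : V} : v ∈ (W.part S).verts ↔
    ∃ (p q : ℕ × ℕ) (h : (elementaryWall r).Adj p q), p ∈ S ∧ q ∈ S ∧ v ∈ (W.seg p q h).support := by
  simp only [part, Subgraph.verts_iSup, Set.mem_iUnion, Walk.mem_verts_toSubgraph]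
  constructor
  · rintro ⟨p, q, h, hp, hq, hv⟩; exact ⟨p, q, h, hp, hq, hv⟩
  · rintro ⟨p, q, h, hp, hq, hv⟩; exact ⟨p, q, h, hp, hq, hv⟩

theorem part_adj {S : Set (ℕ × ℕ)} {u v : V} : (W.part S).Adj u v ↔
    ∃ (p q : ℕ × ℕ) (h : (elementaryWall r).Adj p q), p ∈ S ∧ q ∈ S ∧ s(u, v) ∈ (W.seg p q h).edges := by
  simp only [part, Subgraph.iSup_adj, Walk.adj_toSubgraph_iff_mem_edges]
  constructor
  · rintro ⟨p, q, h, hp, hq, hv⟩; exact ⟨p, q, h, hp, hq, hv⟩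
  · rintro ⟨p, q, h, hp, hq, hv⟩; exact ⟨p, q, h, hp, hq, hv⟩

/-- The branch vertices from `S` and the subdivided edges between them. -/
def hull (S : Set (ℕ × ℕ)) : Set V := {v | (∃ p ∈ S, v = W.branch p) ∨ v ∈ (W.part S).verts}

theorem branch_mem_hull {S : Set (ℕ × ℕ)} {p : ℕ × ℕ} (hp : p ∈ S) : W.branch p ∈ W.hull S :=
  Or.inl ⟨p, hp, rfl⟩

theorem seg_mem_hull {S : Set (ℕ × ℕ)} {p q : ℕ × ℕ} (h : (elementaryWall r).Adj p q) (hp : p ∈ S)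
    (hq : q ∈ S) {v : V} (hv : v ∈ (W.seg p q h).support) : v ∈ W.hull S :=
  Or.inr (W.mem_part_verts.2 ⟨p, q, h, hp, hq, hv⟩)

theorem hull_mono {S T : Set (ℕ × ℕ)} (h : S ⊆ T) : W.hull S ⊆ W.hull T := by
  rintro v (⟨p, hp, rfl⟩ | hv)
  · exact W.branch_mem_hull (h hp)
  · obtain ⟨p, q, hpq, hp, hq, hv⟩ := W.mem_part_verts.1 hv
    exact W.seg_mem_hull hpq (h hp) (h hq) hv

theorem hull_inter {S T : Set (ℕ × ℕ)} (hS : S ⊆ wallVerts r 1) (hT : T ⊆ wallVerts r 1) :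
    W.hull S ∩ W.hull T ⊆ W.hull (S ∩ T) := by
  rintro v ⟨hv, hv'⟩
  have key : ∀ {S T : Set (ℕ × ℕ)}, S ⊆ wallVerts r 1 → ∀ p ∈ S, W.branch p ∈ (W.part T).verts →
      p ∈ T := by
    intro S T hS p hp h
    obtain ⟨a, b, hab, ha, hb, h⟩ := W.mem_part_verts.1 h
    rcases W.branch_mem_seg a b hab p (hS hp) h with rfl | rfl
    · exact ha
    · exact hb
  rcases hv with ⟨p, hp, rfl⟩ | hv
  · rcases hv' with ⟨q, hq, h⟩ | hv'
    · exact W.branch_mem_hull ⟨hp, W.branch_injOn (hS hp) (hT hq) h ▸ hq⟩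
    · exact W.branch_mem_hull ⟨hp, key hS p hp hv'⟩
  · rcases hv' with ⟨q, hq, rfl⟩ | hv'
    · exact W.branch_mem_hull ⟨key hT q hq hv, hq⟩
    · obtain ⟨a, b, hab, ha, hb, h⟩ := W.mem_part_verts.1 hv
      obtain ⟨a', b', hab', ha', hb', h'⟩ := W.mem_part_verts.1 hv'
      by_cases he : s(a, b) = s(a', b')
      · have : a ∈ T ∧ b ∈ T := by
          rcases Sym2.eq_iff.1 he with ⟨rfl, rfl⟩ | ⟨rfl, rfl⟩
          · exact ⟨ha', hb'⟩
          · exact ⟨hb', ha'⟩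
        exact W.seg_mem_hull (S := S ∩ T) hab ⟨ha, this.1⟩ ⟨hb, this.2⟩ h
      · obtain ⟨c, hc, rfl⟩ := W.seg_inter a b hab a' b' hab' he v h h'
        refine W.branch_mem_hull ⟨?_, ?_⟩
        · rcases W.branch_mem_seg a b hab c hc h with rfl | rfl
          · exact ha
          · exact hb
        · rcases W.branch_mem_seg a' b' hab' c hc h' with rfl | rfl
          · exact ha'
          · exact hb'

theorem hull_singleton (c : ℕ × ℕ) : W.hull {c} ⊆ {W.branch c} := by
  rintro v (⟨p, hp, rfl⟩ | hv)
  · rw [Set.mem_singleton_iff.1 hp]; rfl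
  · obtain ⟨a, b, hab, ha, hb, -⟩ := W.mem_part_verts.1 hv
    rw [Set.mem_singleton_iff.1 ha, Set.mem_singleton_iff.1 hb] at hab
    exact absurd rfl hab.ne

theorem disjoint_hull {S T : Set (ℕ × ℕ)} (hS : S ⊆ wallVerts r 1) (hT : T ⊆ wallVerts r 1)
    (h : Disjoint S T) : Disjoint (W.hull S) (W.hull T) := by
  rw [Set.disjoint_left]
  intro v hv hv'
  have := W.hull_inter hS hT ⟨hv, hv'⟩
  rw [Set.disjoint_iff_inter_eq_empty.1 h] at this
  rcases this with ⟨p, hp, -⟩ | hv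
  · exact hp
  · obtain ⟨a, -, -, ha, -⟩ := W.mem_part_verts.1 hv
    exact ha

theorem eq_branch_of_mem_hull {S T : Set (ℕ × ℕ)} (hS : S ⊆ wallVerts r 1)
    (hT : T ⊆ wallVerts r 1) {c : ℕ × ℕ} (h : S ∩ T ⊆ {c}) {v : V} (hv : v ∈ W.hull S)
    (hv' : v ∈ W.hull T) : v = W.branch c :=
  W.hull_singleton c (W.hull_mono h (W.hull_inter hS hT ⟨hv, hv'⟩))

theorem branch_mem_hull_iff {S : Set (ℕ × ℕ)} (hS : S ⊆ wallVerts r 1) {p : ℕ × ℕ}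
    (hp : p ∈ wallVerts r 1) : W.branch p ∈ W.hull S ↔ p ∈ S := by
  refine ⟨fun h => ?_, W.branch_mem_hull⟩
  by_contra hpS
  exact Set.disjoint_left.1 (W.disjoint_hull (S := {p}) (Set.singleton_subset_iff.2 hp) hS
    (Set.disjoint_singleton_left.2 hpS)) (W.branch_mem_hull rfl) h

theorem exists_walk {S : Set (ℕ × ℕ)} {p q : ℕ × ℕ} (hp : p ∈ S) (h : Linked r S p q) :
    ∃ w : G.Walk (W.branch p) (W.branch q), (∀ v ∈ w.support, v ∈ W.hull S) ∧
      ∀ e ∈ w.edges, e ∈ (W.part S).edgeSet := by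
  induction h with
  | refl => exact ⟨.nil, by simp [W.branch_mem_hull hp], by simp⟩
  | @tail a b hab h ih =>
    obtain ⟨w, hw, hw'⟩ := ih
    refine ⟨w.append (W.seg a b h.1), fun v hv => ?_, fun e he => ?_⟩
    · rcases Walk.mem_support_append_iff _ _ |>.1 hv with hv | hv
      · exact hw v hv
      · exact W.seg_mem_hull h.1 h.2.1 h.2.2 hv
    · rw [Walk.edges_append, List.mem_append] at he
      rcases he with he | he
      · exact hw' e he
      · induction e using Sym2.ind with
        | _ x y => exact W.part_adj.2 ⟨a, b, h.1, h.2.1, h.2.2, he⟩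

theorem exists_path {S : Set (ℕ × ℕ)} {p q : ℕ × ℕ} (hp : p ∈ S) (h : Linked r S p q) :
    ∃ w : G.Walk (W.branch p) (W.branch q), w.IsPath ∧ (∀ v ∈ w.support, v ∈ W.hull S) ∧
      (∀ e ∈ w.edges, e ∈ (W.part S).edgeSet) ∧
      (W.branch p ≠ W.branch q → ∀ v ∈ w.support, v ∈ (W.part S).verts) := by
  classical
  obtain ⟨w, hw, hw'⟩ := W.exists_walk hp h
  have hE : ∀ e ∈ w.bypass.edges, e ∈ (W.part S).edgeSet :=
    fun e he => hw' e (w.edges_bypass_subset_edges he)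
  refine ⟨w.bypass, w.bypass_isPath, fun v hv => hw v (w.support_bypass_subset_support hv), hE,
    fun hne v hv => ?_⟩
  obtain ⟨e, he, hve⟩ := (Walk.mem_support_iff_exists_mem_edges_of_not_nil
    (fun h => hne h.eq)).1 hv
  exact (W.part S).mem_verts_of_mem_edge (hE e he) hve

theorem hull_subset_part {S : Set (ℕ × ℕ)}
    (h : ∀ p ∈ S, ∃ q ∈ S, (elementaryWall r).Adj p q) : W.hull S ⊆ (W.part S).verts := by
  rintro v (⟨p, hp, rfl⟩ | hv)
  · obtain ⟨q, hq, hpq⟩ := h p hp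
    exact W.mem_part_verts.2 ⟨p, q, hpq, hp, hq, Walk.start_mem_support _⟩
  · exact hv

end Wall

/-! ### Concatenating paths -/

namespace SimpleGraph.Walk

variable {V : Type*} {G : SimpleGraph V}

theorem IsPath.append_of_inter {u v w : V} {p : G.Walk u v} {q : G.Walk v w} (hp : p.IsPath)
    (hq : q.IsPath) (h : ∀ x ∈ p.support, x ∈ q.support → x = v) : (p.append q).IsPath := by
  induction p with
  | nil => simpa using hq
  | cons hab p ih =>
    rw [cons_isPath_iff] at hp
    rw [cons_append, cons_isPath_iff]
    refine ⟨ih hp.1 hq fun x hx => h x (by simp [hx]), ?_⟩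
    rw [mem_support_append_iff]
    rintro (h' | h')
    · exact hp.2 h'
    · have := h _ (by simp) h'
      subst this
      exact hp.2 p.end_mem_support

end SimpleGraph.Walk

/-! ### Coordinates in the elementary wall -/

theorem brickGraph_adj {x y x' y' : ℕ} : brickGraph.Adj (x, y) (x', y') ↔
    (y = y' ∧ (x + 1 = x' ∨ x' + 1 = x)) ∨
    (x = x' ∧ ((y + 1 = y' ∧ (x + y) % 2 = 0) ∨ (y' + 1 = y ∧ (x' + y') % 2 = 0))) := by
  simp only [brickGraph, Nat.even_iff]

theorem mem_window {r i x y : ℕ} : (x, y) ∈ window r i ↔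
    2 * i ≤ x + 1 ∧ x + 2 * i ≤ 2 * r + 2 ∧ i ≤ y ∧ y + i ≤ r + 1 := Iff.rfl

/-- The corners of `window r i` that have degree one. -/
def IsPruned (r i x y : ℕ) : Prop :=
  (x + 1 = 2 * i ∧ ((y = i ∧ i % 2 = 0) ∨ (y + i = r + 1 ∧ i % 2 = 1))) ∨
  (x + 2 * i = 2 * r + 2 ∧ ((y = i ∧ i % 2 = 1) ∨ (y + i = r + 1 ∧ i % 2 = 0)))

theorem mem_wallVerts {r i x y : ℕ} (hr : Odd r) (hi : 1 ≤ i) (hir : 2 * i + 1 ≤ r) :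
    (x, y) ∈ wallVerts r i ↔ (x, y) ∈ window r i ∧ ¬ IsPruned r i x y := by
  have hr2 := Nat.odd_iff.1 hr
  rw [wallVerts, prune, Set.mem_ofPred_eq]
  refine and_congr_right fun hw => ?_
  have hw' := mem_window.1 hw
  rw [not_iff_not]
  constructor
  · intro h1
    obtain ⟨a, ha⟩ := Set.ncard_eq_one.mp h1
    have key : ∀ x1 y1 x2 y2, (x1, y1) ≠ (x2, y2) →
        brickGraph.Adj (x, y) (x1, y1) → (x1, y1) ∈ window r i →
        brickGraph.Adj (x, y) (x2, y2) → (x2, y2) ∈ window r i → False := by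
      intro x1 y1 x2 y2 hne h1 h1' h2 h2'
      have e1 : (x1, y1) ∈ ({a} : Set (ℕ × ℕ)) := ha ▸ ⟨h1, h1'⟩
      have e2 : (x2, y2) ∈ ({a} : Set (ℕ × ℕ)) := ha ▸ ⟨h2, h2'⟩
      exact hne (e1.trans e2.symm)
    by_contra hp
    simp only [IsPruned] at hp
    by_cases hx : x + 1 = 2 * i
    · rcases Nat.mod_two_eq_zero_or_one y with hy | hy
      · exact key (x + 1) y x (y - 1) (by simp) (by rw [brickGraph_adj]; omega)
          (by rw [mem_window]; omega) (by rw [brickGraph_adj]; omega) (by rw [mem_window]; omega)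
      · exact key (x + 1) y x (y + 1) (by simp) (by rw [brickGraph_adj]; omega)
          (by rw [mem_window]; omega) (by rw [brickGraph_adj]; omega) (by rw [mem_window]; omega)
    · by_cases hx' : x + 2 * i = 2 * r + 2
      · rcases Nat.mod_two_eq_zero_or_one y with hy | hy
        · exact key (x - 1) y x (y + 1) (by simp) (by rw [brickGraph_adj]; omega)
            (by rw [mem_window]; omega) (by rw [brickGraph_adj]; omega) (by rw [mem_window]; omega)
        · exact key (x - 1) y x (y - 1) (by simp; omega) (by rw [brickGraph_adj]; omega)
            (by rw [mem_window]; omega) (by rw [brickGraph_adj]; omega) (by rw [mem_window]; omega)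
      · exact key (x - 1) y (x + 1) y (by simp) (by rw [brickGraph_adj]; omega)
          (by rw [mem_window]; omega) (by rw [brickGraph_adj]; omega) (by rw [mem_window]; omega)
  · intro hp
    rw [IsPruned] at hp
    rw [Set.ncard_eq_one]
    rcases hp with hp | hp
    · refine ⟨(x + 1, y), ?_⟩
      ext ⟨x', y'⟩
      simp only [Set.mem_inter_iff, SimpleGraph.mem_neighborSet, brickGraph_adj, mem_window,
        Set.mem_singleton_iff, Prod.mk.injEq]
      omega
    · refine ⟨(x - 1, y), ?_⟩
      ext ⟨x', y'⟩
      simp only [Set.mem_inter_iff, SimpleGraph.mem_neighborSet, brickGraph_adj, mem_window,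
        Set.mem_singleton_iff, Prod.mk.injEq]
      omega

theorem wallVerts_one {r x y : ℕ} (hr : Odd r) (h3 : 3 ≤ r) : (x, y) ∈ wallVerts r 1 ↔
    1 ≤ x ∧ x ≤ 2 * r ∧ 1 ≤ y ∧ y ≤ r ∧ ¬ (x = 1 ∧ y = r) ∧ ¬ (x = 2 * r ∧ y = 1) := by
  rw [mem_wallVerts hr le_rfl (by omega), mem_window, IsPruned]
  omega

theorem wallVerts_subset_one {r i : ℕ} (hr : Odd r) (hi : 1 ≤ i) (hir : 2 * i + 1 ≤ r) :
    wallVerts r i ⊆ wallVerts r 1 := by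
  have hr2 := Nat.odd_iff.1 hr
  rintro ⟨x, y⟩ h
  rw [mem_wallVerts hr hi hir, mem_window, IsPruned] at h
  rw [wallVerts_one hr (by omega)]
  omega

theorem wallVerts_diff_layerVerts {r i : ℕ} {p : ℕ × ℕ} (hp : p ∈ wallVerts r i)
    (hp' : p ∉ layerVerts r i) : p ∈ window r (i + 1) := by
  by_contra h
  exact hp' ⟨hp, h⟩

theorem layerVerts_one {r x y : ℕ} (hr : Odd r) (h3 : 3 ≤ r) : (x, y) ∈ layerVerts r 1 ↔
    (x, y) ∈ wallVerts r 1 ∧ (x ≤ 2 ∨ 2 * r ≤ x + 1 ∨ y = 1 ∨ y = r) := by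
  rw [layerVerts, Set.mem_sdiff, wallVerts_one hr h3, mem_window]
  omega

theorem elementaryWall_adj_right {r x y : ℕ} (h : (x, y) ∈ wallVerts r 1)
    (h' : (x + 1, y) ∈ wallVerts r 1) : (elementaryWall r).Adj (x, y) (x + 1, y) :=
  ⟨h, h', brickGraph_adj.2 (by omega)⟩

theorem elementaryWall_adj_up {r x y : ℕ} (h : (x, y) ∈ wallVerts r 1)
    (h' : (x, y + 1) ∈ wallVerts r 1) (he : (x + y) % 2 = 0) :
    (elementaryWall r).Adj (x, y) (x, y + 1) :=
  ⟨h, h', brickGraph_adj.2 (by omega)⟩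

namespace Linked

variable {r : ℕ} {S : Set (ℕ × ℕ)}

theorem right (hS : S ⊆ wallVerts r 1) {x y : ℕ} (h : (x, y) ∈ S) (h' : (x + 1, y) ∈ S) :
    Linked r S (x, y) (x + 1, y) :=
  of_adj (elementaryWall_adj_right (hS h) (hS h')) h h'

theorem up (hS : S ⊆ wallVerts r 1) {x y : ℕ} (h : (x, y) ∈ S) (h' : (x, y + 1) ∈ S)
    (he : (x + y) % 2 = 0) : Linked r S (x, y) (x, y + 1) :=
  of_adj (elementaryWall_adj_up (hS h) (hS h') he) h h'

theorem row (hS : S ⊆ wallVerts r 1) {x x' y : ℕ} (hx : x ≤ x')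
    (h : ∀ z, x ≤ z → z ≤ x' → (z, y) ∈ S) : Linked r S (x, y) (x', y) := by
  induction x', hx using Nat.le_induction with
  | base => exact refl
  | succ x' hx ih =>
    exact (ih fun z h1 h2 => h z h1 (by omega)).trans
      (right hS (h x' hx (by omega)) (h (x' + 1) (by omega) le_rfl))

theorem columns (hS : S ⊆ wallVerts r 1) {x y y' : ℕ} (hy : y ≤ y')
    (h : ∀ z, y ≤ z → z ≤ y' → (x, z) ∈ S ∧ (x + 1, z) ∈ S) :
    Linked r S (x, y) (x, y') := by
  induction y', hy using Nat.le_induction with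
  | base => exact refl
  | succ y' hy ih =>
    refine (ih fun z h1 h2 => h z h1 (by omega)).trans ?_
    obtain ⟨h1, h2⟩ := h y' hy (by omega)
    obtain ⟨h3, h4⟩ := h (y' + 1) (by omega) le_rfl
    by_cases he : (x + y') % 2 = 0
    · exact up hS h1 h3 he
    · exact (right hS h1 h2).trans ((up hS h2 h4 (by omega)).trans (right hS h3 h4).symm)

end Linked

/-! ### The frame of the elementary wall -/

/-- The vertices of the elementary wall that lie outside `W̄⁽ⁱ⁾`. -/
def outerVerts (r i : ℕ) : Set (ℕ × ℕ) := wallVerts r 1 \ wallVerts r i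

theorem linked_frame {r : ℕ} (hr : Odd r) (h3 : 3 ≤ r) {S : Set (ℕ × ℕ)}
    (hS : S ⊆ wallVerts r 1) (hL : layerVerts r 1 ⊆ S) {x y : ℕ} (hx : x = 2 ∨ x = 2 * r - 1)
    (hy : 1 ≤ y) (hyr : y ≤ r) : Linked r S (x, y) (2, 1) := by
  have hr2 := Nat.odd_iff.1 hr
  have hmem : ∀ {x y}, ((x, y) ∈ wallVerts r 1 ∧ (x ≤ 2 ∨ 2 * r ≤ x + 1 ∨ y = 1 ∨ y = r)) →
      (x, y) ∈ S := fun h => hL ((layerVerts_one hr h3).2 h)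
  simp only [wallVerts_one hr h3] at hmem
  have e1 : ∀ y, 1 ≤ y → y ≤ r - 1 → Linked r S (2, y) (2, 1) := by
    intro y h1 h2
    have a := Linked.columns (x := 1) hS h1 fun z _ _ => ⟨hmem (by omega), hmem (by omega)⟩
    have b := Linked.right (x := 1) (y := y) hS (hmem (by omega)) (hmem (by omega))
    have c := Linked.right (x := 1) (y := 1) hS (hmem (by omega)) (hmem (by omega))
    exact b.symm.trans (a.symm.trans c)
  have e2 : ∀ y, 2 ≤ y → y ≤ r → Linked r S (2 * r - 1, 2) (2 * r - 1, y) := by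
    intro y h1 h2
    exact Linked.columns (x := 2 * r - 1) hS h1 fun z _ _ => ⟨hmem (by omega), hmem (by omega)⟩
  have e3 : Linked r S (2, 1) (2 * r - 1, 1) :=
    Linked.row hS (by omega) fun z _ _ => hmem (by omega)
  have e4 : Linked r S (2 * r - 1, 1) (2 * r - 1, 2) :=
    Linked.up hS (hmem (by omega)) (hmem (by omega)) (by omega)
  have e5 : Linked r S (2, r - 1) (2, r - 1 + 1) :=
    Linked.up hS (hmem (by omega)) (hmem (by omega)) (by omega)
  rcases hx with rfl | rfl
  · by_cases hyr' : y = r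
    · rw [Nat.sub_add_cancel (by omega)] at e5
      rw [hyr']
      exact e5.symm.trans (e1 _ (by omega) le_rfl)
    · exact e1 y hy (by omega)
  · by_cases hy1 : y = 1
    · rw [hy1]; exact e3.symm
    · exact (e3.trans (e4.trans (e2 y (by omega) hyr))).symm

theorem linked_layerVerts_one {r : ℕ} (hr : Odd r) (h3 : 3 ≤ r) {p q : ℕ × ℕ}
    (hp : p ∈ layerVerts r 1) (hq : q ∈ layerVerts r 1) : Linked r (layerVerts r 1) p q := by
  have hS : layerVerts r 1 ⊆ wallVerts r 1 := Set.sdiff_subset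
  have key : ∀ p ∈ layerVerts r 1, Linked r (layerVerts r 1) p (2, 1) := by
    rintro ⟨x, y⟩ h
    have hmem : ∀ {x y}, ((x, y) ∈ wallVerts r 1 ∧ (x ≤ 2 ∨ 2 * r ≤ x + 1 ∨ y = 1 ∨ y = r)) →
        (x, y) ∈ layerVerts r 1 := fun h => (layerVerts_one hr h3).2 h
    simp only [wallVerts_one hr h3] at hmem
    have h' := (layerVerts_one hr h3).1 h
    rw [wallVerts_one hr h3] at h'
    by_cases hx : 2 * r ≤ x + 1
    · exact (Linked.row hS (show 2 * r - 1 ≤ x by omega) fun z _ _ => hmem (by omega)).symm.trans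
        (linked_frame hr h3 hS le_rfl (Or.inr rfl) (by omega) (by omega))
    · by_cases hx1 : x = 1
      · subst hx1
        exact (Linked.right (x := 1) hS h (hmem (by omega))).trans
          (linked_frame hr h3 hS le_rfl (Or.inl rfl) (by omega) (by omega))
      · exact (Linked.row hS (show 2 ≤ x by omega) fun z _ _ => hmem (by omega)).symm.trans
          (linked_frame hr h3 hS le_rfl (Or.inl rfl) (by omega) (by omega))
  exact (key p hp).trans (key q hq).symm

theorem mem_outerVerts {r i x y : ℕ} (hr : Odd r) (hi : 1 ≤ i) (hir : 2 * i + 1 ≤ r) :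
    (x, y) ∈ outerVerts r i ↔ (1 ≤ x ∧ x ≤ 2 * r ∧ 1 ≤ y ∧ y ≤ r ∧ ¬ (x = 1 ∧ y = r) ∧
      ¬ (x = 2 * r ∧ y = 1)) ∧ (x + 1 < 2 * i ∨ 2 * r + 2 < x + 2 * i ∨ y < i ∨ r + 1 < y + i ∨
        IsPruned r i x y) := by
  rw [outerVerts, Set.mem_sdiff, wallVerts_one hr (by omega), mem_wallVerts hr hi hir, mem_window]
  refine and_congr_right fun _ => ?_
  by_cases h : IsPruned r i x y <;> simp [h]
  omega

theorem linked_outerVerts {r i : ℕ} (hr : Odd r) (hi : 2 ≤ i) (hir : 2 * i + 1 ≤ r) {p q : ℕ × ℕ}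
    (hp : p ∈ outerVerts r i) (hq : q ∈ outerVerts r i) : Linked r (outerVerts r i) p q := by
  have hr2 := Nat.odd_iff.1 hr
  have h3 : 3 ≤ r := by omega
  have hS : outerVerts r i ⊆ wallVerts r 1 := Set.sdiff_subset
  have hmem := fun {x y} => (mem_outerVerts (x := x) (y := y) hr (by omega : 1 ≤ i) hir).2
  have hL : layerVerts r 1 ⊆ outerVerts r i := by
    rintro ⟨x, y⟩ h
    rw [layerVerts_one hr h3, wallVerts_one hr h3] at h
    exact hmem (by omega)
  have key : ∀ p ∈ outerVerts r i, Linked r (outerVerts r i) p (2, 1) := by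
    rintro ⟨x, y⟩ h
    have h' := (mem_outerVerts hr (by omega) hir).1 h
    by_cases hx : 2 * r + 2 < x + 2 * i ∨
        (x + 2 * i = 2 * r + 2 ∧ IsPruned r i x y)
    · by_cases hx1 : x = 2 * r
      · subst hx1
        have e := Linked.right (x := 2 * r - 1) (y := y) hS (hmem (by omega))
          (hmem (by rw [IsPruned]; omega))
        rw [Nat.sub_add_cancel (by omega)] at e
        exact e.symm.trans (linked_frame hr h3 hS hL (Or.inr rfl) (by omega) (by omega))
      · refine (Linked.row hS (show x ≤ 2 * r - 1 by omega) fun z hz _ => ?_).trans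
          (linked_frame hr h3 hS hL (Or.inr rfl) (by omega) (by omega))
        rcases eq_or_lt_of_le hz with rfl | hz
        · exact h
        · exact hmem (by omega)
    · by_cases hx1 : x = 1
      · subst hx1
        exact (Linked.right (x := 1) hS h (hmem (by omega))).trans
          (linked_frame hr h3 hS hL (Or.inl rfl) (by omega) (by omega))
      · refine (Linked.row hS (show 2 ≤ x by omega) fun z hz hz' => ?_).symm.trans
          (linked_frame hr h3 hS hL (Or.inl rfl) (by omega) (by omega))
        rcases eq_or_lt_of_le hz' with rfl | hz'
        · exact h
        · rw [IsPruned] at h' hx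
          exact hmem (by omega)
  exact (key p hp).trans (key q hq).symm

theorem window_subset {r i : ℕ} (hr : Odd r) (hi : 1 ≤ i) (hir : 2 * i + 1 ≤ r) :
    window r (i + 1) ⊆ wallVerts r i := by
  rintro ⟨x, y⟩ h
  rw [mem_window] at h
  rw [mem_wallVerts hr hi hir, mem_window, IsPruned]
  omega

theorem linked_window {r i : ℕ} (hr : Odd r) (hi : 1 ≤ i) (hir : 2 * i + 1 ≤ r) {p q : ℕ × ℕ}
    (hp : p ∈ window r (i + 1)) (hq : q ∈ window r (i + 1)) : Linked r (window r (i + 1)) p q := by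
  have hS : window r (i + 1) ⊆ wallVerts r 1 :=
    (window_subset hr hi hir).trans (wallVerts_subset_one hr hi hir)
  have hmem := fun {x y} => (mem_window (r := r) (i := i + 1) (x := x) (y := y)).2
  have key : ∀ p ∈ window r (i + 1), Linked r (window r (i + 1)) p (2 * i + 1, i + 1) := by
    rintro ⟨x, y⟩ h
    rw [mem_window] at h
    exact (Linked.row hS (show 2 * i + 1 ≤ x by omega) fun z _ _ => hmem (by omega)).symm.trans
      (Linked.columns (x := 2 * i + 1) hS (show i + 1 ≤ y by omega)
        fun z _ _ => ⟨hmem (by omega), hmem (by omega)⟩).symm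
  exact (key p hp).trans (key q hq).symm

/-! ### The compass of a nested wall misses the outer layers -/

theorem mem_layerVerts {r i x y : ℕ} (hr : Odd r) (hi : 1 ≤ i) (hir : 2 * i + 1 ≤ r) :
    (x, y) ∈ layerVerts r i ↔ (x, y) ∈ window r i ∧ ¬ IsPruned r i x y ∧
      (x ≤ 2 * i ∨ 2 * r + 1 ≤ x + 2 * i ∨ y = i ∨ y + i = r + 1) := by
  rw [layerVerts, Set.mem_sdiff, mem_wallVerts hr hi hir, and_assoc]
  refine and_congr_right fun hw => and_congr_right fun _ => ?_
  rw [mem_window] at *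
  omega

theorem layerVerts_subset_one {r i : ℕ} (hr : Odd r) (hi : 1 ≤ i) (hir : 2 * i + 1 ≤ r) :
    layerVerts r i ⊆ wallVerts r 1 :=
  Set.sdiff_subset.trans (wallVerts_subset_one hr hi hir)

theorem exists_adj_layerVerts {r i : ℕ} (hr : Odd r) (hi : 1 ≤ i) (hir : 2 * i + 1 ≤ r)
    {p : ℕ × ℕ} (hp : p ∈ layerVerts r i) : ∃ q ∈ layerVerts r i, (elementaryWall r).Adj p q := by
  have hr2 := Nat.odd_iff.1 hr
  have hS := layerVerts_subset_one hr hi hir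
  obtain ⟨x, y⟩ := p
  have h := (mem_layerVerts hr hi hir).1 hp
  rw [mem_window, IsPruned] at h
  by_cases hx : (x + 1, y) ∈ layerVerts r i
  · exact ⟨_, hx, elementaryWall_adj_right (hS hp) (hS hx)⟩
  · have hx' : (x - 1, y) ∈ layerVerts r i := by
      rw [mem_layerVerts hr hi hir, mem_window, IsPruned] at hx ⊢
      omega
    refine ⟨_, hx', ?_⟩
    have e := elementaryWall_adj_right (x := x - 1) (hS hx')
      (by rw [Nat.sub_add_cancel (by omega)]; exact hS hp)
    rw [Nat.sub_add_cancel (by omega)] at e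
    exact e.symm

theorem exists_left_half {r i t ζ c : ℕ} (hr : Odd r) (hi : 2 ≤ i) (hir : 2 * i + 1 ≤ r)
    (ht : t + i = r) (h1 : 2 * i ≤ ζ) (h2 : ζ ≤ 2 * i + 1) (h3 : 2 * i ≤ c) (h4 : c ≤ 2 * i + 2) :
    ∃ S ⊆ layerVerts r i, Linked r S (ζ, i) (c, t + 1) ∧ (ζ, i) ∈ S ∧ ∀ x y, (x, y) ∈ S →
      i ≤ y ∧ y ≤ t + 1 ∧ (x ≤ 2 * i ∨ (y = i ∧ x ≤ ζ) ∨ (y = t + 1 ∧ x ≤ c)) := by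
  have hr2 := Nat.odd_iff.1 hr
  have hi1 : 1 ≤ i := by omega
  set S : Set (ℕ × ℕ) := {p | p ∈ layerVerts r i ∧
    (p.1 ≤ 2 * i ∨ (p.2 = i ∧ p.1 ≤ ζ) ∨ (p.2 = t + 1 ∧ p.1 ≤ c))} with hSdef
  have hSL : S ⊆ layerVerts r i := fun p h => h.1
  have hm : ∀ x y, (x, y) ∈ S ↔ (x, y) ∈ layerVerts r i ∧
    (x ≤ 2 * i ∨ (y = i ∧ x ≤ ζ) ∨ (y = t + 1 ∧ x ≤ c)) := fun _ _ => Iff.rfl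
  clear_value S
  simp only [mem_layerVerts hr hi1 hir, mem_window, IsPruned] at hm
  have c1 : ∀ y, i < y → y ≤ t → (2 * i - 1, y) ∈ S := fun y _ _ => (hm _ _).2 (by omega)
  have c2 : ∀ y, i < y → y ≤ t → (2 * i, y) ∈ S := fun y _ _ => (hm _ _).2 (by omega)
  have c3 : ∀ x, 2 * i ≤ x → x ≤ ζ → (x, i) ∈ S := fun y _ _ => (hm _ _).2 (by omega)
  have c4 : ∀ x, 2 * i ≤ x → x ≤ c → (x, t + 1) ∈ S := fun y _ _ => (hm _ _).2 (by omega)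
  have c5 : i % 2 = 1 → (2 * i - 1, i) ∈ S := fun _ => (hm _ _).2 (by omega)
  have c6 : t % 2 = 1 → (2 * i - 1, t + 1) ∈ S := fun _ => (hm _ _).2 (by omega)
  have hS1 : S ⊆ wallVerts r 1 := hSL.trans (layerVerts_subset_one hr hi1 hir)
  refine ⟨S, hSL, ?_, c3 ζ h1 le_rfl, fun x y h => ?_⟩
  · have e1 : Linked r S (2 * i, i) (ζ, i) := Linked.row hS1 h1 c3
    have e2 : Linked r S (2 * i, t + 1) (c, t + 1) := Linked.row hS1 h3 c4
    have e3 : Linked r S (2 * i - 1, i + 1) (2 * i - 1, t) :=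
      Linked.columns hS1 (by omega) fun z h h' =>
        ⟨c1 z h h', by rw [Nat.sub_add_cancel (by omega)]; exact c2 z h h'⟩
    have hR : ∀ y, (2 * i - 1, y) ∈ S → (2 * i, y) ∈ S → Linked r S (2 * i - 1, y) (2 * i, y) := by
      intro y h h'
      have := Linked.right (x := 2 * i - 1) (y := y) hS1 h
        (by rw [Nat.sub_add_cancel (by omega)]; exact h')
      rwa [Nat.sub_add_cancel (by omega)] at this
    have e4 : Linked r S (2 * i, i) (2 * i - 1, i + 1) := by
      rcases Nat.mod_two_eq_zero_or_one i with h | h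
      · exact (Linked.up hS1 (c3 _ le_rfl h1) (c2 _ (by omega) (by omega)) (by omega)).trans
          (hR (i + 1) (c1 _ (by omega) (by omega)) (c2 _ (by omega) (by omega))).symm
      · exact (hR i (c5 h) (c3 _ le_rfl h1)).symm.trans
          (Linked.up hS1 (c5 h) (c1 _ (by omega) (by omega)) (by omega))
    have e5 : Linked r S (2 * i - 1, t) (2 * i, t + 1) := by
      rcases Nat.mod_two_eq_zero_or_one t with h | h
      · exact (hR t (c1 _ (by omega) (by omega)) (c2 _ (by omega) (by omega))).trans
          (Linked.up hS1 (c2 _ (by omega) (by omega)) (c4 _ le_rfl h3) (by omega))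
      · exact (Linked.up hS1 (c1 _ (by omega) (by omega)) (c6 h) (by omega)).trans
          (hR _ (c6 h) (c4 _ le_rfl h3))
    exact e1.symm.trans (e4.trans (e3.trans (e5.trans e2)))
  · obtain ⟨⟨hw, -⟩, h⟩ := (hm x y).1 h
    exact ⟨hw.2.2.1, by omega, h⟩

theorem exists_right_half {r i t ζ c : ℕ} (hr : Odd r) (hi : 2 ≤ i) (hir : 2 * i + 1 ≤ r)
    (ht : t + i = r) (h1 : 2 * i ≤ ζ) (h2 : ζ ≤ 2 * i + 3) (h3 : 2 * i ≤ c) (h4 : c ≤ 2 * i + 2) :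
    ∃ S ⊆ layerVerts r i, Linked r S (c, t + 1) (ζ, i) ∧ (c, t + 1) ∈ S ∧ ∀ x y, (x, y) ∈ S →
      i ≤ y ∧ y ≤ t + 1 ∧
        (2 * r + 1 ≤ x + 2 * i ∨ (y = i ∧ ζ ≤ x) ∨ (y = t + 1 ∧ c ≤ x)) := by
  have hr2 := Nat.odd_iff.1 hr
  have hi1 : 1 ≤ i := by omega
  set S : Set (ℕ × ℕ) := {p | p ∈ layerVerts r i ∧
    (2 * r + 1 ≤ p.1 + 2 * i ∨ (p.2 = i ∧ ζ ≤ p.1) ∨ (p.2 = t + 1 ∧ c ≤ p.1))} with hSdef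
  have hSL : S ⊆ layerVerts r i := fun p h => h.1
  have hm : ∀ x y, (x, y) ∈ S ↔ (x, y) ∈ layerVerts r i ∧
    (2 * r + 1 ≤ x + 2 * i ∨ (y = i ∧ ζ ≤ x) ∨ (y = t + 1 ∧ c ≤ x)) := fun _ _ => Iff.rfl
  clear_value S
  obtain ⟨ρ, hρ⟩ : ∃ ρ, ρ + 2 * i = 2 * r + 1 := ⟨2 * r + 1 - 2 * i, by omega⟩
  simp only [mem_layerVerts hr hi1 hir, mem_window, IsPruned] at hm
  have c1 : ∀ y, i < y → y ≤ t → (ρ + 1, y) ∈ S := fun y _ _ => (hm _ _).2 (by omega)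
  have c2 : ∀ y, i < y → y ≤ t → (ρ, y) ∈ S := fun y _ _ => (hm _ _).2 (by omega)
  have c3 : ∀ x, ζ ≤ x → x ≤ ρ → (x, i) ∈ S := fun y _ _ => (hm _ _).2 (by omega)
  have c4 : ∀ x, c ≤ x → x ≤ ρ → (x, t + 1) ∈ S := fun y _ _ => (hm _ _).2 (by omega)
  have c5 : i % 2 = 0 → (ρ + 1, i) ∈ S := fun _ => (hm _ _).2 (by omega)
  have c6 : t % 2 = 0 → (ρ + 1, t + 1) ∈ S := fun _ => (hm _ _).2 (by omega)
  have hS1 : S ⊆ wallVerts r 1 := hSL.trans (layerVerts_subset_one hr hi1 hir)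
  have h1' : ζ ≤ ρ := by omega
  have h3' : c ≤ ρ := by omega
  refine ⟨S, hSL, ?_, c4 c le_rfl h3', fun x y h => ?_⟩
  · have e1 : Linked r S (ζ, i) (ρ, i) := Linked.row hS1 h1' c3
    have e2 : Linked r S (c, t + 1) (ρ, t + 1) := Linked.row hS1 h3' c4
    have e3 : Linked r S (ρ, i + 1) (ρ, t) :=
      Linked.columns hS1 (by omega) fun z h h' => ⟨c2 z h h', c1 z h h'⟩
    have e4 : Linked r S (ρ, i) (ρ, i + 1) := by
      rcases Nat.mod_two_eq_zero_or_one i with h | h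
      · exact (Linked.right hS1 (c3 _ h1' le_rfl) (c5 h)).trans
          ((Linked.up hS1 (c5 h) (c1 _ (by omega) (by omega)) (by omega)).trans
          (Linked.right hS1 (c2 _ (by omega) (by omega)) (c1 _ (by omega) (by omega))).symm)
      · exact Linked.up hS1 (c3 _ h1' le_rfl) (c2 _ (by omega) (by omega)) (by omega)
    have e5 : Linked r S (ρ, t) (ρ, t + 1) := by
      rcases Nat.mod_two_eq_zero_or_one t with h | h
      · exact (Linked.right hS1 (c2 _ (by omega) (by omega)) (c1 _ (by omega) (by omega))).trans
          ((Linked.up hS1 (c1 _ (by omega) (by omega)) (c6 h) (by omega)).trans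
          (Linked.right hS1 (c4 _ h3' le_rfl) (c6 h)).symm)
      · exact Linked.up hS1 (c2 _ (by omega) (by omega)) (c4 _ h3' le_rfl) (by omega)
    exact e2.trans (e5.symm.trans (e3.symm.trans (e4.symm.trans e1.symm)))
  · obtain ⟨⟨hw, -⟩, h⟩ := (hm x y).1 h
    exact ⟨hw.2.2.1, by omega, h⟩

namespace Wall

open SimpleGraph

variable {V : Type*} {G : SimpleGraph V} {r : ℕ} (W : Wall G r)

theorem part_subset_hull (S : Set (ℕ × ℕ)) : (W.part S).verts ⊆ W.hull S := fun _ h => Or.inr h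

theorem hull_layerVerts {i : ℕ} (hi : 1 ≤ i) (hir : 2 * i + 1 ≤ r) :
    W.hull (layerVerts r i) = (W.perim i).verts :=
  (W.hull_subset_part fun _ => exists_adj_layerVerts W.odd hi hir).antisymm (W.part_subset_hull _)

theorem exists_walk_of_mem_seg {p q : ℕ × ℕ} (h : (elementaryWall r).Adj p q) {v : V}
    (hv : v ∈ (W.seg p q h).support) (hne : v ≠ W.branch q) :
    ∃ w : G.Walk (W.branch p) v, (∀ x ∈ w.support, x ∈ (W.seg p q h).support) ∧
      W.branch q ∉ w.support := by
  classical
  exact ⟨(W.seg p q h).takeUntil v hv, fun x hx => Walk.support_takeUntil_subset_support _ hv hx,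
    Walk.endpoint_notMem_support_takeUntil (W.seg_isPath p q h) hv hne.symm⟩

theorem exists_walk_of_mem_hull {S : Set (ℕ × ℕ)} {v : V} (hv : v ∈ W.hull S) :
    ∃ p ∈ S, ∃ w : G.Walk (W.branch p) v, ∀ x ∈ w.support, x ∈ W.hull S := by
  classical
  rcases hv with ⟨p, hp, rfl⟩ | hv
  · exact ⟨p, hp, .nil, by simpa using W.branch_mem_hull hp⟩
  · obtain ⟨p, q, h, hp, hq, hv⟩ := W.mem_part_verts.1 hv
    exact ⟨p, hp, (W.seg p q h).takeUntil v hv, fun x hx =>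
      W.seg_mem_hull h hp hq (Walk.support_takeUntil_subset_support _ hv hx)⟩

theorem eq_branch_of_mem_seg {p q : ℕ × ℕ} (h : (elementaryWall r).Adj p q) {S : Set (ℕ × ℕ)}
    (hS : S ⊆ wallVerts r 1) (hp : p ∉ S) {v : V} (hv : v ∈ (W.seg p q h).support)
    (hv' : v ∈ W.hull S) : v = W.branch q := by
  refine W.eq_branch_of_mem_hull (S := {p, q}) ?_ hS ?_ (W.seg_mem_hull h (by simp) (by simp) hv)
    hv'
  · rintro x (rfl | rfl)
    · exact h.1
    · exact h.2.1
  · rintro x ⟨rfl | rfl, hx⟩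
    · exact absurd hx hp
    · rfl

set_option maxHeartbeats 1000000 in
theorem exists_separated (D : PlaneDrawing G) {i : ℕ} (hi : 2 ≤ i) (hir : 2 * i + 1 ≤ r) :
    ∃ m ∈ window r (i + 1), ∃ n ∈ outerVerts r i, ∀ p : G.Walk (W.branch m) (W.branch n),
      ∃ z ∈ p.support, z ∈ (W.perim i).verts := by
  have hr := W.odd
  have hr2 := Nat.odd_iff.1 hr
  have hi1 : 1 ≤ i := by omega
  obtain ⟨ξ, c, hξ, hc, hξ2, hne⟩ : ∃ ξ c : ℕ, (ξ = 2 * i + 1 ∨ ξ = 2 * i + 2) ∧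
      (c = 2 * i + 1 ∨ c = 2 * i + 2) ∧ (ξ + i) % 2 = 0 ∧ (c + i) % 2 = 1 := by
    rcases Nat.mod_two_eq_zero_or_one i with h | h
    · exact ⟨2 * i + 2, 2 * i + 1, by omega, by omega, by omega, by omega⟩
    · exact ⟨2 * i + 1, 2 * i + 2, by omega, by omega, by omega, by omega⟩
  obtain ⟨t, ht⟩ : ∃ t, t + i = r + 1 := ⟨r + 1 - i, by omega⟩
  obtain ⟨j, hij⟩ : ∃ j, i = j + 1 := ⟨i - 1, by omega⟩
  obtain ⟨ζ, rfl⟩ : ∃ ζ, ξ = ζ + 1 := ⟨ξ - 1, by omega⟩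
  obtain ⟨t, rfl⟩ : ∃ t', t = t' + 1 := ⟨t - 1, by omega⟩
  have hL := layerVerts_subset_one hr hi1 hir
  have hw1 := fun x y => wallVerts_one (x := x) (y := y) hr W.three_le
  obtain ⟨SA, hSAL, linkA, haA, hmA⟩ := exists_left_half (t := t) (ζ := ζ) (c := c) hr hi hir
    (by omega) (by omega) (by omega) (by omega) (by omega)
  obtain ⟨SB, hSBL, linkB, hyB, hmB⟩ := exists_right_half (t := t) (ζ := ζ + 2) (c := c) hr hi hir
    (by omega) (by omega) (by omega) (by omega) (by omega)
  have hSA1 : SA ⊆ wallVerts r 1 := hSAL.trans hL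
  have hSB1 : SB ⊆ wallVerts r 1 := hSBL.trans hL
  have va : (ζ, i) ∈ wallVerts r 1 := (hw1 _ _).2 (by omega)
  have vx : (ζ + 1, i) ∈ wallVerts r 1 := (hw1 _ _).2 (by omega)
  have vb : (ζ + 2, i) ∈ wallVerts r 1 := (hw1 _ _).2 (by omega)
  have va' : (ζ, j) ∈ wallVerts r 1 := (hw1 _ _).2 (by omega)
  have vn : (ζ + 1, j) ∈ wallVerts r 1 := (hw1 _ _).2 (by omega)
  have vb' : (ζ + 2, j) ∈ wallVerts r 1 := (hw1 _ _).2 (by omega)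
  have vm : (ζ + 1, i + 1) ∈ wallVerts r 1 := (hw1 _ _).2 (by omega)
  have vy : (c, t + 1) ∈ wallVerts r 1 := (hw1 _ _).2 (by omega)
  obtain ⟨Sax, m1⟩ : ∃ S : Set (ℕ × ℕ), ∀ x y, (x, y) ∈ S ↔
      (x = ζ ∧ y = i) ∨ (x = ζ + 1 ∧ y = i) :=
    ⟨{p | (p.1 = ζ ∧ p.2 = i) ∨ (p.1 = ζ + 1 ∧ p.2 = i)}, fun _ _ => Iff.rfl⟩
  obtain ⟨Sxb, m2⟩ : ∃ S : Set (ℕ × ℕ), ∀ x y, (x, y) ∈ S ↔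
      (x = ζ + 1 ∧ y = i) ∨ (x = ζ + 2 ∧ y = i) :=
    ⟨{p | (p.1 = ζ + 1 ∧ p.2 = i) ∨ (p.1 = ζ + 2 ∧ p.2 = i)}, fun _ _ => Iff.rfl⟩
  obtain ⟨Sxm, m3⟩ : ∃ S : Set (ℕ × ℕ), ∀ x y, (x, y) ∈ S ↔
      (x = ζ + 1 ∧ y = i) ∨ (x = ζ + 1 ∧ y = i + 1) :=
    ⟨{p | (p.1 = ζ + 1 ∧ p.2 = i) ∨ (p.1 = ζ + 1 ∧ p.2 = i + 1)}, fun _ _ => Iff.rfl⟩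
  obtain ⟨Sd, m4⟩ : ∃ S : Set (ℕ × ℕ), ∀ x y, (x, y) ∈ S ↔
      (x = ζ ∧ y = i) ∨ (x = ζ ∧ y = j) ∨ (x = ζ + 1 ∧ y = j) :=
    ⟨{p | (p.1 = ζ ∧ p.2 = i) ∨ (p.1 = ζ ∧ p.2 = j) ∨ (p.1 = ζ + 1 ∧ p.2 = j)}, fun _ _ => Iff.rfl⟩
  obtain ⟨Se, m5⟩ : ∃ S : Set (ℕ × ℕ), ∀ x y, (x, y) ∈ S ↔
      (x = ζ + 1 ∧ y = j) ∨ (x = ζ + 2 ∧ y = j) ∨ (x = ζ + 2 ∧ y = i) :=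
    ⟨{p | (p.1 = ζ + 1 ∧ p.2 = j) ∨ (p.1 = ζ + 2 ∧ p.2 = j) ∨ (p.1 = ζ + 2 ∧ p.2 = i)}, fun _ _ => Iff.rfl⟩
  obtain ⟨Sy, m6⟩ : ∃ S : Set (ℕ × ℕ), ∀ x y, (x, y) ∈ S ↔
      (x = c ∧ y = t + 1) ∨ (x, y) ∈ window r (i + 1) :=
    ⟨{p | (p.1 = c ∧ p.2 = t + 1) ∨ p ∈ window r (i + 1)}, fun _ _ => Iff.rfl⟩
  simp only [mem_window] at m6
  have hSax1 : Sax ⊆ wallVerts r 1 := by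
    rintro ⟨x, y⟩ h; rw [m1] at h; rw [hw1]; omega
  have hSxb1 : Sxb ⊆ wallVerts r 1 := by
    rintro ⟨x, y⟩ h; rw [m2] at h; rw [hw1]; omega
  have hSxm1 : Sxm ⊆ wallVerts r 1 := by
    rintro ⟨x, y⟩ h; rw [m3] at h; rw [hw1]; omega
  have hSd1 : Sd ⊆ wallVerts r 1 := by
    rintro ⟨x, y⟩ h; rw [m4] at h; rw [hw1]; omega
  have hSe1 : Se ⊆ wallVerts r 1 := by
    rintro ⟨x, y⟩ h; rw [m5] at h; rw [hw1]; omega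
  have hSy1 : Sy ⊆ wallVerts r 1 := by
    rintro ⟨x, y⟩ h; rw [m6] at h; rw [hw1]; omega
  have linkax : Linked r Sax (ζ, i) (ζ + 1, i) :=
    Linked.right hSax1 ((m1 _ _).2 (by omega)) ((m1 _ _).2 (by omega))
  have linkxb : Linked r Sxb (ζ + 1, i) (ζ + 2, i) :=
    Linked.right hSxb1 ((m2 _ _).2 (by omega)) ((m2 _ _).2 (by omega))
  have linkxm : Linked r Sxm (ζ + 1, i) (ζ + 1, i + 1) :=
    Linked.up hSxm1 ((m3 _ _).2 (by omega)) ((m3 _ _).2 (by omega)) (by omega)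
  have linkd : Linked r Sd (ζ, i) (ζ + 1, j) := by
    have := Linked.up hSd1 (x := ζ) (y := j) ((m4 _ _).2 (by omega)) ((m4 _ _).2 (by omega))
      (by omega)
    rw [← hij] at this
    exact this.symm.trans (Linked.right hSd1 ((m4 _ _).2 (by omega)) ((m4 _ _).2 (by omega)))
  have linke : Linked r Se (ζ + 1, j) (ζ + 2, i) := by
    have := Linked.up hSe1 (x := ζ + 2) (y := j) ((m5 _ _).2 (by omega)) ((m5 _ _).2 (by omega))
      (by omega)
    rw [← hij] at this
    exact (Linked.right hSe1 ((m5 _ _).2 (by omega)) ((m5 _ _).2 (by omega))).trans this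
  have linkmy : Linked r Sy (ζ + 1, i + 1) (c, t + 1) :=
    ((linked_window hr hi1 hir (p := (ζ + 1, i + 1)) (q := (c, t))
      (mem_window.2 (by omega)) (mem_window.2 (by omega))).mono (by
        rintro ⟨x, y⟩ h; rw [mem_window] at h; rw [m6]; omega)).trans
      (Linked.up hSy1 ((m6 _ _).2 (by omega)) ((m6 _ _).2 (by omega)) (by omega))
  obtain ⟨wax, pax, hax, -⟩ := W.exists_path ((m1 _ _).2 (by omega)) linkax
  obtain ⟨wxb, pxb, hxb, -⟩ := W.exists_path ((m2 _ _).2 (by omega)) linkxb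
  obtain ⟨wxm, pxm, hxm, -⟩ := W.exists_path ((m3 _ _).2 (by omega)) linkxm
  obtain ⟨wd, pd, hd, -⟩ := W.exists_path ((m4 _ _).2 (by omega)) linkd
  obtain ⟨we, pe, he, -⟩ := W.exists_path ((m5 _ _).2 (by omega)) linke
  obtain ⟨wmy, pmy, hmy, -⟩ := W.exists_path ((m6 _ _).2 (by omega)) linkmy
  obtain ⟨wA, pA, hA, -⟩ := W.exists_path haA linkA
  obtain ⟨wB, pB, hB, -⟩ := W.exists_path hyB linkB
  have meet : ∀ {S T : Set (ℕ × ℕ)} (p : ℕ × ℕ), S ⊆ wallVerts r 1 → T ⊆ wallVerts r 1 →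
      S ∩ T ⊆ {p} → ∀ v ∈ W.hull S, v ∈ W.hull T → v = W.branch p :=
    fun p hS hT h v hv hv' => W.eq_branch_of_mem_hull hS hT h hv hv'
  have away : ∀ {S T : Set (ℕ × ℕ)}, S ⊆ wallVerts r 1 → T ⊆ wallVerts r 1 →
      S ∩ T = ∅ → ∀ v ∈ W.hull S, v ∉ W.hull T :=
    fun hS hT h v hv hv' => Set.disjoint_left.1 (W.disjoint_hull hS hT
      (Set.disjoint_iff_inter_eq_empty.2 h)) hv hv'
  have ne : ∀ {p q : ℕ × ℕ}, p ∈ wallVerts r 1 → q ∈ wallVerts r 1 → p ≠ q →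
      W.branch p ≠ W.branch q := fun hp hq h h' => h (W.branch_injOn hp hq h')
  have subset_tac : ∀ {S T : Set (ℕ × ℕ)} {a b : ℕ},
      (∀ x y, (x, y) ∈ S → (x, y) ∈ T → x = a ∧ y = b) → S ∩ T ⊆ {(a, b)} := by
    rintro S T a b h ⟨x, y⟩ ⟨h1, h2⟩
    exact Prod.ext (h x y h1 h2).1 (h x y h1 h2).2
  have empty_tac : ∀ {S T : Set (ℕ × ℕ)},
      (∀ x y, (x, y) ∈ S → (x, y) ∈ T → False) → S ∩ T = ∅ := by
    intro S T h
    exact Set.eq_empty_of_forall_notMem fun ⟨x, y⟩ ⟨h1, h2⟩ => h x y h1 h2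
  have K : ∀ z, z ∈ (wax.append wxb).support → z ∈ W.hull Sax ∨ z ∈ W.hull Sxb := by
    intro z hz
    exact ((Walk.mem_support_append_iff _ _).1 hz).imp (hax z) (hxb z)
  have K' : ∀ z, z ∈ (wA.append wB).support → z ∈ W.hull SA ∨ z ∈ W.hull SB := by
    intro z hz
    exact ((Walk.mem_support_append_iff _ _).1 hz).imp (hA z) (hB z)
  have Kd : ∀ z, z ∈ (wd.append we).support → z ∈ W.hull Sd ∨ z ∈ W.hull Se := by
    intro z hz
    exact ((Walk.mem_support_append_iff _ _).1 hz).imp (hd z) (he z)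
  have Kc : ∀ z, z ∈ (wxm.append wmy).support → z ∈ W.hull Sxm ∨ z ∈ W.hull Sy := by
    intro z hz
    exact ((Walk.mem_support_append_iff _ _).1 hz).imp (hxm z) (hmy z)
  refine ⟨(ζ + 1, i + 1), mem_window.2 (by omega), (ζ + 1, j), ?_, fun p => ?_⟩
  · rw [mem_outerVerts hr hi1 hir]; omega
  obtain ⟨z, hz, hz'⟩ := D.exists_mem_of_chords (w₁ := wax.append wxb) (w₂ := wA.append wB)
    (d := wd.append we) (c := wxm.append wmy) (m := W.branch (ζ + 1, i + 1))
    (n := W.branch (ζ + 1, j))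
    (pax.append_of_inter pxb fun v hv hv' => meet _ hSax1 hSxb1
      (subset_tac (a := ζ + 1) (b := i) fun x y => by rw [m1, m2]; omega) v (hax v hv) (hxb v hv'))
    (pA.append_of_inter pB fun v hv hv' => meet _ hSA1 hSB1
      (subset_tac (a := c) (b := t + 1) fun x y h h' => by have := hmA x y h; have := hmB x y h'; omega)
        v (hA v hv) (hB v hv'))
    (pd.append_of_inter pe fun v hv hv' => meet _ hSd1 hSe1
      (subset_tac (a := ζ + 1) (b := j) fun x y => by rw [m4, m5]; omega) v (hd v hv) (he v hv'))
    (pxm.append_of_inter pmy fun v hv hv' => meet _ hSxm1 hSy1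
      (subset_tac (a := ζ + 1) (b := i + 1) fun x y => by rw [m3, m6]; omega)
        v (hxm v hv) (hmy v hv'))
    (by
      intro v hv hv'
      rcases K v hv with hv | hv <;> rcases K' v hv' with hv' | hv'
      · exact Or.inl (meet _ hSax1 hSA1 (subset_tac fun x y h h' => by
          have := (m1 x y).1 h; have := hmA x y h'; omega) v hv hv')
      · exact absurd hv' (away hSax1 hSB1 (empty_tac fun x y h h' => by
          have := (m1 x y).1 h; have := hmB x y h'; omega) v hv)
      · exact absurd hv' (away hSxb1 hSA1 (empty_tac fun x y h h' => by
          have := (m2 x y).1 h; have := hmA x y h'; omega) v hv)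
      · exact Or.inr (meet _ hSxb1 hSB1 (subset_tac fun x y h h' => by
          have := (m2 x y).1 h; have := hmB x y h'; omega) v hv hv'))
    (by
      intro v hv hv'
      rcases Kd v hv with hv | hv <;> rcases K v hv' with hv' | hv'
      · exact Or.inl (meet _ hSd1 hSax1 (subset_tac fun x y => by rw [m4, m1]; omega) v hv hv')
      · exact absurd hv' (away hSd1 hSxb1 (empty_tac fun x y => by rw [m4, m2]; omega) v hv)
      · exact absurd hv' (away hSe1 hSax1 (empty_tac fun x y => by rw [m5, m1]; omega) v hv)
      · exact Or.inr (meet _ hSe1 hSxb1 (subset_tac fun x y => by rw [m5, m2]; omega) v hv hv'))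
    (by
      intro v hv hv'
      rcases Kd v hv with hv | hv <;> rcases K' v hv' with hv' | hv'
      · exact Or.inl (meet _ hSd1 hSA1 (subset_tac fun x y h h' => by
          have := (m4 x y).1 h; have := hmA x y h'; omega) v hv hv')
      · exact absurd hv' (away hSd1 hSB1 (empty_tac fun x y h h' => by
          have := (m4 x y).1 h; have := hmB x y h'; omega) v hv)
      · exact absurd hv' (away hSe1 hSA1 (empty_tac fun x y h h' => by
          have := (m5 x y).1 h; have := hmA x y h'; omega) v hv)
      · exact Or.inr (meet _ hSe1 hSB1 (subset_tac fun x y h h' => by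
          have := (m5 x y).1 h; have := hmB x y h'; omega) v hv hv'))
    (by simp [Walk.mem_support_append_iff]) (ne vx va (by simp)) (ne vx vb (by simp))
    (by simp [Walk.mem_support_append_iff])
    (ne vy va (by simp; omega)) (ne vy vb (by simp; omega))
    (by
      intro v hv hv'
      rcases Kc v hv with hv | hv <;> rcases K v hv' with hv' | hv'
      · exact (meet _ hSxm1 hSax1 (subset_tac fun x y => by rw [m3, m1]; omega) v hv hv')
      · exact (meet _ hSxm1 hSxb1 (subset_tac fun x y => by rw [m3, m2]; omega) v hv hv')
      · exact absurd hv' (away hSy1 hSax1 (empty_tac fun x y => by rw [m6, m1]; omega) v hv)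
      · exact absurd hv' (away hSy1 hSxb1 (empty_tac fun x y => by rw [m6, m2]; omega) v hv))
    (by
      intro v hv hv'
      rcases Kc v hv with hv | hv <;> rcases K' v hv' with hv' | hv'
      · exact absurd hv' (away hSxm1 hSA1 (empty_tac fun x y h h' => by
          have := (m3 x y).1 h; have := hmA x y h'; omega) v hv)
      · exact absurd hv' (away hSxm1 hSB1 (empty_tac fun x y h h' => by
          have := (m3 x y).1 h; have := hmB x y h'; omega) v hv)
      · exact (meet _ hSy1 hSA1 (subset_tac fun x y h h' => by
          have := (m6 x y).1 h; have := hmA x y h'; omega) v hv hv')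
      · exact (meet _ hSy1 hSB1 (subset_tac fun x y h h' => by
          have := (m6 x y).1 h; have := hmB x y h'; omega) v hv hv'))
    (by
      intro v hv hv'
      rcases Kc v hv with hv | hv <;> rcases Kd v hv' with hv' | hv'
      · exact absurd hv' (away hSxm1 hSd1 (empty_tac fun x y => by rw [m3, m4]; omega) v hv)
      · exact absurd hv' (away hSxm1 hSe1 (empty_tac fun x y => by rw [m3, m5]; omega) v hv)
      · exact absurd hv' (away hSy1 hSd1 (empty_tac fun x y => by rw [m6, m4]; omega) v hv)
      · exact absurd hv' (away hSy1 hSe1 (empty_tac fun x y => by rw [m6, m5]; omega) v hv))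
    (by simp [Walk.mem_support_append_iff]) (ne vm vx (by simp)) (ne vm vy (by simp; omega))
    (by simp [Walk.mem_support_append_iff]) (ne vn va (by simp)) (ne vn vb (by simp)) p
  refine ⟨z, hz, ?_⟩
  rw [← W.hull_layerVerts hi1 hir]
  have hSax2 : Sax ⊆ layerVerts r i := by
    rintro ⟨x, y⟩ h; rw [m1] at h; rw [mem_layerVerts hr hi1 hir, mem_window, IsPruned]; omega
  have hSxb2 : Sxb ⊆ layerVerts r i := by
    rintro ⟨x, y⟩ h; rw [m2] at h; rw [mem_layerVerts hr hi1 hir, mem_window, IsPruned]; omega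
  rcases hz' with hz' | hz'
  · rcases K z hz' with h | h
    · exact W.hull_mono hSax2 h
    · exact W.hull_mono hSxb2 h
  · rcases K' z hz' with h | h
    · exact W.hull_mono hSAL h
    · exact W.hull_mono hSBL h

theorem notMem_compass (D : PlaneDrawing G) {i : ℕ} (hi : 2 ≤ i) (hir : 2 * i + 1 ≤ r)
    {p : ℕ × ℕ} (hp : p ∈ outerVerts r i) {v : V} (w : G.Walk (W.branch p) v)
    (hw : ∀ x ∈ w.support, x ∉ (W.perim i).verts) : v ∉ (W.compass i).verts := by
  have hr := W.odd
  have hi1 : 1 ≤ i := by omega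
  have hL := layerVerts_subset_one hr hi1 hir
  have hO : outerVerts r i ⊆ wallVerts r 1 := Set.sdiff_subset
  have hN : window r (i + 1) ⊆ wallVerts r 1 :=
    (window_subset hr hi1 hir).trans (wallVerts_subset_one hr hi1 hir)
  have hOL : ∀ x ∈ W.hull (outerVerts r i), x ∉ (W.perim i).verts := by
    rw [← W.hull_layerVerts hi1 hir]
    exact fun x hx hx' => Set.disjoint_left.1 (W.disjoint_hull hO hL
      (Set.disjoint_left.2 fun a ha ha' => ha.2 ha'.1)) hx hx'
  have hNL : ∀ x ∈ W.hull (window r (i + 1)), x ∉ (W.perim i).verts := by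
    rw [← W.hull_layerVerts hi1 hir]
    exact fun x hx hx' => Set.disjoint_left.1 (W.disjoint_hull hN hL
      (Set.disjoint_left.2 fun a ha ha' => ha'.2 ha)) hx hx'
  obtain ⟨m, hm, n, hn, hmn⟩ := W.exists_separated D hi hir
  rintro (⟨u, hu, c, hc⟩ | hv)
  swap
  · exact hw v w.end_mem_support hv
  have huP : u ∉ (W.perim i).verts := hc u c.start_mem_support
  obtain ⟨q, hq, w', hw'⟩ : ∃ q ∈ window r (i + 1), ∃ w' : G.Walk (W.branch q) u,
      ∀ x ∈ w'.support, x ∉ (W.perim i).verts := by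
    obtain ⟨a, b, hab, ha, hb, hu⟩ := W.mem_part_verts.1 hu
    have key : ∀ a b (hab : (elementaryWall r).Adj a b), a ∈ wallVerts r i → b ∈ wallVerts r i →
        u ∈ (W.seg a b hab).support → a ∉ layerVerts r i →
        ∃ q ∈ window r (i + 1), ∃ w' : G.Walk (W.branch q) u,
          ∀ x ∈ w'.support, x ∉ (W.perim i).verts := by
      intro a b hab ha hb hu haL
      have haw := wallVerts_diff_layerVerts ha haL
      by_cases hbL : b ∈ layerVerts r i
      · have hne : u ≠ W.branch b := by
          rintro rfl
          exact huP (W.hull_layerVerts hi1 hir ▸ W.branch_mem_hull hbL)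
        obtain ⟨w', h1, h2⟩ := W.exists_walk_of_mem_seg hab hu hne
        refine ⟨a, haw, w', fun x hx hx' => ?_⟩
        rw [← W.hull_layerVerts hi1 hir] at hx'
        have := W.eq_branch_of_mem_seg hab hL haL (h1 x hx) hx'
        exact h2 (this ▸ hx)
      · obtain ⟨q, hq, w', hw'⟩ := W.exists_walk_of_mem_hull
          (W.seg_mem_hull hab haw (wallVerts_diff_layerVerts hb hbL) hu)
        exact ⟨q, hq, w', fun x hx => hNL x (hw' x hx)⟩
    by_cases haL : a ∈ layerVerts r i
    · by_cases hbL : b ∈ layerVerts r i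
      · exact absurd (W.mem_part_verts.2 ⟨a, b, hab, haL, hbL, hu⟩) huP
      · refine key b a hab.symm hb ha ?_ hbL
        rw [W.seg_symm a b hab, Walk.support_reverse, List.mem_reverse]
        exact hu
    · exact key a b hab ha hb hu haL
  obtain ⟨w1, hw1, -⟩ := W.exists_walk hm (linked_window hr hi1 hir hm hq)
  obtain ⟨w2, hw2, -⟩ := W.exists_walk hp (linked_outerVerts hr hi hir hp hn)
  obtain ⟨z, hz, hzP⟩ := hmn (w1.append (w'.append (c.append (w.reverse.append w2))))
  simp only [Walk.mem_support_append_iff, Walk.support_reverse, List.mem_reverse] at hz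
  rcases hz with hz | hz | hz | hz | hz
  · exact hNL z (hw1 z hz) hzP
  · exact hw' z hz hzP
  · exact hc z hz hzP
  · exact hw z hz hzP
  · exact hOL z (hw2 z hz) hzP

theorem notMem_compass_of_mem_hull (D : PlaneDrawing G) {i : ℕ} (hi : 2 ≤ i)
    (hir : 2 * i + 1 ≤ r) {v : V} (hv : v ∈ W.hull (outerVerts r i)) :
    v ∉ (W.compass i).verts := by
  have hi1 : 1 ≤ i := by omega
  obtain ⟨p, hp, w, hw⟩ := W.exists_walk_of_mem_hull hv
  refine W.notMem_compass D hi hir hp w fun x hx => ?_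
  rw [← W.hull_layerVerts hi1 hir]
  exact fun hx' => Set.disjoint_left.1 (W.disjoint_hull Set.sdiff_subset
    (layerVerts_subset_one W.odd hi1 hir)
      (Set.disjoint_left.2 fun a ha ha' => ha.2 ha'.1)) (hw x hx) hx'

theorem notMem_compass_of_mem_seg (D : PlaneDrawing G) {i : ℕ} (hi : 2 ≤ i)
    (hir : 2 * i + 1 ≤ r) {p q : ℕ × ℕ} (h : (elementaryWall r).Adj p q)
    (hp : p ∈ outerVerts r i) {v : V} (hv : v ∈ (W.seg p q h).support) (hne : v ≠ W.branch q) :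
    v ∉ (W.compass i).verts := by
  have hi1 : 1 ≤ i := by omega
  obtain ⟨w, h1, h2⟩ := W.exists_walk_of_mem_seg h hv hne
  refine W.notMem_compass D hi hir hp w fun x hx => ?_
  rw [← W.hull_layerVerts hi1 hir]
  intro hx'
  have := W.eq_branch_of_mem_seg h (layerVerts_subset_one W.odd hi1 hir)
    (fun hpL => hp.2 hpL.1) (h1 x hx) hx'
  exact h2 (this ▸ hx)

end Wall

/-! ### In-pegs -/

/-- The coordinates of the in-pegs of the perimeter. -/
def IsPeg (r : ℕ) (p : ℕ × ℕ) : Prop :=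
  (p.1 = 2 ∧ 2 ≤ p.2 ∧ p.2 + 1 ≤ r) ∨ (p.2 = r ∧ p.1 % 2 = 0 ∧ 4 ≤ p.1 ∧ p.1 + 2 ≤ 2 * r) ∨
  (p.1 + 1 = 2 * r ∧ 2 ≤ p.2 ∧ p.2 + 1 ≤ r) ∨
  (p.2 = 1 ∧ p.1 % 2 = 1 ∧ 3 ≤ p.1 ∧ p.1 + 3 ≤ 2 * r)

theorem isPeg_of_ncard {r : ℕ} (hr : Odd r) (h3 : 3 ≤ r) {p : ℕ × ℕ} (hp : p ∈ layerVerts r 1)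
    (hn : 3 ≤ ((elementaryWall r).neighborSet p).ncard) : IsPeg r p := by
  have hr2 := Nat.odd_iff.1 hr
  obtain ⟨x, y⟩ := p
  set V : ℕ × ℕ := if (x + y) % 2 = 0 then (x, y + 1) else (x, y - 1) with hV
  have hsub : (elementaryWall r).neighborSet (x, y) ⊆ {(x - 1, y), (x + 1, y), V} := by
    rintro ⟨x', y'⟩ ⟨h1, h2, h⟩
    rw [brickGraph_adj] at h
    simp only [Set.mem_insert_iff, Set.mem_singleton_iff, hV]
    split_ifs <;> simp only [Prod.mk.injEq] <;> omega
  have key : ∀ a b c : ℕ × ℕ, (elementaryWall r).neighborSet (x, y) ⊆ {a, b, c} →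
      a ∈ wallVerts r 1 := by
    intro a b c h
    by_contra ha
    have : (elementaryWall r).neighborSet (x, y) ⊆ {b, c} := by
      intro q hq
      rcases h hq with rfl | h
      · exact absurd hq.2.1 ha
      · exact h
    have := Set.ncard_le_ncard this (by simp)
    have := Set.ncard_insert_le b {c}
    rw [Set.ncard_singleton] at this
    omega
  have h1 := key _ _ _ hsub
  have h2 := key (x + 1, y) (x - 1, y) V (fun q hq => by
    rcases hsub hq with h | h | h
    · exact Or.inr (Or.inl h)
    · exact Or.inl h
    · exact Or.inr (Or.inr h))
  have h3' := key V (x + 1, y) (x - 1, y) (fun q hq => by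
    rcases hsub hq with h | h | h
    · exact Or.inr (Or.inr h)
    · exact Or.inr (Or.inl h)
    · exact Or.inl h)
  rw [layerVerts_one hr h3, wallVerts_one hr h3] at hp
  rw [wallVerts_one hr h3] at h1 h2
  have h4 : 2 ≤ x ∧ x + 1 ≤ 2 * r ∧ 1 ≤ y ∧ y ≤ r := by omega
  have h5 : (x + y) % 2 = 0 ∧ y + 1 ≤ r ∨ (x + y) % 2 = 1 ∧ 2 ≤ y := by
    split_ifs at hV with he <;> rw [hV, wallVerts_one hr h3] at h3'
    · exact Or.inl ⟨he, h3'.2.2.2.1⟩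
    · exact Or.inr ⟨by omega, by omega⟩
  have h6 : ¬ (x = 2 ∧ y = r) ∧ ¬ (x + 1 = 2 * r ∧ y = 1) := by omega
  clear h1 h2 h3' hsub key hn hV
  replace hp := hp.2
  rcases hp with h | h | h | h
  · exact Or.inl (by simp only; omega)
  · exact Or.inr (Or.inr (Or.inl (by simp only; omega)))
  · by_cases hx : x = 2 ∨ x + 1 = 2 * r
    · exfalso; omega
    · exact Or.inr (Or.inr (Or.inr (by simp only; omega)))
  · by_cases hx : x = 2 ∨ x + 1 = 2 * r
    · exfalso; omega
    · exact Or.inr (Or.inl (by simp only; omega))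

theorem IsPeg.mem_layerVerts {r : ℕ} (hr : Odd r) (h3 : 3 ≤ r) {p : ℕ × ℕ} (hp : IsPeg r p) :
    p ∈ layerVerts r 1 := by
  obtain ⟨x, y⟩ := p
  rw [layerVerts_one hr h3, wallVerts_one hr h3]
  rw [IsPeg] at hp
  simp only at hp
  omega

namespace Wall

open SimpleGraph

variable {V : Type*} {G : SimpleGraph V} {r : ℕ} (W : Wall G r)

theorem mem_neighborSet_nested {u v : V} : u ∈ (W.nested 1).neighborSet v ↔
    ∃ (p q : ℕ × ℕ) (h : (elementaryWall r).Adj p q), s(v, u) ∈ (W.seg p q h).edges := by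
  rw [Subgraph.mem_neighborSet, nested, part_adj]
  constructor
  · rintro ⟨p, q, h, -, -, he⟩; exact ⟨p, q, h, he⟩
  · rintro ⟨p, q, h, he⟩; exact ⟨p, q, h, h.1, h.2.1, he⟩

theorem IsInPeg.exists_isPeg [Finite V] {v : V} (h : W.IsInPeg v) :
    ∃ p, IsPeg r p ∧ v = W.branch p := by
  classical
  obtain ⟨hv, hn⟩ := h
  obtain ⟨a, b, hab, ha, hb, hv⟩ := W.mem_part_verts.1 hv
  by_cases hbr : ∃ p ∈ wallVerts r 1, v = W.branch p
  · obtain ⟨p, hp, rfl⟩ := hbr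
    have hpL : p ∈ layerVerts r 1 := by
      rcases W.branch_mem_seg a b hab p hp hv with rfl | rfl
      · exact ha
      · exact hb
    refine ⟨p, isPeg_of_ncard W.odd W.three_le hpL ?_, rfl⟩
    have hsub : (W.nested 1).neighborSet (W.branch p) ⊆
        (fun q => if h : (elementaryWall r).Adj p q then (W.seg p q h).snd else W.branch p) ''
          (elementaryWall r).neighborSet p := by
      intro u hu
      have key : ∀ p' q' (h : (elementaryWall r).Adj p' q'), p' = p →
          s(W.branch p, u) ∈ (W.seg p' q' h).edges → u ∈
        (fun q => if h : (elementaryWall r).Adj p q then (W.seg p q h).snd else W.branch p) ''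
          (elementaryWall r).neighborSet p := by
        rintro p' q' h rfl he
        refine ⟨q', h, ?_⟩
        have hne : W.branch p' ≠ W.branch q' :=
          fun e => h.ne (W.branch_injOn h.1 h.2.1 e)
        have := (W.seg_isPath p' q' h).neighborSet_toSubgraph_startpoint
          (fun hnil => hne hnil.eq)
        have hu : u ∈ (W.seg p' q' h).toSubgraph.neighborSet (W.branch p') := by
          rw [Subgraph.mem_neighborSet, Walk.adj_toSubgraph_iff_mem_edges]
          exact he
        rw [this] at hu
        simp only [dif_pos h]
        exact hu.symm
      obtain ⟨p', q', h, he⟩ := W.mem_neighborSet_nested.1 hu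
      rcases W.branch_mem_seg p' q' h p hp (Walk.fst_mem_support_of_mem_edges _ he) with e | e
      · exact key p' q' h e.symm he
      · refine key q' p' h.symm e.symm ?_
        rw [W.seg_symm p' q' h, Walk.edges_reverse, List.mem_reverse]
        exact he
    have hfin : ((elementaryWall r).neighborSet p).Finite := by
      refine Set.Finite.subset (Set.finite_Iic ((p.1 + 1, p.2 + 1) : ℕ × ℕ)) ?_
      rintro ⟨x', y'⟩ h
      obtain ⟨x, y⟩ := p
      have := h.2.2
      rw [brickGraph_adj] at this
      exact Prod.mk_le_mk.2 (by omega)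
    calc 3 = _ := hn.symm
      _ ≤ _ := Set.ncard_le_ncard hsub (hfin.image _)
      _ ≤ _ := Set.ncard_image_le hfin
  · exfalso
    have hsub : (W.nested 1).neighborSet v ⊆ (W.seg a b hab).toSubgraph.neighborSet v := by
      intro u hu
      rw [Subgraph.mem_neighborSet, Walk.adj_toSubgraph_iff_mem_edges]
      obtain ⟨p', q', h, he⟩ := W.mem_neighborSet_nested.1 hu
      by_cases hs : s(a, b) = s(p', q')
      · rcases Sym2.eq_iff.1 hs with ⟨rfl, rfl⟩ | ⟨rfl, rfl⟩
        · exact he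
        · rwa [W.seg_symm a b hab, Walk.edges_reverse, List.mem_reverse] at he
      · exact absurd (W.seg_inter a b hab p' q' h hs v hv
          (Walk.fst_mem_support_of_mem_edges _ he)) hbr
    have hva : v ≠ W.branch a := fun e => hbr ⟨a, hab.1, e⟩
    have hvb : v ≠ W.branch b := fun e => hbr ⟨b, hab.2.1, e⟩
    obtain ⟨i, hi, hil⟩ := (Walk.mem_support_iff_exists_getVert).1 hv
    have hi0 : i ≠ 0 := by rintro rfl; rw [Walk.getVert_zero] at hi; exact hva hi.symm
    have hil' : i < (W.seg a b hab).length := by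
      rcases lt_or_eq_of_le hil with h | h
      · exact h
      · rw [h, Walk.getVert_length] at hi; exact absurd hi.symm hvb
    have h2 := (W.seg_isPath a b hab).ncard_neighborSet_toSubgraph_internal_eq_two hi0 hil'
    rw [hi] at h2
    have := Set.ncard_le_ncard hsub (Set.toFinite _)
    omega

end Wall

/-! ### Pairings whose union with a given pairing is a single cycle -/

theorem Finset.even_card_of_involution {α : Type*} [DecidableEq α] (A : Finset α) (f : α → α)
    (hf : ∀ x ∈ A, f x ∈ A) (hf2 : ∀ x ∈ A, f (f x) = x) (hne : ∀ x ∈ A, f x ≠ x) :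
    A.card % 2 = 0 := by
  have h : ∑ _x ∈ A, (1 : ZMod 2) = 0 :=
    Finset.sum_involution (fun x _ => f x) (fun _ _ => by decide) (fun x hx _ => hne x hx)
      (fun x hx => hf x hx) (fun x hx => hf2 x hx)
  rw [Finset.sum_const, nsmul_eq_mul, mul_one] at h
  have := (ZMod.natCast_eq_zero_iff _ _).1 h
  omega

/-- A fixed-point-free involution of `{0, …, n - 1}`. -/
structure IsPairing (n : ℕ) (M : ℕ → ℕ) : Prop where
  lt : ∀ i < n, M i < n
  inv : ∀ i < n, M (M i) = i
  ne : ∀ i < n, M i ≠ i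

/-- Replace the pairs of `x` and `y` by `{x, y}` and the pair of their former partners. -/
def mergePairs (M : ℕ → ℕ) (x y i : ℕ) : ℕ :=
  if i = x then y else if i = y then x else if i = M x then M y else if i = M y then M x else M i

namespace IsPairing

variable {n : ℕ} {M E : ℕ → ℕ}

theorem eq_iff (hM : IsPairing n M) {i j : ℕ} (hi : i < n) (hj : j < n) : M i = j ↔ M j = i := by
  constructor
  · rintro rfl; exact hM.inv i hi
  · rintro rfl; exact hM.inv j hj

theorem inj (hM : IsPairing n M) {i j : ℕ} (hi : i < n) (hj : j < n) (h : M i = M j) : i = j := by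
  rw [← hM.inv i hi, h, hM.inv j hj]

theorem mergePairs (hM : IsPairing n M) {x y : ℕ} (hx : x < n) (hy : y < n) (hxy : x ≠ y)
    (hne : M x ≠ y) : IsPairing n (mergePairs M x y) := by
  have h1 := hM.lt x hx
  have h2 := hM.lt y hy
  have h3 := hM.ne x hx
  have h4 := hM.ne y hy
  have h5 : M y ≠ x := fun h => hne ((hM.eq_iff hy hx).1 h)
  have h6 : M x ≠ M y := fun h => hxy (hM.inj hx hy h)
  have h7 := hM.inv x hx
  have h8 := hM.inv y hy
  have key : ∀ i < n, i ≠ x → i ≠ y → i ≠ M x → i ≠ M y →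
      M i ≠ x ∧ M i ≠ y ∧ M i ≠ M x ∧ M i ≠ M y := by
    intro i hi a b c d
    refine ⟨fun h => c ?_, fun h => d ?_, fun h => a (hM.inj hi hx h),
      fun h => b (hM.inj hi hy h)⟩
    · exact ((hM.eq_iff hi hx).1 h).symm
    · exact ((hM.eq_iff hi hy).1 h).symm
  refine ⟨fun i hi => ?_, fun i hi => ?_, fun i hi => ?_⟩
  · have := hM.lt i hi
    unfold _root_.mergePairs
    split_ifs <;> assumption
  · have := hM.inv i hi
    have := key i hi
    simp only [_root_.mergePairs]
    by_cases a : i = x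
    · simp [a, hxy.symm]
    by_cases b : i = y
    · simp [b, hxy.symm]
    by_cases c : i = M x
    · simp [c, h3, hne, h4, h5, h6.symm]
    by_cases d : i = M y
    · simp [d, h3, hne, h4, h5, h6.symm]
    obtain ⟨e1, e2, e3, e4⟩ := this a b c d
    simp [a, b, c, d, e1, e2, e3, e4, hM.inv i hi]
  · have := hM.ne i hi
    unfold _root_.mergePairs
    split_ifs <;> first | assumption | omega

/-- If `C` separates `x` from `y`, then merging their pairs only makes closed sets larger. -/
theorem closed_of_mergePairs (hM : IsPairing n M) (hE : IsPairing n E) {x y : ℕ} (hx : x < n)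
    (hy : y < n) {C : Finset ℕ} (hCM : ∀ i ∈ C, M i ∈ C)
    (hCE : ∀ i ∈ C, E i ∈ C) (hxC : x ∈ C) (hyC : y ∉ C) {A : Finset ℕ}
    (hA : A ⊆ Finset.range n) (hAM : ∀ i ∈ A, _root_.mergePairs M x y i ∈ A)
    (hAE : ∀ i ∈ A, E i ∈ A) : ∀ i ∈ A, M i ∈ A := by
  have lt : ∀ {i}, i ∈ A → i < n := fun h => Finset.mem_range.1 (hA h)
  have hxy : x ≠ y := fun h => hyC (h ▸ hxC)
  have hne : M x ≠ y := fun h => hyC (h ▸ hCM x hxC)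
  have hne' : M y ≠ x := fun h => hne ((hM.eq_iff hy hx).1 h)
  have hMyC : M y ∉ C := fun h => hyC (hM.inv y hy ▸ hCM _ h)
  have hmM := hM.ne x hx
  have e1 : x ∈ A → y ∈ A := fun h => by simpa [_root_.mergePairs] using hAM x h
  have e2 : y ∈ A → x ∈ A := fun h => by simpa [_root_.mergePairs, hxy.symm] using hAM y h
  have e3 : M x ∈ A → M y ∈ A := fun h => by
    simpa [_root_.mergePairs, hmM, hne] using hAM _ h
  have e4 : M y ∈ A → M x ∈ A := fun h => by
    have h6 : M y ≠ M x := fun h => hxy (hM.inj hy hx h).symm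
    simpa [_root_.mergePairs, hM.ne y hy, hne', h6] using hAM _ h
  have e5 : ∀ i ∈ A, i ≠ x → i ≠ y → i ≠ M x → i ≠ M y → M i ∈ A := fun i hi a b c d => by
    simpa [_root_.mergePairs, a, b, c, d] using hAM i hi
  have main : x ∈ A ↔ M x ∈ A := by
    set B := A ∩ C with hB
    have hBE := Finset.even_card_of_involution B E
      (fun i hi => Finset.mem_inter.2 ⟨hAE i (Finset.mem_inter.1 hi).1,
        hCE i (Finset.mem_inter.1 hi).2⟩)
      (fun i hi => hE.inv i (lt (Finset.mem_inter.1 hi).1))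
      (fun i hi => hE.ne i (lt (Finset.mem_inter.1 hi).1))
    have hBM := Finset.even_card_of_involution ((B.erase x).erase (M x)) M
      (fun i hi => by
        simp only [Finset.mem_erase, hB, Finset.mem_inter] at hi ⊢
        obtain ⟨h1, h2, h3, h4⟩ := hi
        refine ⟨fun h => h2 (hM.inj (lt h3) hx h), fun h => h1 ?_, ?_, hCM i h4⟩
        · exact ((hM.eq_iff (lt h3) hx).1 h).symm
        · exact e5 i h3 h2 (fun h => hyC (h ▸ h4)) h1 (fun h => hMyC (h ▸ h4)))
      (fun i hi => hM.inv i (lt (Finset.mem_inter.1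
        (Finset.mem_of_mem_erase (Finset.mem_of_mem_erase hi))).1))
      (fun i hi => hM.ne i (lt (Finset.mem_inter.1
        (Finset.mem_of_mem_erase (Finset.mem_of_mem_erase hi))).1))
    by_contra hcon
    have hcard : (((B.erase x).erase (M x)).card + 1) = B.card := by
      by_cases h : x ∈ A
      · have h' : M x ∉ A := fun h' => hcon ⟨fun _ => h', fun _ => h⟩
        rw [Finset.erase_eq_of_notMem (a := M x)]
        · exact Finset.card_erase_add_one (Finset.mem_inter.2 ⟨h, hxC⟩)
        · simp [hB, h']
      · have h' : M x ∈ A := by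
          by_contra h'
          exact hcon ⟨fun h'' => absurd h'' h, fun h'' => absurd h'' h'⟩
        rw [Finset.erase_eq_of_notMem (a := x)]
        · exact Finset.card_erase_add_one (Finset.mem_inter.2 ⟨h', hCM x hxC⟩)
        · simp [hB, h]
    omega
  intro i hi
  by_cases a : i = x
  · subst a; exact main.1 hi
  by_cases b : i = y
  · subst b; exact e3 (main.1 (e2 hi))
  by_cases c : i = M x
  · subst c; rw [hM.inv x hx]; exact main.2 hi
  by_cases d : i = M y
  · subst d; rw [hM.inv y hy]; exact e1 (main.2 (e4 hi))
  exact e5 i hi a b c d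

end IsPairing

/-- The pairings that arise from the pairing `{1, 2}, {3, 4}, …, {n - 1, 0}` by merging the pairs
of `e` and `e + 1` for the elements `e` of the set `sw` of even numbers: `sw` determines the
pairs `{e, e + 1}`, the pairs that enclose them, and the single pair that encloses all others from
outside. -/
structure IsNested (n : ℕ) (sw : Finset ℕ) (M : ℕ → ℕ) : Prop extends IsPairing n M where
  pairs : ∀ i < n, i < M i → (i % 2 = 0 ∧ i ∈ sw ∧ M i = i + 1) ∨
    (i % 2 = 1 ∧ M i % 2 = 0 ∧ i - 1 ∉ sw ∧ M i ∉ sw ∧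
      ∀ e, i < e → e < M i → e % 2 = 0 → e ∈ sw) ∨
    (i % 2 = 0 ∧ M i % 2 = 1 ∧ i ∉ sw ∧ M i - 1 ∉ sw ∧
      ∀ e < n, e % 2 = 0 → (e < i ∨ M i < e) → e ∈ sw)
  outer : ∃ i < n, i < M i ∧ i % 2 = 0 ∧ i ∉ sw
  subset : sw ⊆ Finset.range n

theorem IsNested.merge {n : ℕ} {sw : Finset ℕ} {M : ℕ → ℕ} (h : IsNested n sw M) {e : ℕ}
    (he2 : e % 2 = 0) (hen : e + 1 < n) (hesw : e ∉ sw) (hne : M e ≠ e + 1) :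
    IsNested n (insert e sw) (mergePairs M e (e + 1)) := by
  have hx : e < n := by omega
  have h1 := h.lt e hx
  have h2 := h.lt (e + 1) hen
  have h3 := h.ne e hx
  have h4 := h.ne (e + 1) hen
  have h5 : M (e + 1) ≠ e := fun h' => hne ((h.eq_iff hen hx).1 h')
  have h6 : M e ≠ M (e + 1) := fun h' => by have := h.inj hx hen h'; omega
  have h7 := h.inv e hx
  have h8 := h.inv (e + 1) hen
  have key : ∀ i < n, i ≠ e → i ≠ e + 1 → i ≠ M e → i ≠ M (e + 1) →
      M i ≠ e ∧ M i ≠ e + 1 ∧ M i ≠ M e ∧ M i ≠ M (e + 1) := by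
    intro i hi a b c d
    refine ⟨fun h' => c ?_, fun h' => d ?_, fun h' => a (h.inj hi hx h'),
      fun h' => b (h.inj hi hen h')⟩
    · exact ((h.eq_iff hi hx).1 h').symm
    · exact ((h.eq_iff hi hen).1 h').symm
  set p := M e with hp
  set q := M (e + 1) with hq
  -- the pair of `e`
  have cx : (p < e ∧ p % 2 = 1 ∧ p - 1 ∉ sw ∧ ∀ f, p < f → f < e → f % 2 = 0 → f ∈ sw) ∨
      (e + 1 < p ∧ p % 2 = 1 ∧ p - 1 ∉ sw ∧
        ∀ f < n, f % 2 = 0 → (f < e ∨ p < f) → f ∈ sw) := by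
    rcases lt_or_gt_of_ne h3 with hlt | hlt
    · have := h.pairs p h1 (by omega)
      rw [h7] at this
      rcases this with hh | hh | hh
      · omega
      · exact Or.inl ⟨hlt, hh.1, hh.2.2.1, hh.2.2.2.2⟩
      · omega
    · rcases h.pairs e hx hlt with hh | hh | hh
      · exact absurd hh.2.1 hesw
      · omega
      · exact Or.inr ⟨by omega, hh.2.1, hh.2.2.2.1, hh.2.2.2.2⟩
  have cy : (e + 1 < q ∧ q % 2 = 0 ∧ q ∉ sw ∧ ∀ f, e + 1 < f → f < q → f % 2 = 0 → f ∈ sw) ∨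
      (q < e ∧ q % 2 = 0 ∧ q ∉ sw ∧
        ∀ f < n, f % 2 = 0 → (f < q ∨ e + 1 < f) → f ∈ sw) := by
    rcases lt_or_gt_of_ne h4 with hlt | hlt
    · have := h.pairs q h2 (by omega)
      rw [h8] at this
      rcases this with hh | hh | hh
      · omega
      · omega
      · exact Or.inr ⟨by omega, hh.1, hh.2.2.1, hh.2.2.2.2⟩
    · rcases h.pairs (e + 1) hen hlt with hh | hh | hh
      · omega
      · exact Or.inl ⟨hlt, hh.2.1, hh.2.2.2.1, hh.2.2.2.2⟩
      · omega
  have m1 : mergePairs M e (e + 1) e = e + 1 := by simp [mergePairs]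
  have m2 : mergePairs M e (e + 1) (e + 1) = e := by simp [mergePairs]
  have m3 : mergePairs M e (e + 1) p = q := by
    simp [mergePairs, ← hp, h3, hne, ← hq]
  have m4 : mergePairs M e (e + 1) q = p := by
    simp [mergePairs, ← hp, h4, h5, ← hq, h6.symm]
  have m5 : ∀ i, i ≠ e → i ≠ e + 1 → i ≠ p → i ≠ q → mergePairs M e (e + 1) i = M i := by
    intro i a b c d
    simp [mergePairs, ← hp, ← hq, a, b, c, d]
  have ins : ∀ f, f ∉ insert e sw ↔ f ≠ e ∧ f ∉ sw := fun f => by simp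
  refine ⟨h.toIsPairing.mergePairs hx hen (by omega) hne, fun i hi hlt => ?_, ?_, ?_⟩
  · by_cases a : i = e
    · subst a
      rw [m1]
      exact Or.inl ⟨he2, Finset.mem_insert_self _ _, rfl⟩
    by_cases b : i = e + 1
    · rw [b, m2] at hlt; omega
    by_cases c : i = p
    · rw [c, m3] at hlt ⊢
      rcases cx with ⟨x1, x2, x3, x4⟩ | ⟨x1, x2, x3, x4⟩
      · rcases cy with ⟨y1, y2, y3, y4⟩ | ⟨y1, y2, y3, y4⟩
        · refine Or.inr (Or.inl ⟨x2, y2, (ins _).2 ⟨by omega, x3⟩, (ins _).2 ⟨by omega, y3⟩, ?_⟩)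
          intro f f1 f2 f3
          by_cases hfe : f = e
          · exact hfe ▸ Finset.mem_insert_self _ _
          · refine Finset.mem_insert_of_mem ?_
            by_cases hfe' : f < e
            · exact x4 f f1 hfe' f3
            · exact y4 f (by omega) f2 f3
        · exact absurd (x4 q hlt y1 y2) y3
      · rcases cy with ⟨y1, y2, y3, y4⟩ | ⟨y1, y2, y3, y4⟩
        · exact absurd (y4 (p - 1) (by omega) (by omega) (by omega)) x3
        · omega
    by_cases d : i = q
    · rw [d, m4] at hlt ⊢
      rcases cx with ⟨x1, x2, x3, x4⟩ | ⟨x1, x2, x3, x4⟩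
      · rcases cy with ⟨y1, y2, y3, y4⟩ | ⟨y1, y2, y3, y4⟩
        · omega
        · refine Or.inr (Or.inr ⟨y2, x2, (ins _).2 ⟨by omega, y3⟩, (ins _).2 ⟨by omega, x3⟩, ?_⟩)
          intro f f1 f2 f3
          by_cases hfe : f = e
          · exact hfe ▸ Finset.mem_insert_self _ _
          · refine Finset.mem_insert_of_mem ?_
            by_cases hfe' : p < f ∧ f < e
            · exact x4 f hfe'.1 hfe'.2 f2
            · exact y4 f f1 f2 (by omega)
      · rcases cy with ⟨y1, y2, y3, y4⟩ | ⟨y1, y2, y3, y4⟩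
        · refine Or.inr (Or.inr ⟨y2, x2, (ins _).2 ⟨by omega, y3⟩, (ins _).2 ⟨by omega, x3⟩, ?_⟩)
          intro f f1 f2 f3
          by_cases hfe : f = e
          · exact hfe ▸ Finset.mem_insert_self _ _
          · refine Finset.mem_insert_of_mem ?_
            by_cases hfe' : e + 1 < f ∧ f < q
            · exact y4 f hfe'.1 hfe'.2 f2
            · exact x4 f f1 f2 (by omega)
        · exact absurd (x4 q h2 y2 (Or.inl y1)) y3
    rw [m5 i a b c d] at hlt ⊢
    obtain ⟨k1, k2, -, -⟩ := key i hi a b c d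
    rcases h.pairs i hi hlt with hh | hh | hh
    · exact Or.inl ⟨hh.1, Finset.mem_insert_of_mem hh.2.1, hh.2.2⟩
    · exact Or.inr (Or.inl ⟨hh.1, hh.2.1, (ins _).2 ⟨by omega, hh.2.2.1⟩,
        (ins _).2 ⟨k1, hh.2.2.2.1⟩,
        fun f f1 f2 f3 => Finset.mem_insert_of_mem (hh.2.2.2.2 f f1 f2 f3)⟩)
    · exact Or.inr (Or.inr ⟨hh.1, hh.2.1, (ins _).2 ⟨a, hh.2.2.1⟩,
        (ins _).2 ⟨by omega, hh.2.2.2.1⟩,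
        fun f f1 f2 f3 => Finset.mem_insert_of_mem (hh.2.2.2.2 f f1 f2 f3)⟩)
  · rcases cx with ⟨x1, x2, x3, x4⟩ | ⟨x1, x2, x3, x4⟩
    · rcases cy with ⟨y1, y2, y3, y4⟩ | ⟨y1, y2, y3, y4⟩
      · obtain ⟨i, hi, hlt, hi2, hisw⟩ := h.outer
        have b1 : i ≠ e := by rintro rfl; omega
        have b2 : i ≠ q := by rintro rfl; omega
        exact ⟨i, hi, by rw [m5 i b1 (by omega) (by omega) b2]; exact hlt, hi2,
          (ins _).2 ⟨b1, hisw⟩⟩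
      · refine ⟨q, h2, ?_, y2, (ins _).2 ⟨by omega, y3⟩⟩
        rw [m4]
        by_contra hcon
        exact y3 (x4 q (by omega) y1 y2)
    · rcases cy with ⟨y1, y2, y3, y4⟩ | ⟨y1, y2, y3, y4⟩
      · refine ⟨q, h2, ?_, y2, (ins _).2 ⟨by omega, y3⟩⟩
        rw [m4]
        by_contra hcon
        exact x3 (y4 (p - 1) (by omega) (by omega) (by omega))
      · exact absurd (x4 q h2 y2 (Or.inl y1)) y3
  · intro f hf
    rcases Finset.mem_insert.1 hf with rfl | hf
    · exact Finset.mem_range.2 hx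
    · exact h.subset hf

/-- The pairing `{1, 2}, {3, 4}, …, {n - 1, 0}`. -/
def cyclicPairing (n i : ℕ) : ℕ :=
  if i % 2 = 1 then (if i + 1 = n then 0 else i + 1) else (if i = 0 then n - 1 else i - 1)

theorem isNested_cyclicPairing {n : ℕ} (hn : n % 2 = 0) (h2 : 2 ≤ n) :
    IsNested n ∅ (cyclicPairing n) := by
  refine ⟨⟨fun i hi => ?_, fun i hi => ?_, fun i hi => ?_⟩, fun i hi hlt => ?_, ?_, by simp⟩
  · unfold cyclicPairing; split_ifs <;> omega
  · have e1 : ∀ a, a % 2 = 1 → a + 1 = n → cyclicPairing n a = 0 := fun a h h' => by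
      simp [cyclicPairing, h, h']
    have e2 : ∀ a, a % 2 = 1 → a + 1 ≠ n → cyclicPairing n a = a + 1 := fun a h h' => by
      simp [cyclicPairing, h, h']
    have e3 : cyclicPairing n 0 = n - 1 := by simp [cyclicPairing]
    have e4 : ∀ a, a % 2 = 0 → a ≠ 0 → cyclicPairing n a = a - 1 := fun a h h' => by
      simp [cyclicPairing, h, h']
    rcases Nat.mod_two_eq_zero_or_one i with h | h
    · by_cases h0 : i = 0
      · rw [h0, e3, e1 _ (by omega) (by omega)]
      · rw [e4 i h h0, e2 _ (by omega) (by omega)]; omega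
    · by_cases h0 : i + 1 = n
      · rw [e1 i h h0, e3]; omega
      · rw [e2 i h h0, e4 _ (by omega) (by omega)]; omega
  · unfold cyclicPairing; split_ifs <;> omega
  · simp only [Finset.notMem_empty, not_false_eq_true, true_and, false_and, and_false, false_or,
      imp_false]
    unfold cyclicPairing at hlt ⊢
    split_ifs at hlt ⊢
    · omega
    · exact Or.inl ⟨by omega, by omega, fun e => by omega⟩
    · exact Or.inr ⟨by omega, by omega, fun e => by omega⟩
    · omega
  · refine ⟨0, by omega, ?_, rfl, by simp⟩
    simp [cyclicPairing]; omega

theorem exists_isNested {n : ℕ} (hn : n % 2 = 0) (h2 : 2 ≤ n) {E : ℕ → ℕ} (hE : IsPairing n E)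
    (w : ℕ) : ∃ sw M, IsNested n sw M ∧ w ∉ sw ∧ ∀ A ⊆ Finset.range n, A.Nonempty →
      (∀ i ∈ A, M i ∈ A) → (∀ i ∈ A, E i ∈ A) → A = Finset.range n := by
  -- merge as long as this joins different components
  have greedy : ∀ m sw M, IsNested n sw M → w ∉ sw →
      (∀ A ⊆ Finset.range n, (∀ i ∈ A, M i ∈ A) → (∀ i ∈ A, E i ∈ A) →
        ∀ i ∈ A, cyclicPairing n i ∈ A) → n - sw.card = m →
      ∃ sw M, IsNested n sw M ∧ w ∉ sw ∧
      (∀ A ⊆ Finset.range n, (∀ i ∈ A, M i ∈ A) → (∀ i ∈ A, E i ∈ A) →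
        ∀ i ∈ A, cyclicPairing n i ∈ A) ∧
      ∀ e, e % 2 = 0 → e + 1 < n → e ∉ sw → e ≠ w → ∀ C ⊆ Finset.range n,
        (∀ i ∈ C, M i ∈ C) → (∀ i ∈ C, E i ∈ C) → e ∈ C → e + 1 ∈ C := by
    intro m
    induction m using Nat.strong_induction_on with
    | _ m ih =>
      intro sw M h hw hinv hm
      by_cases hmax : ∀ e, e % 2 = 0 → e + 1 < n → e ∉ sw → e ≠ w → ∀ C ⊆ Finset.range n,
        (∀ i ∈ C, M i ∈ C) → (∀ i ∈ C, E i ∈ C) → e ∈ C → e + 1 ∈ C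
      · exact ⟨sw, M, h, hw, hinv, hmax⟩
      · push Not at hmax
        obtain ⟨e, he2, hen, hesw, hew, C, hC, hCM, hCE, heC, heC'⟩ := hmax
        have hne : M e ≠ e + 1 := fun h' => heC' (h' ▸ hCM e heC)
        have h' := h.merge he2 hen hesw hne
        have hcard := Finset.card_le_card h'.subset
        rw [Finset.card_range, Finset.card_insert_of_notMem hesw] at hcard
        refine ih _ ?_ _ _ h' (by simp [hew.symm, hw]) (fun A hA hAM hAE => ?_) rfl
        · rw [Finset.card_insert_of_notMem hesw]; omega
        · exact hinv A hA (h.closed_of_mergePairs hE (by omega) hen hCM hCE heC heC' hA hAM hAE)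
            hAE
  obtain ⟨sw, M, h, hw, hinv, hmax⟩ := greedy _ ∅ (cyclicPairing n) (isNested_cyclicPairing hn h2)
    (by simp) (fun A _ hA _ => hA) rfl
  refine ⟨sw, M, h, hw, fun A hA hne hAM hAE => ?_⟩
  have hcyc := hinv A hA hAM hAE
  have compl : ∀ f, IsPairing n f → (∀ i ∈ A, f i ∈ A) →
      ∀ i ∈ Finset.range n \ A, f i ∈ Finset.range n \ A := by
    intro f hf hfA i hi
    rw [Finset.mem_sdiff, Finset.mem_range] at hi ⊢
    exact ⟨hf.lt i hi.1, fun h => hi.2 (hf.inv i hi.1 ▸ hfA _ h)⟩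
  have sym : ∀ f, IsPairing n f → (∀ i ∈ A, f i ∈ A) → ∀ i < n, (f i ∈ A ↔ i ∈ A) :=
    fun f hf hfA i hi => ⟨fun h => hf.inv i hi ▸ hfA _ h, hfA i⟩
  have step : ∀ j, j + 1 < n → j ≠ w → (j ∈ A ↔ j + 1 ∈ A) := by
    intro j hj hjw
    rcases Nat.mod_two_eq_zero_or_one j with hj2 | hj2
    · by_cases hsw : j ∈ sw
      · have hMj : M j = j + 1 := by
          rcases lt_or_gt_of_ne (h.ne j (by omega)) with hlt | hlt
          · have := h.pairs (M j) (h.lt j (by omega)) (by rw [h.inv j (by omega)]; exact hlt)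
            rw [h.inv j (by omega)] at this
            rcases this with hh | hh | hh
            · omega
            · exact absurd hsw hh.2.2.2.1
            · omega
          · rcases h.pairs j (by omega) hlt with hh | hh | hh
            · exact hh.2.2
            · omega
            · exact absurd hsw hh.2.2.1
        rw [← hMj]
        exact (sym M h.toIsPairing hAM j (by omega)).symm
      · refine ⟨hmax j hj2 hj hsw hjw A hA hAM hAE, fun h1 => ?_⟩
        by_contra h2
        have := hmax j hj2 hj hsw hjw _ Finset.sdiff_subset (compl M h.toIsPairing hAM)
          (compl E hE hAE) (Finset.mem_sdiff.2 ⟨Finset.mem_range.2 (by omega), h2⟩)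
        exact (Finset.mem_sdiff.1 this).2 h1
    · have := sym _ (isNested_cyclicPairing hn h2).toIsPairing hcyc j (by omega)
      rw [cyclicPairing, if_pos hj2, if_neg (by omega)] at this
      exact this.symm
  have last : n - 1 ∈ A ↔ 0 ∈ A := by
    have := sym _ (isNested_cyclicPairing hn h2).toIsPairing hcyc 0 (by omega)
    rwa [cyclicPairing, if_neg (by omega), if_pos rfl] at this
  have low : ∀ j, j < n → j ≤ w → (j ∈ A ↔ 0 ∈ A) := by
    intro j
    induction j with
    | zero => simp
    | succ j ih =>
      intro h1 h2
      rw [← step j h1 (by omega)]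
      exact ih (by omega) (by omega)
  have high : ∀ d, ∀ j, j + d = n - 1 → w < j → (j ∈ A ↔ n - 1 ∈ A) := by
    intro d
    induction d with
    | zero => intro j hj _; rw [show j = n - 1 by omega]
    | succ d ih =>
      intro j hj hwj
      rw [step j (by omega) (by omega)]
      exact ih (j + 1) (by omega) (by omega)
  have all : ∀ j < n, (j ∈ A ↔ 0 ∈ A) := by
    intro j hj
    by_cases hjw : j ≤ w
    · exact low j hj hjw
    · exact (high (n - 1 - j) j (by omega) (by omega)).trans last
  obtain ⟨a, ha⟩ := hne
  have h0 := (all a (Finset.mem_range.1 (hA ha))).1 ha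
  exact hA.antisymm fun j hj => (all j (Finset.mem_range.1 hj)).2 h0

/-- A pairing of `n` points on a circle, cut between `n - 1` and `0`, that joins them into a single
cycle with a given pairing. The pair `{β, α}` is the only one that separates the other pairs from
the cut; a pair of points at distance more than one is called long. -/
theorem exists_pairing {n : ℕ} (hn : n % 2 = 0) (h2 : 2 ≤ n) {E : ℕ → ℕ} (hE : IsPairing n E)
    (c : ℕ) : ∃ M β α, IsPairing n M ∧ (∀ A ⊆ Finset.range n, A.Nonempty →
      (∀ i ∈ A, M i ∈ A) → (∀ i ∈ A, E i ∈ A) → A = Finset.range n) ∧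
      M β = α ∧ β < α ∧ α < n ∧ β % 2 = 0 ∧ α % 2 = 1 ∧
      (∀ i < n, i < M i → i ≠ β → M i = i + 1 ∨
        (i + 1 < M i ∧ i % 2 = 1 ∧ M i % 2 = 0 ∧ β < i ∧ M i < α)) ∧
      (∀ i j, i < n → j < n → i + 1 < M i → j + 1 < M j → i ≠ β → j ≠ β → i < j → M i < j) ∧
      (∀ i < n, i + 1 < M i → i ≠ β → i ≠ c + 1) ∧ (α = c + 1 → α + 1 = n) := by
  obtain ⟨sw, M, h, hw, hA⟩ := exists_isNested hn h2 hE (c + 2)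
  obtain ⟨β, hβ, hlt, hβ2, hβsw⟩ := h.outer
  have hMβ := h.lt β hβ
  obtain ⟨hα2, hαsw, hout⟩ : M β % 2 = 1 ∧ M β - 1 ∉ sw ∧
      ∀ e < n, e % 2 = 0 → (e < β ∨ M β < e) → e ∈ sw := by
    rcases h.pairs β hβ hlt with hh | hh | hh
    · exact absurd hh.2.1 hβsw
    · omega
    · exact ⟨hh.2.1, hh.2.2.2.1, hh.2.2.2.2⟩
  have long : ∀ i < n, i + 1 < M i → i ≠ β → i % 2 = 1 ∧ M i % 2 = 0 ∧ i - 1 ∉ sw ∧ M i ∉ sw ∧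
      ∀ e, i < e → e < M i → e % 2 = 0 → e ∈ sw := by
    intro i hi hl hiβ
    rcases h.pairs i hi (by omega) with hh | hh | hh
    · omega
    · exact hh
    · exfalso
      rcases lt_or_gt_of_ne hiβ with h1 | h1
      · exact hh.2.2.1 (hout i hi hh.1 (Or.inl h1))
      · exact hβsw (hh.2.2.2.2 β hβ hβ2 (Or.inl h1))
  refine ⟨M, β, M β, h.toIsPairing, hA, rfl, hlt, hMβ, hβ2, hα2, fun i hi hi' hiβ => ?_,
    fun i j hi hj hli hlj hiβ hjβ hij => ?_, fun i hi hli hiβ hic => ?_, fun hc => ?_⟩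
  · by_cases hs : M i = i + 1
    · exact Or.inl hs
    · obtain ⟨l1, l2, l3, l4, -⟩ := long i hi (by omega) hiβ
      have hMi := h.lt i hi
      refine Or.inr ⟨by omega, l1, l2, ?_, ?_⟩
      · by_contra hcon
        exact l3 (hout _ (by omega) (by omega) (Or.inl (by omega)))
      · by_contra hcon
        exact l4 (hout _ hMi l2 (Or.inr (by omega)))
  · obtain ⟨l1, l2, l3, l4, l5⟩ := long i hi hli hiβ
    obtain ⟨k1, k2, k3, k4, k5⟩ := long j hj hlj hjβ
    by_contra hcon
    exact k3 (l5 (j - 1) (by omega) (by omega) (by omega))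
  · obtain ⟨l1, l2, l3, l4, l5⟩ := long i hi hli hiβ
    subst hic
    exact hw (l5 (c + 2) (by omega) (by omega) (by omega))
  · by_contra hcon
    exact hw (hout (c + 2) (by omega) (by omega) (Or.inr (by omega)))

/-! ### Coordinates along the first two layers -/

/-- `(x, y)` has rank `t` on the first layer, cut open between `(2, 3)` and `(1, 4)`. -/
def OnFirst (r x y t : ℕ) : Prop :=
  (1 ≤ x ∧ x ≤ 2 ∧ 4 ≤ y ∧ y + 1 ≤ r ∧ t = 2 * y + (x + y + 1) % 2) ∨
  (y = r ∧ 2 ≤ x ∧ x ≤ 2 * r ∧ t + 2 = 2 * r + x) ∨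
  (2 * r ≤ x + 1 ∧ x ≤ 2 * r ∧ 2 ≤ y ∧ y + 1 ≤ r ∧ t + 2 * y + 3 = 6 * r + (x + y) % 2) ∨
  (y = 1 ∧ 1 ≤ x ∧ x + 1 ≤ 2 * r ∧ t + x + 6 = 8 * r) ∨
  (1 ≤ x ∧ x ≤ 2 ∧ (y = 2 ∨ (y = 3 ∧ x = 2)) ∧ t + 10 = 8 * r + 2 * y + (x + y + 1) % 2)

/-- `(x, y)` has rank `t` on the second layer, cut open between `(3, 3)` and `(3, 4)`. -/
def OnSecond (r x y t : ℕ) : Prop :=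
  (3 ≤ x ∧ x ≤ 4 ∧ 4 ≤ y ∧ y + 2 ≤ r ∧ t = 2 * y + (x + y + 1) % 2) ∨
  (y + 1 = r ∧ 3 ≤ x ∧ x + 3 ≤ 2 * r ∧ t + 5 = 2 * r + x) ∨
  (2 * r ≤ x + 3 ∧ x + 2 ≤ 2 * r ∧ 3 ≤ y ∧ y + 2 ≤ r ∧ t + 2 * y + 11 = 6 * r + (x + y) % 2) ∨
  (y = 2 ∧ 4 ≤ x ∧ x + 2 ≤ 2 * r ∧ t + x + 17 = 8 * r) ∨
  (y = 3 ∧ 3 ≤ x ∧ x ≤ 4 ∧ t + 20 = 8 * r + (x + y + 1) % 2)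

section

variable {r x y t x' y' t' : ℕ}

theorem OnFirst.mem_layerVerts (hr : Odd r) (h5 : 5 ≤ r) (h : OnFirst r x y t) :
    (x, y) ∈ layerVerts r 1 := by
  have hr2 := Nat.odd_iff.1 hr
  rw [layerVerts_one hr (by omega), wallVerts_one hr (by omega)]
  rcases h with h | h | h | h | h <;> omega

theorem OnSecond.mem_layerVerts (hr : Odd r) (h5 : 5 ≤ r) (h : OnSecond r x y t) :
    (x, y) ∈ layerVerts r 2 := by
  have hr2 := Nat.odd_iff.1 hr
  rw [_root_.mem_layerVerts hr (by omega) (by omega), mem_window, IsPruned]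
  rcases h with h | h | h | h | h <;> omega

theorem OnFirst.eq (hr : Odd r) (h5 : 5 ≤ r) (h : OnFirst r x y t) (h' : OnFirst r x' y' t) :
    x = x' ∧ y = y' := by
  have hr2 := Nat.odd_iff.1 hr
  rcases h with h | h | h | h | h <;> rcases h' with h' | h' | h' | h' | h' <;> omega

theorem OnSecond.eq (hr : Odd r) (h5 : 5 ≤ r) (h : OnSecond r x y t) (h' : OnSecond r x' y' t) :
    x = x' ∧ y = y' := by
  have hr2 := Nat.odd_iff.1 hr
  rcases h with h | h | h | h | h <;> rcases h' with h' | h' | h' | h' | h' <;> omega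

theorem OnFirst.rank_eq (hr : Odd r) (h5 : 5 ≤ r) (h : OnFirst r x y t) (h' : OnFirst r x y t') :
    t = t' := by
  have hr2 := Nat.odd_iff.1 hr
  rcases h with h | h | h | h | h <;> rcases h' with h' | h' | h' | h' | h' <;> omega

theorem OnSecond.rank_eq (hr : Odd r) (h5 : 5 ≤ r) (h : OnSecond r x y t)
    (h' : OnSecond r x y t') : t = t' := by
  have hr2 := Nat.odd_iff.1 hr
  rcases h with h | h | h | h | h <;> rcases h' with h' | h' | h' | h' | h' <;> omega

theorem OnFirst.exists_pred (hr : Odd r) (h5 : 5 ≤ r) (h : OnFirst r x y (t + 1)) (ht : 8 ≤ t) :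
    ∃ x' y', OnFirst r x' y' t ∧ (elementaryWall r).Adj (x', y') (x, y) := by
  have hr2 := Nat.odd_iff.1 hr
  have adj : ∀ x' y', OnFirst r x' y' t → brickGraph.Adj (x', y') (x, y) →
      ∃ x' y', OnFirst r x' y' t ∧ (elementaryWall r).Adj (x', y') (x, y) := fun x' y' h1 h2 =>
    ⟨x', y', h1, (h1.mem_layerVerts hr h5).1, (h.mem_layerVerts hr h5).1, h2⟩
  simp only [brickGraph_adj] at adj
  rcases h with h | h | h | h | h
  · by_cases he : (x + y + 1) % 2 = 1
    · by_cases h1 : x = 1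
      · exact adj 2 y (Or.inl (by omega)) (by omega)
      · exact adj 1 y (Or.inl (by omega)) (by omega)
    · exact adj x (y - 1) (Or.inl (by omega)) (by omega)
  · by_cases h1 : x = 2
    · exact adj 2 (y - 1) (Or.inl (by omega)) (by omega)
    · exact adj (x - 1) y (Or.inr (Or.inl (by omega))) (by omega)
  · by_cases he : (x + y) % 2 = 1
    · by_cases h1 : x = 2 * r
      · exact adj (x - 1) y (Or.inr (Or.inr (Or.inl (by omega)))) (by omega)
      · exact adj (x + 1) y (Or.inr (Or.inr (Or.inl (by omega)))) (by omega)
    · by_cases hy : y + 1 = r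
      · exact adj x (y + 1) (Or.inr (Or.inl (by omega))) (by omega)
      · exact adj x (y + 1) (Or.inr (Or.inr (Or.inl (by omega)))) (by omega)
  · by_cases h1 : x + 1 = 2 * r
    · exact adj x 2 (Or.inr (Or.inr (Or.inl (by omega)))) (by omega)
    · exact adj (x + 1) y (Or.inr (Or.inr (Or.inr (Or.inl (by omega))))) (by omega)
  · by_cases h1 : x = 1
    · exact adj 1 1 (Or.inr (Or.inr (Or.inr (Or.inl (by omega))))) (by omega)
    · by_cases hy : y = 2
      · exact adj 1 2 (Or.inr (Or.inr (Or.inr (Or.inr (by omega))))) (by omega)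
      · exact adj 2 2 (Or.inr (Or.inr (Or.inr (Or.inr (by omega))))) (by omega)

theorem OnSecond.exists_pred (hr : Odd r) (h5 : 5 ≤ r) (h : OnSecond r x y (t + 1)) (ht : 8 ≤ t) :
    ∃ x' y', OnSecond r x' y' t ∧ (elementaryWall r).Adj (x', y') (x, y) := by
  have hr2 := Nat.odd_iff.1 hr
  have sub := layerVerts_subset_one hr (i := 2) (by omega) (by omega)
  have adj : ∀ x' y', OnSecond r x' y' t → brickGraph.Adj (x', y') (x, y) →
      ∃ x' y', OnSecond r x' y' t ∧ (elementaryWall r).Adj (x', y') (x, y) := fun x' y' h1 h2 =>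
    ⟨x', y', h1, sub (h1.mem_layerVerts hr h5), sub (h.mem_layerVerts hr h5), h2⟩
  simp only [brickGraph_adj] at adj
  rcases h with h | h | h | h | h
  · by_cases he : (x + y + 1) % 2 = 1
    · by_cases h1 : x = 3
      · exact adj 4 y (Or.inl (by omega)) (by omega)
      · exact adj 3 y (Or.inl (by omega)) (by omega)
    · exact adj x (y - 1) (Or.inl (by omega)) (by omega)
  · by_cases h1 : x = 3
    · exact adj 3 (y - 1) (Or.inl (by omega)) (by omega)
    · exact adj (x - 1) y (Or.inr (Or.inl (by omega))) (by omega)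
  · by_cases he : (x + y) % 2 = 1
    · by_cases h1 : x + 2 = 2 * r
      · exact adj (x - 1) y (Or.inr (Or.inr (Or.inl (by omega)))) (by omega)
      · exact adj (x + 1) y (Or.inr (Or.inr (Or.inl (by omega)))) (by omega)
    · by_cases hy : y + 2 = r
      · exact adj x (y + 1) (Or.inr (Or.inl (by omega))) (by omega)
      · exact adj x (y + 1) (Or.inr (Or.inr (Or.inl (by omega)))) (by omega)
  · by_cases h1 : x + 2 = 2 * r
    · exact adj x 3 (Or.inr (Or.inr (Or.inl (by omega)))) (by omega)
    · exact adj (x + 1) y (Or.inr (Or.inr (Or.inr (Or.inl (by omega))))) (by omega)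
  · by_cases h1 : x = 4
    · exact adj 4 2 (Or.inr (Or.inr (Or.inr (Or.inl (by omega))))) (by omega)
    · exact adj 4 3 (Or.inr (Or.inr (Or.inr (Or.inr (by omega))))) (by omega)

end

/-- The vertices of rank between `a` and `b` on the first layer. -/
def firstSeg (r a b : ℕ) : Set (ℕ × ℕ) := {p | ∃ t, OnFirst r p.1 p.2 t ∧ a ≤ t ∧ t ≤ b}

/-- The vertices of rank between `a` and `b` on the second layer. -/
def secondSeg (r a b : ℕ) : Set (ℕ × ℕ) := {p | ∃ t, OnSecond r p.1 p.2 t ∧ a ≤ t ∧ t ≤ b}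

theorem firstSeg_subset {r a b : ℕ} (hr : Odd r) (h5 : 5 ≤ r) :
    firstSeg r a b ⊆ layerVerts r 1 := fun _ ⟨_, h, _⟩ => h.mem_layerVerts hr h5

theorem secondSeg_subset {r a b : ℕ} (hr : Odd r) (h5 : 5 ≤ r) :
    secondSeg r a b ⊆ layerVerts r 2 := fun _ ⟨_, h, _⟩ => h.mem_layerVerts hr h5

theorem disjoint_firstSeg {r a b a' b' : ℕ} (hr : Odd r) (h5 : 5 ≤ r) (h : b < a') :
    Disjoint (firstSeg r a b) (firstSeg r a' b') := by
  rw [Set.disjoint_left]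
  rintro p ⟨t, ht, -, h1⟩ ⟨t', ht', h2, -⟩
  have := ht.rank_eq hr h5 ht'
  omega

theorem disjoint_secondSeg {r a b a' b' : ℕ} (hr : Odd r) (h5 : 5 ≤ r) (h : b < a') :
    Disjoint (secondSeg r a b) (secondSeg r a' b') := by
  rw [Set.disjoint_left]
  rintro p ⟨t, ht, -, h1⟩ ⟨t', ht', h2, -⟩
  have := ht.rank_eq hr h5 ht'
  omega

theorem linked_firstSeg {r a b x y x' y' : ℕ} (hr : Odd r) (h5 : 5 ≤ r) (ha : 8 ≤ a) (hab : a ≤ b)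
    (h : OnFirst r x y a) (h' : OnFirst r x' y' b) :
    Linked r (firstSeg r a b) (x, y) (x', y') := by
  have key : ∀ b', a ≤ b' → b' ≤ b → ∀ x' y', OnFirst r x' y' b' →
      Linked r (firstSeg r a b) (x, y) (x', y') := by
    intro b' hab'
    induction b', hab' using Nat.le_induction with
    | base =>
      intro _ x' y' h'
      obtain ⟨rfl, rfl⟩ := h.eq hr h5 h'
      exact Linked.refl
    | succ b' hab' ih =>
      intro hb x' y' h'
      obtain ⟨x'', y'', h1, h2⟩ := h'.exists_pred hr h5 (by omega)
      exact (ih (by omega) x'' y'' h1).trans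
        (Linked.of_adj h2 ⟨b', h1, hab', by omega⟩ ⟨b' + 1, h', by omega, hb⟩)
  exact key b hab le_rfl x' y' h'

theorem linked_secondSeg {r a b x y x' y' : ℕ} (hr : Odd r) (h5 : 5 ≤ r) (ha : 8 ≤ a)
    (hab : a ≤ b) (h : OnSecond r x y a) (h' : OnSecond r x' y' b) :
    Linked r (secondSeg r a b) (x, y) (x', y') := by
  have key : ∀ b', a ≤ b' → b' ≤ b → ∀ x' y', OnSecond r x' y' b' →
      Linked r (secondSeg r a b) (x, y) (x', y') := by
    intro b' hab'
    induction b', hab' using Nat.le_induction with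
    | base =>
      intro _ x' y' h'
      obtain ⟨rfl, rfl⟩ := h.eq hr h5 h'
      exact Linked.refl
    | succ b' hab' ih =>
      intro hb x' y' h'
      obtain ⟨x'', y'', h1, h2⟩ := h'.exists_pred hr h5 (by omega)
      exact (ih (by omega) x'' y'' h1).trans
        (Linked.of_adj h2 ⟨b', h1, hab', by omega⟩ ⟨b' + 1, h', by omega, hb⟩)
  exact key b hab le_rfl x' y' h'

/-! ### From the pegs to the second layer -/

/-- The in-peg `(x, y)`, other than `(2, 3)`, has rank `t` and its stub leads to the vertex of
rank `t'` on the second layer. -/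
def PegRank (r x y t t' : ℕ) : Prop :=
  (x = 2 ∧ 4 ≤ y ∧ y + 1 ≤ r ∧ t = 2 * y + (y + 1) % 2 ∧ t' = 2 * y + y % 2) ∨
  (y = r ∧ x % 2 = 0 ∧ 4 ≤ x ∧ x + 4 ≤ 2 * r ∧ t + 2 = 2 * r + x ∧ t' + 5 = 2 * r + x) ∨
  (y = r ∧ x + 2 = 2 * r ∧ t + 4 = 4 * r ∧ t' + 8 = 4 * r) ∨
  (y + 1 = r ∧ x + 1 = 2 * r ∧ t = 4 * r ∧ t' + 8 = 4 * r) ∨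
  (x + 1 = 2 * r ∧ 2 ≤ y ∧ y + 2 ≤ r ∧ t + 2 * y + 3 = 6 * r + (y + 1) % 2 ∧
    t' + 2 * y + 11 = 6 * r + y % 2) ∨
  (y = 1 ∧ x % 2 = 1 ∧ 5 ≤ x ∧ x + 3 ≤ 2 * r ∧ t + x + 6 = 8 * r ∧ t' + x + 17 = 8 * r) ∨
  (x = 3 ∧ y = 1 ∧ t + 9 = 8 * r ∧ t' + 21 = 8 * r) ∨
  (x = 2 ∧ y = 2 ∧ t + 5 = 8 * r ∧ t' + 21 = 8 * r)

/-- The in-peg `(x, y)` together with the inner vertex of degree two that follows it at two of the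
corners. -/
def stub (r : ℕ) (p : ℕ × ℕ) : Set (ℕ × ℕ) :=
  {q | (q.1 = p.1 ∧ q.2 = p.2) ∨
    (((p.1 = 2 ∧ p.2 = 2) ∨ (p.1 = 3 ∧ p.2 = 1)) ∧ q.1 = 3 ∧ q.2 = 2) ∨
    (((p.2 = r ∧ p.1 + 2 = 2 * r) ∨ (p.2 + 1 = r ∧ p.1 + 1 = 2 * r)) ∧
      q.1 + 2 = 2 * r ∧ q.2 + 1 = r)}

theorem mem_stub {r x y x' y' : ℕ} : (x', y') ∈ stub r (x, y) ↔ (x' = x ∧ y' = y) ∨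
    (((x = 2 ∧ y = 2) ∨ (x = 3 ∧ y = 1)) ∧ x' = 3 ∧ y' = 2) ∨
    (((y = r ∧ x + 2 = 2 * r) ∨ (y + 1 = r ∧ x + 1 = 2 * r)) ∧ x' + 2 = 2 * r ∧ y' + 1 = r) :=
  Iff.rfl

section

variable {r x y t t' x₁ y₁ t₁ t₁' : ℕ}

theorem IsPeg.exists_pegRank (h5 : 5 ≤ r) (h : IsPeg r (x, y)) :
    (x = 2 ∧ y = 3) ∨ ∃ t t', PegRank r x y t t' := by
  rw [IsPeg] at h
  simp only at h
  rcases h with h | h | h | h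
  · by_cases h3 : y = 3
    · exact Or.inl ⟨h.1, h3⟩
    by_cases h2 : y = 2
    · exact Or.inr ⟨8 * r - 5, 8 * r - 21, by rw [PegRank]; omega⟩
    · exact Or.inr ⟨_, _, Or.inl ⟨h.1, by omega, by omega, rfl, rfl⟩⟩
  · right
    by_cases h2 : x + 2 = 2 * r
    · exact ⟨4 * r - 4, 4 * r - 8, Or.inr (Or.inr (Or.inl (by omega)))⟩
    · exact ⟨2 * r + x - 2, 2 * r + x - 5, Or.inr (Or.inl (by omega))⟩
  · right
    by_cases h2 : y + 1 = r
    · exact ⟨4 * r, 4 * r - 8, Or.inr (Or.inr (Or.inr (Or.inl (by omega))))⟩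
    · exact ⟨6 * r + (y + 1) % 2 - (2 * y + 3), 6 * r + y % 2 - (2 * y + 11),
        Or.inr (Or.inr (Or.inr (Or.inr (Or.inl (by omega)))))⟩
  · right
    by_cases h2 : x = 3
    · exact ⟨8 * r - 9, 8 * r - 21, by rw [PegRank]; omega⟩
    · exact ⟨8 * r - (x + 6), 8 * r - (x + 17),
        Or.inr (Or.inr (Or.inr (Or.inr (Or.inr (Or.inl (by omega))))))⟩

theorem PegRank.onFirst (hr : Odd r) (h5 : 5 ≤ r) (h : PegRank r x y t t') : OnFirst r x y t := by
  have hr2 := Nat.odd_iff.1 hr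
  rcases h with h | h | h | h | h | h | h | h
  · exact Or.inl (by omega)
  · exact Or.inr (Or.inl (by omega))
  · exact Or.inr (Or.inl (by omega))
  · exact Or.inr (Or.inr (Or.inl (by omega)))
  · exact Or.inr (Or.inr (Or.inl (by omega)))
  · exact Or.inr (Or.inr (Or.inr (Or.inl (by omega))))
  · exact Or.inr (Or.inr (Or.inr (Or.inl (by omega))))
  · exact Or.inr (Or.inr (Or.inr (Or.inr (by omega))))

theorem stub_subset (hr : Odd r) (h5 : 5 ≤ r) (h : IsPeg r (x, y)) :
    stub r (x, y) ⊆ outerVerts r 2 := by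
  have hr2 := Nat.odd_iff.1 hr
  rintro ⟨x', y'⟩ h'
  rw [mem_stub] at h'
  rw [mem_outerVerts hr (by omega) (by omega), IsPruned]
  rw [IsPeg] at h
  simp only at h
  rcases h' with h' | h' | h'
  · obtain ⟨rfl, rfl⟩ := h'
    constructor <;> omega
  · constructor <;> omega
  · constructor <;> omega

theorem PegRank.exists_onSecond (hr : Odd r) (h5 : 5 ≤ r) (h : PegRank r x y t t') :
    ∃ s q, s ∈ stub r (x, y) ∧ Linked r (stub r (x, y)) (x, y) s ∧
      OnSecond r q.1 q.2 t' ∧ (elementaryWall r).Adj s q := by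
  have hr2 := Nat.odd_iff.1 hr
  have direct : ∀ X Y, OnSecond r X Y t' → (elementaryWall r).Adj (x, y) (X, Y) →
      ∃ s q, s ∈ stub r (x, y) ∧ Linked r (stub r (x, y)) (x, y) s ∧
      OnSecond r q.1 q.2 t' ∧ (elementaryWall r).Adj s q := fun X Y h1 h2 =>
    ⟨(x, y), (X, Y), mem_stub.2 (Or.inl ⟨rfl, rfl⟩), Linked.refl, h1, h2⟩
  have indirect : ∀ s X Y, OnSecond r X Y t' → s ∈ stub r (x, y) →
      (elementaryWall r).Adj (x, y) s → (elementaryWall r).Adj s (X, Y) →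
      ∃ s q, s ∈ stub r (x, y) ∧ Linked r (stub r (x, y)) (x, y) s ∧
      OnSecond r q.1 q.2 t' ∧ (elementaryWall r).Adj s q := fun s X Y h1 h2 h3 h4 =>
    ⟨s, (X, Y), h2, Linked.of_adj h3 (mem_stub.2 (Or.inl ⟨rfl, rfl⟩)) h2, h1, h4⟩
  have adj : ∀ x y x' y', (x, y) ∈ wallVerts r 1 → (x', y') ∈ wallVerts r 1 →
      brickGraph.Adj (x, y) (x', y') → (elementaryWall r).Adj (x, y) (x', y') :=
    fun _ _ _ _ h1 h2 h3 => ⟨h1, h2, h3⟩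
  simp only [wallVerts_one hr (show 3 ≤ r by omega), brickGraph_adj] at adj
  rcases h with h | h | h | h | h | h | h | h
  · refine direct 3 y ?_ (adj _ _ _ _ (by omega) (by omega) (by omega))
    by_cases hy : y + 1 = r
    · exact Or.inr (Or.inl (by omega))
    · exact Or.inl (by omega)
  · exact direct x (y - 1) (Or.inr (Or.inl (by omega)))
      (adj _ _ _ _ (by omega) (by omega) (by omega))
  · exact indirect (x, y - 1) (x - 1) (y - 1) (Or.inr (Or.inl (by omega)))
      (mem_stub.2 (by omega)) (adj _ _ _ _ (by omega) (by omega) (by omega))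
      (adj _ _ _ _ (by omega) (by omega) (by omega))
  · exact indirect (x - 1, y) (x - 2) y (Or.inr (Or.inl (by omega)))
      (mem_stub.2 (by omega)) (adj _ _ _ _ (by omega) (by omega) (by omega))
      (adj _ _ _ _ (by omega) (by omega) (by omega))
  · refine direct (x - 1) y ?_ (adj _ _ _ _ (by omega) (by omega) (by omega))
    by_cases hy : y = 2
    · exact Or.inr (Or.inr (Or.inr (Or.inl (by omega))))
    · exact Or.inr (Or.inr (Or.inl (by omega)))
  · exact direct x 2 (Or.inr (Or.inr (Or.inr (Or.inl (by omega)))))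
      (adj _ _ _ _ (by omega) (by omega) (by omega))
  · exact indirect (3, 2) 4 2 (Or.inr (Or.inr (Or.inr (Or.inl (by omega)))))
      (mem_stub.2 (by omega)) (adj _ _ _ _ (by omega) (by omega) (by omega))
      (adj _ _ _ _ (by omega) (by omega) (by omega))
  · exact indirect (3, 2) 4 2 (Or.inr (Or.inr (Or.inr (Or.inl (by omega)))))
      (mem_stub.2 (by omega)) (adj _ _ _ _ (by omega) (by omega) (by omega))
      (adj _ _ _ _ (by omega) (by omega) (by omega))

theorem PegRank.bounds (h5 : 5 ≤ r) (h : PegRank r x y t t') :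
    9 ≤ t ∧ t + 5 ≤ 8 * r ∧ 8 ≤ t' ∧ t' + 21 ≤ 8 * r := by
  have p1 : (y + 1) % 2 + y % 2 = 1 := by omega
  rcases h with h | h | h | h | h | h | h | h <;> omega

theorem PegRank.ten_le (h7 : 7 ≤ r) (h : PegRank r x y t t') (ht : 9 < t) : 10 ≤ t' := by
  have p1 : (y + 1) % 2 + y % 2 = 1 := by omega
  rcases h with h | h | h | h | h | h | h | h <;> omega

theorem PegRank.gap (h5 : 5 ≤ r) (h : PegRank r x y t t') :
    ¬ (4 * r - 4 < t ∧ t < 4 * r) ∧ ¬ (8 * r - 9 < t ∧ t < 8 * r - 5) := by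
  rcases h with h | h | h | h | h | h | h | h <;> omega

theorem PegRank.le (hr : Odd r) (h5 : 5 ≤ r) (h : PegRank r x y t t') (h' : PegRank r x₁ y₁ t₁ t₁')
    (hlt : t < t₁) : t' < t₁' ∨ (t' = t₁' ∧
      ((t = 4 * r - 4 ∧ t₁ = 4 * r) ∨ (t = 8 * r - 9 ∧ t₁ = 8 * r - 5))) := by
  have hr2 := Nat.odd_iff.1 hr
  have p1 : (y + 1) % 2 + y % 2 = 1 := by omega
  have p2 : (y₁ + 1) % 2 + y₁ % 2 = 1 := by omega
  rcases h with h | h | h | h | h | h | h | h <;>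
  rcases h' with h' | h' | h' | h' | h' | h' | h' | h' <;>
  first
  | omega
  | (rcases Nat.mod_two_eq_zero_or_one y with e | e <;>
      rcases Nat.mod_two_eq_zero_or_one y₁ with e' | e' <;> omega)

theorem PegRank.disjoint_stub (h5 : 5 ≤ r) (h : PegRank r x y t t')
    (h' : PegRank r x₁ y₁ t₁ t₁') (hne : t' ≠ t₁') :
    Disjoint (stub r (x, y)) (stub r (x₁, y₁)) := by
  rw [Set.disjoint_left]
  rintro ⟨X, Y⟩ h1 h2
  rw [mem_stub] at h1 h2
  apply hne
  have : x = x₁ ∧ y = y₁ ∨ (t' + 21 = 8 * r ∧ t₁' + 21 = 8 * r) ∨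
      (t' + 8 = 4 * r ∧ t₁' + 8 = 4 * r) := by
    rcases h1 with h1 | h1 | h1
    · rcases h2 with h2 | h2 | h2
      · exact Or.inl ⟨h1.1.symm.trans h2.1, h1.2.symm.trans h2.2⟩
      · exfalso
        rcases h with h | h | h | h | h | h | h | h <;> omega
      · exfalso
        rcases h with h | h | h | h | h | h | h | h <;> omega
    · rcases h2 with h2 | h2 | h2
      · exfalso
        rcases h' with h | h | h | h | h | h | h | h <;> omega
      · right; left
        constructor
        · rcases h with h | h | h | h | h | h | h | h <;> omega
        · rcases h' with h | h | h | h | h | h | h | h <;> omega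
      · omega
    · rcases h2 with h2 | h2 | h2
      · exfalso
        rcases h' with h | h | h | h | h | h | h | h <;> omega
      · omega
      · right; right
        constructor
        · rcases h with h | h | h | h | h | h | h | h <;> omega
        · rcases h' with h | h | h | h | h | h | h | h <;> omega
  rcases this with ⟨rfl, rfl⟩ | h | h
  · rcases h with h | h | h | h | h | h | h | h <;>
    rcases h' with h' | h' | h' | h' | h' | h' | h' | h' <;> omega
  · omega
  · omega

theorem PegRank.disjoint_firstSeg (hr : Odd r) (h5 : 5 ≤ r) (h : PegRank r x y t t') {a b : ℕ}
    (hab : t < a ∨ b < t) : Disjoint (stub r (x, y)) (firstSeg r a b) := by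
  rw [Set.disjoint_left]
  rintro ⟨X, Y⟩ h1 ⟨T, hT, h2, h3⟩
  rw [mem_stub] at h1
  have : X = x ∧ Y = y := by
    have := hT.mem_layerVerts hr h5
    rw [layerVerts_one hr (by omega)] at this
    omega
  obtain ⟨rfl, rfl⟩ := this
  have := hT.rank_eq hr h5 (h.onFirst hr h5)
  omega

end

/-! ### From the second layer to a deeper one -/

theorem exists_core {r k : ℕ} (hr : Odd r) (hk : 2 ≤ k) (hkr : 2 * k + 3 ≤ r) :
    ∃ (A B : Set (ℕ × ℕ)) (a x y b : ℕ × ℕ), A ⊆ insert (4, 4) (window r 3) ∧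
      B ⊆ insert (4, 3) (window r 3) ∧ A ⊆ outerVerts r (k + 1) ∧ B ⊆ outerVerts r (k + 1) ∧
      Disjoint A B ∧ (4, 4) ∈ A ∧ a ∈ A ∧ b ∈ B ∧ (4, 3) ∈ B ∧ Linked r A (4, 4) a ∧
      Linked r B b (4, 3) ∧ (elementaryWall r).Adj a x ∧ (elementaryWall r).Adj y b ∧
      x ∈ layerVerts r (k + 1) ∧ y ∈ layerVerts r (k + 1) ∧ x ≠ y ∧
      Linked r (layerVerts r (k + 1)) x y := by
  have hr2 := Nat.odd_iff.1 hr
  have hL := layerVerts_subset_one hr (i := k + 1) (by omega) (by omega)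
  have lay : ∀ x y, 2 * k + 1 ≤ x → x ≤ 2 * k + 3 → k + 1 ≤ y → y ≤ k + 2 →
      (x ≤ 2 * k + 2 ∨ y = k + 1) → (2 * k + 2 ≤ x ∨ y = k + 2 ∨ k % 2 = 0) →
      (x, y) ∈ layerVerts r (k + 1) := by
    intro x y h1 h2 h3 h4 h5 h6
    rw [mem_layerVerts hr (by omega) (by omega), mem_window, IsPruned]
    refine ⟨?_, ?_, ?_⟩ <;> omega
  have out : ∀ x y, (1 ≤ x ∧ x ≤ 2 * r ∧ 1 ≤ y ∧ y ≤ r ∧ ¬ (x = 1 ∧ y = r) ∧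
      ¬ (x = 2 * r ∧ y = 1)) → (x < 2 * k + 1 ∨ y < k + 1) → (x, y) ∈ outerVerts r (k + 1) := by
    intro x y h1 h2
    rw [mem_outerVerts hr (by omega) (by omega)]
    exact ⟨h1, by omega⟩
  have adj : ∀ x y x' y', (x, y) ∈ wallVerts r 1 → (x', y') ∈ wallVerts r 1 →
      brickGraph.Adj (x, y) (x', y') → (elementaryWall r).Adj (x, y) (x', y') :=
    fun _ _ _ _ h1 h2 h3 => ⟨h1, h2, h3⟩
  simp only [wallVerts_one hr (show 3 ≤ r by omega), brickGraph_adj] at adj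
  obtain ⟨A, hA⟩ : ∃ A : Set (ℕ × ℕ), ∀ x y, (x, y) ∈ A ↔ (x = 4 ∧ y = 4) ∨
      (5 ≤ x ∧ x ≤ 2 * k ∧ 4 ≤ y ∧ y ≤ k + 2 ∧ (x ≤ 6 ∨ y = k + 2)) :=
    ⟨{p | (p.1 = 4 ∧ p.2 = 4) ∨
      (5 ≤ p.1 ∧ p.1 ≤ 2 * k ∧ 4 ≤ p.2 ∧ p.2 ≤ k + 2 ∧ (p.1 ≤ 6 ∨ p.2 = k + 2))},
      fun _ _ => Iff.rfl⟩
  have hA1 : A ⊆ insert (4, 4) (window r 3) := by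
    rintro ⟨x, y⟩ h
    rw [hA] at h
    rcases h with ⟨rfl, rfl⟩ | h
    · exact Or.inl rfl
    · exact Or.inr (mem_window.2 (by omega))
  have hA2 : A ⊆ outerVerts r (k + 1) := by
    rintro ⟨x, y⟩ h
    rw [hA] at h
    exact out x y (by omega) (by omega)
  have hAW : A ⊆ wallVerts r 1 := hA2.trans Set.sdiff_subset
  have linkA : Linked r A (4, 4) (2 * k, k + 2) := by
    rcases eq_or_lt_of_le hk with rfl | hk
    · exact Linked.refl
    · exact (Linked.right hAW ((hA _ _).2 (by omega)) ((hA _ _).2 (by omega))).trans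
        ((Linked.columns (x := 5) hAW (show 4 ≤ k + 2 by omega)
          fun z _ _ => ⟨(hA _ _).2 (by omega), (hA _ _).2 (by omega)⟩).trans
        (Linked.row hAW (by omega) fun z _ _ => (hA _ _).2 (by omega)))
  have hlinkL : ∀ x', 2 * k + 2 ≤ x' → x' ≤ 2 * k + 3 →
      Linked r (layerVerts r (k + 1)) (2 * k + 1, k + 2) (x', k + 1) := by
    intro x' h1 h2
    rcases Nat.mod_two_eq_zero_or_one k with h | h
    · exact (Linked.up hL (lay (2 * k + 1) (k + 1) (by omega) (by omega) (by omega) (by omega)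
          (by omega) (by omega)) (lay _ _ (by omega) (by omega) (by omega) (by omega)
          (by omega) (by omega)) (by omega)).symm.trans
        (Linked.row hL (by omega) fun z _ _ => lay _ _ (by omega) (by omega) (by omega) (by omega)
          (by omega) (by omega))
    · exact (Linked.right hL (lay _ _ (by omega) (by omega) (by omega) (by omega)
          (by omega) (by omega)) (lay _ _ (by omega) (by omega) (by omega) (by omega)
          (by omega) (by omega))).trans
        ((Linked.up hL (lay (2 * k + 2) (k + 1) (by omega) (by omega) (by omega) (by omega)
          (by omega) (by omega)) (lay _ _ (by omega) (by omega) (by omega) (by omega)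
          (by omega) (by omega)) (by omega)).symm.trans
        (Linked.row hL (by omega) fun z _ _ => lay _ _ (by omega) (by omega) (by omega) (by omega)
          (by omega) (by omega)))
  have hx := lay (2 * k + 1) (k + 2) (by omega) (by omega) (by omega) (by omega)
    (by omega) (by omega)
  have hax : (elementaryWall r).Adj (2 * k, k + 2) (2 * k + 1, k + 2) :=
    adj _ _ _ _ (by omega) (by omega) (by omega)
  rcases eq_or_lt_of_le hk with rfl | hk
  · refine ⟨A, {(4, 3)}, (4, 4), (5, 4), (5, 3), (4, 3), hA1, ?_, hA2, ?_, ?_,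
      (hA _ _).2 (by omega), (hA _ _).2 (by omega), rfl, rfl, Linked.refl, Linked.refl, hax, ?_,
      hx, ?_, by simp, ?_⟩
    · rintro _ rfl; exact Or.inl rfl
    · rintro _ rfl; exact out _ _ (by omega) (by omega)
    · rw [Set.disjoint_singleton_right, hA]; omega
    · exact adj _ _ _ _ (by omega) (by omega) (by omega)
    · exact lay _ _ (by omega) (by omega) (by omega) (by omega) (by omega) (by omega)
    · exact (Linked.up hL (lay 5 3 (by omega) (by omega) (by omega) (by omega) (by omega)
        (by omega)) hx (by omega)).symm
  obtain ⟨x₀, h1, h2, h3⟩ : ∃ x₀, 2 * k + 2 ≤ x₀ ∧ x₀ ≤ 2 * k + 3 ∧ (x₀ + k) % 2 = 0 := by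
    rcases Nat.mod_two_eq_zero_or_one k with h | h
    · exact ⟨2 * k + 2, by omega, by omega, by omega⟩
    · exact ⟨2 * k + 3, by omega, by omega, by omega⟩
  obtain ⟨B, hB⟩ : ∃ B : Set (ℕ × ℕ), ∀ x y, (x, y) ∈ B ↔ (4 ≤ x ∧ x ≤ 2 * k + 3 ∧ y = 3) ∨
      (2 * k + 2 ≤ x ∧ x ≤ 2 * k + 3 ∧ 3 ≤ y ∧ y ≤ k) :=
    ⟨{p | (4 ≤ p.1 ∧ p.1 ≤ 2 * k + 3 ∧ p.2 = 3) ∨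
      (2 * k + 2 ≤ p.1 ∧ p.1 ≤ 2 * k + 3 ∧ 3 ≤ p.2 ∧ p.2 ≤ k)}, fun _ _ => Iff.rfl⟩
  have hB2 : B ⊆ outerVerts r (k + 1) := by
    rintro ⟨x, y⟩ h
    rw [hB] at h
    exact out x y (by omega) (by omega)
  have hBW : B ⊆ wallVerts r 1 := hB2.trans Set.sdiff_subset
  refine ⟨A, B, (2 * k, k + 2), (2 * k + 1, k + 2), (x₀, k + 1), (x₀, k), hA1, ?_, hA2, hB2, ?_,
      (hA _ _).2 (by omega), (hA _ _).2 (by omega), (hB _ _).2 (by omega), (hB _ _).2 (by omega),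
      linkA, ?_, hax, adj _ _ _ _ (by omega) (by omega) (by omega),
      hx, lay _ _ (by omega) (by omega) (by omega) (by omega) (by omega) (by omega), by simp,
      hlinkL x₀ h1 h2⟩
  · rintro ⟨x, y⟩ h
    rw [hB] at h
    by_cases h4 : x = 4
    · obtain rfl : y = 3 := by omega
      exact Or.inl (by rw [h4])
    · exact Or.inr (mem_window.2 (by omega))
  · rw [Set.disjoint_left]
    rintro ⟨x, y⟩ h h'
    rw [hA] at h
    rw [hB] at h'
    omega
  · exact ((Linked.row hBW (show 4 ≤ 2 * k + 2 by omega)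
      fun z _ _ => (hB _ _).2 (by omega)).trans
      ((Linked.columns (x := 2 * k + 2) hBW (show 3 ≤ k by omega)
          fun z _ _ => ⟨(hB _ _).2 (by omega), (hB _ _).2 (by omega)⟩).trans
        (Linked.row hBW h1 fun z _ _ => (hB _ _).2 (by omega)))).symm

/-! ### Linking the pegs within the wall -/

theorem layerVerts_one_subset_outerVerts {r : ℕ} :
    layerVerts r 1 ⊆ outerVerts r 2 :=
  fun _ h => ⟨h.1, fun h' => h.2 h'.1⟩

theorem outerVerts_mono {r i j : ℕ} (hr : Odd r) (hi : 1 ≤ i) (hij : i ≤ j)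
    (hjr : 2 * j + 1 ≤ r) : outerVerts r i ⊆ outerVerts r j := by
  rintro ⟨x, y⟩ ⟨h1, h2⟩
  refine ⟨h1, fun h3 => h2 ?_⟩
  rcases eq_or_lt_of_le hij with rfl | hij
  · exact h3
  · refine window_subset hr hi (by omega) ?_
    have := h3.1
    rw [mem_window] at this ⊢
    omega

theorem layerVerts_subset_outerVerts {r i j : ℕ} (hr : Odd r) (hi : 1 ≤ i) (hij : i < j)
    (hjr : 2 * j + 1 ≤ r) : layerVerts r i ⊆ outerVerts r j := by
  rintro ⟨x, y⟩ h
  refine ⟨layerVerts_subset_one hr hi (by omega) h, fun h3 => h.2 ?_⟩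
  have := h3.1
  rw [mem_window] at this ⊢
  omega

theorem disjoint_strata {r : ℕ} (hr : Odd r) (h5 : 5 ≤ r) {X₁ X₂ X₃ Y₁ Y₂ Y₃ : Set (ℕ × ℕ)}
    (hX₁ : X₁ ⊆ outerVerts r 2) (hX₂ : X₂ ⊆ layerVerts r 2) (hX₃ : X₃ ⊆ window r 3)
    (hY₁ : Y₁ ⊆ outerVerts r 2) (hY₂ : Y₂ ⊆ layerVerts r 2) (hY₃ : Y₃ ⊆ window r 3)
    (h₁ : Disjoint X₁ Y₁) (h₂ : Disjoint X₂ Y₂) (h₃ : Disjoint X₃ Y₃) :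
    Disjoint (X₁ ∪ X₂ ∪ X₃) (Y₁ ∪ Y₂ ∪ Y₃) := by
  have hw := window_subset hr (i := 2) (by omega) (by omega)
  rw [Set.disjoint_left] at *
  rintro p ((h | h) | h) ((h' | h') | h')
  · exact h₁ h h'
  · exact (hX₁ h).2 (hY₂ h').1
  · exact (hX₁ h).2 (hw (hY₃ h'))
  · exact (hY₁ h').2 (hX₂ h).1
  · exact h₂ h h'
  · exact (hX₂ h).2 (hY₃ h')
  · exact (hY₁ h').2 (hw (hX₃ h))
  · exact (hY₂ h').2 (hX₃ h)
  · exact h₃ h h'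

theorem secondSeg_mono {r a b a' b' : ℕ} (ha : a' ≤ a) (hb : b ≤ b') :
    secondSeg r a b ⊆ secondSeg r a' b' :=
  fun _ ⟨t, ht, h1, h2⟩ => ⟨t, ht, ha.trans h1, h2.trans hb⟩

theorem linked_union_left {r : ℕ} {S T : Set (ℕ × ℕ)} {p q : ℕ × ℕ} (h : Linked r S p q) :
    Linked r (S ∪ T) p q := h.mono Set.subset_union_left

theorem exists_linkage {r k n : ℕ} (hr : Odd r) (hk : 1 ≤ k) (hkr : 2 * k + 3 ≤ r)
    (hn : n = 2 * k + 2) {p : ℕ → ℕ × ℕ} (hpeg : ∀ i < n, IsPeg r (p i)) {t : ℕ → ℕ}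
    (hon : ∀ i < n, OnFirst r (p i).1 (p i).2 (t i)) (hmono : ∀ i j, i < j → j < n → t i < t j)
    {E : ℕ → ℕ} (hE : IsPairing n E) :
    ∃ (M : ℕ → ℕ) (β : ℕ) (S : ℕ → Set (ℕ × ℕ)) (SA SQ SB : Set (ℕ × ℕ)) (a x y b : ℕ × ℕ),
      IsPairing n M ∧ (∀ A ⊆ Finset.range n, A.Nonempty → (∀ i ∈ A, M i ∈ A) →
        (∀ i ∈ A, E i ∈ A) → A = Finset.range n) ∧ β < n ∧
      (∀ i < n, i ≠ β → i ≠ M β → S (M i) = S i ∧ S i ⊆ outerVerts r (k + 1) ∧ p i ∈ S i ∧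
        Linked r (S i) (p i) (p (M i)) ∧ Disjoint (S i) SA ∧ Disjoint (S i) SB ∧
        ∀ j < n, j ≠ β → j ≠ M β → j ≠ i → j ≠ M i → Disjoint (S i) (S j)) ∧
      SA ⊆ outerVerts r (k + 1) ∧ SB ⊆ outerVerts r (k + 1) ∧ SQ ⊆ layerVerts r (k + 1) ∧
      Disjoint SA SB ∧ p β ∈ SA ∧ a ∈ SA ∧ b ∈ SB ∧ p (M β) ∈ SB ∧ x ∈ SQ ∧ y ∈ SQ ∧ x ≠ y ∧
      Linked r SA (p β) a ∧ (elementaryWall r).Adj a x ∧ Linked r SQ x y ∧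
      (elementaryWall r).Adj y b ∧ Linked r SB b (p (M β)) := by
  have h5 : 5 ≤ r := by omega
  have hrank : ∀ i, ∃ t', i + 1 < n → PegRank r (p i).1 (p i).2 (t i) t' := by
    intro i
    by_cases hi : i + 1 < n
    swap
    · exact ⟨0, fun h => absurd h hi⟩
    have hle : t (i + 1) + 4 ≤ 8 * r := by
      rcases (hpeg (i + 1) hi).exists_pegRank h5 with h | ⟨t₁, t', h⟩
      · have := hon (i + 1) hi
        rw [h.1, h.2, OnFirst] at this
        omega
      · have := (hon (i + 1) hi).rank_eq hr h5 (h.onFirst hr h5)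
        have := h.bounds h5
        omega
    have hlt := hmono i (i + 1) (by omega) hi
    rcases (hpeg i (by omega)).exists_pegRank h5 with h | ⟨t₁, t', h⟩
    · have := hon i (by omega)
      rw [h.1, h.2, OnFirst] at this
      omega
    · have := (hon i (by omega)).rank_eq hr h5 (h.onFirst hr h5)
      exact ⟨t', fun _ => this ▸ h⟩
  choose t' hrk using hrank
  obtain ⟨c, hc⟩ : ∃ c, ∀ i, i + 1 < n → t i = 4 * r - 4 → t (i + 1) = 4 * r → i = c := by
    by_cases h : ∃ i, i + 1 < n ∧ t i = 4 * r - 4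
    · obtain ⟨c, h1, h2⟩ := h
      refine ⟨c, fun i h3 h4 _ => ?_⟩
      rcases lt_trichotomy i c with h5 | h5 | h5
      · have := hmono i c h5 (by omega); omega
      · exact h5
      · have := hmono c i h5 (by omega); omega
    · exact ⟨0, fun i h1 h2 _ => absurd ⟨i, h1, h2⟩ h⟩
  obtain ⟨M, β, α, hM, hconn, hMβ, hβα, hαn, hβ2, hα2, hpairs, hlong, hcl, hcα⟩ :=
    exists_pairing (n := n) (by omega) (by omega) hE c
  have hMα : M α = β := hMβ ▸ hM.inv β (by omega)
  have weak : ∀ i j, i ≤ j → j + 1 < n → t' i ≤ t' j := by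
    intro i j hij hj
    rcases eq_or_lt_of_le hij with rfl | hij
    · exact le_rfl
    · rcases (hrk i (by omega)).le hr h5 (hrk j hj) (hmono i j hij (by omega)) with h | h <;> omega
  have hord : ∀ i j, i < j → j + 1 < n → (i + 1 = j → j ≠ c + 1 ∧ j + 2 < n) → t' i < t' j := by
    intro i j hij hj hcond
    rcases (hrk i (by omega)).le hr h5 (hrk j hj) (hmono i j hij (by omega)) with h | ⟨-, h⟩
    · exact h
    exfalso
    by_cases hij1 : i + 1 = j
    · obtain ⟨h1, h2⟩ := hcond hij1
      rcases h with h | h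
      · exact h1 (by rw [← hc i (by omega) h.1 (hij1 ▸ h.2), hij1])
      · have h3 := hmono j (j + 1) (by omega) (by omega)
        have := (hrk (j + 1) h2).bounds h5
        omega
    · have h1 := hmono i (i + 1) (by omega) (by omega)
      have h2 := hmono (i + 1) j (by omega) (by omega)
      have h3 := (hrk (i + 1) (by omega)).gap h5
      omega
  have hout2 : ∀ i < n, stub r (p i) ⊆ outerVerts r 2 := fun i hi => stub_subset hr h5 (hpeg i hi)
  have hL1 := layerVerts_one_subset_outerVerts (r := r)
  have hmem : ∀ i, p i ∈ stub r (p i) := fun i => Or.inl ⟨rfl, rfl⟩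
  -- the access to the second layer at `α`
  obtain ⟨SB₀, tα, s', q', hSB₀, hα₀, hs', hls', hadj', hq', htα, hstub', hfirst'⟩ :
      ∃ (SB₀ : Set (ℕ × ℕ)) (tα : ℕ) (s q : ℕ × ℕ), SB₀ ⊆ outerVerts r 2 ∧ p α ∈ SB₀ ∧ s ∈ SB₀ ∧
      Linked r SB₀ (p α) s ∧ (elementaryWall r).Adj s q ∧ OnSecond r q.1 q.2 tα ∧
      (tα + 19 ≤ 8 * r ∧ (7 ≤ r → 10 ≤ tα)) ∧
      (∀ j < α, t' j < tα ∧ Disjoint (stub r (p j)) SB₀) ∧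
      (∀ i, i + 1 < n → i ≠ α → i + 1 ≠ α → Disjoint (firstSeg r (t i) (t (i + 1))) SB₀) := by
    by_cases hα1 : α + 1 = n
    · have hlast : t α + 4 ≤ 8 * r := by
        rcases (hpeg α hαn).exists_pegRank h5 with h | ⟨t₁, t', h⟩
        · have := hon α hαn
          rw [h.1, h.2, OnFirst] at this
          omega
        · have := (hon α hαn).rank_eq hr h5 (h.onFirst hr h5)
          have := h.bounds h5
          omega
      have h23 : OnFirst r 2 3 (8 * r - 4) := Or.inr (Or.inr (Or.inr (Or.inr (by omega))))
      have h33 : OnSecond r 3 3 (8 * r - 19) := Or.inr (Or.inr (Or.inr (Or.inr (by omega))))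
      have h8 := ((hrk β (by omega)).bounds h5).1.trans (hmono β α hβα hαn).le
      refine ⟨firstSeg r (t α) (8 * r - 4), 8 * r - 19, (2, 3), (3, 3),
        (firstSeg_subset hr h5).trans hL1, ⟨t α, hon α hαn, le_rfl, by omega⟩,
        ⟨_, h23, by omega, le_rfl⟩, linked_firstSeg hr h5 (by omega) (by omega) (hon α hαn) h23,
        ⟨(h23.mem_layerVerts hr h5).1, layerVerts_subset_one hr (by omega) (by omega)
          (h33.mem_layerVerts hr h5), brickGraph_adj.2 (by omega)⟩, h33, ⟨by omega, by omega⟩,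
        fun j hj => ⟨?_, ?_⟩, fun i hi h1 h2 => ?_⟩
      · have := (hrk j (by omega)).bounds h5
        omega
      · exact (hrk j (by omega)).disjoint_firstSeg hr h5 (Or.inl (hmono j α hj hαn))
      · exact disjoint_firstSeg hr h5 (hmono _ _ (by omega) hαn)
    · have hα1' : α + 1 < n := by omega
      obtain ⟨s, q, h1, h2, h3, h4⟩ := (hrk α hα1').exists_onSecond hr h5
      have hb := (hrk α hα1').bounds h5
      have hten : 7 ≤ r → 10 ≤ t' α := fun h7 => (hrk α hα1').ten_le h7
        (((hrk β (by omega)).bounds h5).1.trans_lt (hmono β α hβα hαn))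
      have hlt : ∀ j < α, t' j < t' α := fun j hj => hord j α hj hα1' fun _ =>
        ⟨fun h => hα1 (hcα h), by omega⟩
      refine ⟨stub r (p α), t' α, s, q, hout2 α hαn, hmem α, h1, h2, h4, h3, ⟨by omega, hten⟩,
        fun j hj => ⟨hlt j hj, ?_⟩, fun i hi h1 h2 => ?_⟩
      · exact (hrk j (by omega)).disjoint_stub h5 (hrk α hα1') (hlt j hj).ne
      · refine ((hrk α hα1').disjoint_firstSeg hr h5 ?_).symm
        rcases lt_or_gt_of_ne h1 with h | h
        · exact Or.inr (hmono _ _ (by omega) hαn)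
        · exact Or.inl (hmono _ _ h (by omega))
  -- the sets of the other pairs
  obtain ⟨T, hT⟩ : ∃ T : ℕ → Set (ℕ × ℕ), ∀ i, T i = if M i = i + 1 then
      firstSeg r (t i) (t (i + 1)) else
      (stub r (p i) ∪ stub r (p (M i))) ∪ secondSeg r (t' i) (t' (M i)) ∪ ∅ := ⟨_, fun _ => rfl⟩
  have hTs : ∀ i, M i = i + 1 → T i = firstSeg r (t i) (t (i + 1)) ∪ ∅ ∪ ∅ := fun i h => by
    rw [hT, if_pos h]; simp
  have hTl : ∀ i, M i ≠ i + 1 → T i =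
      (stub r (p i) ∪ stub r (p (M i))) ∪ secondSeg r (t' i) (t' (M i)) ∪ ∅ := fun i h => by
    rw [hT, if_neg h]
  have hlen : ∀ i < n, i < M i → i ≠ β → M i ≠ i + 1 → i + 1 < M i ∧ β < i ∧ M i < α ∧
      t' β < t' i ∧ t' i ≤ t' (M i) ∧ i + 2 < n := by
    intro i hi hlt hiβ hne
    obtain ⟨h1, h2, h3, h4, h5⟩ := (hpairs i hi hlt hiβ).resolve_left hne
    exact ⟨h1, h4, h5, hord β i h4 (by omega) fun _ => ⟨hcl i hi h1 hiβ, by omega⟩,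
      weak _ _ hlt.le (by omega), by omega⟩
  have hfS := fun a b => (firstSeg_subset (a := a) (b := b) hr h5).trans hL1
  have hsS := fun a b => secondSeg_subset (a := a) (b := b) hr h5
  have hTprop : ∀ i < n, i < M i → i ≠ β → p i ∈ T i ∧ p (M i) ∈ T i ∧
      Linked r (T i) (p i) (p (M i)) := by
    intro i hi hlt hiβ
    by_cases hs : M i = i + 1
    · have hin : i + 1 < n := hs ▸ hM.lt i hi
      rw [hT, if_pos hs, hs]
      have h1 := hmono i (i + 1) (by omega) hin
      have h2 := ((hrk i hin).bounds h5).1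
      exact ⟨⟨_, hon i hi, le_rfl, h1.le⟩, ⟨_, hon _ hin, h1.le, le_rfl⟩,
        linked_firstSeg hr h5 (by omega) h1.le (hon i hi) (hon _ hin)⟩
    · obtain ⟨h1, h2, h3, h4, h5', h6⟩ := hlen i hi hlt hiβ hs
      rw [hTl i hs]
      refine ⟨Or.inl (Or.inl (Or.inl (hmem i))), Or.inl (Or.inl (Or.inr (hmem _))), ?_⟩
      obtain ⟨s, q, a1, a2, a3, a4⟩ := (hrk i (by omega)).exists_onSecond hr h5
      obtain ⟨s', q', b1, b2, b3, b4⟩ := (hrk (M i) (by omega)).exists_onSecond hr h5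
      refine ((a2.mono ?_).trans (Linked.of_adj a4 ?_ ?_)).trans
        (((linked_secondSeg hr h5 ?_ h5' a3 b3).mono ?_).trans
        ((b2.mono ?_).trans (Linked.of_adj b4 ?_ ?_)).symm)
      · exact fun z hz => Or.inl (Or.inl (Or.inl hz))
      · exact Or.inl (Or.inl (Or.inl a1))
      · exact Or.inl (Or.inr ⟨_, a3, le_rfl, h5'⟩)
      · exact ((hrk i (by omega)).bounds h5).2.2.1
      · exact fun z hz => Or.inl (Or.inr hz)
      · exact fun z hz => Or.inl (Or.inl (Or.inr hz))
      · exact Or.inl (Or.inl (Or.inr b1))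
      · exact Or.inl (Or.inr ⟨_, b3, h5', le_rfl⟩)
  have hshort : ∀ i j, i + 1 < n → j + 1 < n → j ≠ i → j ≠ i + 1 →
      Disjoint (stub r (p j)) (firstSeg r (t i) (t (i + 1))) := by
    intro i j hi hj h1 h2
    refine (hrk j hj).disjoint_firstSeg hr h5 ?_
    rcases lt_or_gt_of_ne h1 with h | h
    · exact Or.inl (hmono _ _ h (by omega))
    · exact Or.inr (hmono _ _ (by omega) (by omega))
  have hstubs : ∀ i j, i + 1 < n → j + 1 < n → t' i < t' j →
      Disjoint (stub r (p i)) (stub r (p j)) := fun i j hi hj h =>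
    (hrk i hi).disjoint_stub h5 (hrk j hj) h.ne
  have E2 : (∅ : Set (ℕ × ℕ)) ⊆ layerVerts r 2 := Set.empty_subset _
  have E3 : (∅ : Set (ℕ × ℕ)) ⊆ window r 3 := Set.empty_subset _
  have hTT' : ∀ i j, i < n → i < M i → i ≠ β → j < n → j < M j → j ≠ β → i < j →
      Disjoint (T i) (T j) := by
    intro i j hi hiM hiβ hj hjM hjβ hij
    have hMij : M i ≠ M j := fun h => by have := hM.inj hi hj h; omega
    have hMi := hM.lt i hi
    have hMj := hM.lt j hj
    by_cases hsi : M i = i + 1 <;> by_cases hsj : M j = j + 1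
    · have hne : i + 1 ≠ j := fun h => by
        have h1 := hM.inv i hi
        rw [hsi, h, hsj] at h1
        omega
      rw [hTs i hsi, hTs j hsj]
      exact disjoint_strata hr h5 (hfS _ _) E2 E3 (hfS _ _) E2 E3
        (disjoint_firstSeg hr h5 (hmono _ _ (by omega) hj)) (by simp) (by simp)
    · obtain ⟨a1, a2, a3, a4, a5, a6⟩ := hlen j hj hjM hjβ hsj
      have hne : i + 1 ≠ j := fun h => by
        have h1 := hM.inv i hi
        rw [hsi, h] at h1
        omega
      rw [hTs i hsi, hTl j hsj]
      refine disjoint_strata hr h5 (hfS _ _) E2 E3 (Set.union_subset (hout2 _ hj) (hout2 _ hMj))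
        (hsS _ _) E3 (Set.disjoint_union_right.2 ⟨(hshort i j ?_ ?_ ?_ ?_).symm,
          (hshort i (M j) ?_ ?_ ?_ ?_).symm⟩) (by simp) (by simp) <;> omega
    · obtain ⟨a1, a2, a3, a4, a5, a6⟩ := hlen i hi hiM hiβ hsi
      have hne : M i ≠ j := fun h => by
        have h1 := hM.inv i hi
        rw [h, hsj] at h1
        omega
      rw [hTl i hsi, hTs j hsj]
      refine disjoint_strata hr h5 (Set.union_subset (hout2 _ hi) (hout2 _ hMi))
        (hsS _ _) E3 (hfS _ _) E2 E3 (Set.disjoint_union_left.2 ⟨hshort j i ?_ ?_ ?_ ?_,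
          hshort j (M i) ?_ ?_ ?_ ?_⟩) (by simp) (by simp) <;> omega
    · obtain ⟨a1, a2, a3, a4, a5, a6⟩ := hlen i hi hiM hiβ hsi
      obtain ⟨b1, b2, b3, b4, b5, b6⟩ := hlen j hj hjM hjβ hsj
      have hlt := hlong i j hi hj a1 b1 hiβ hjβ hij
      have key : t' (M i) < t' j := hord _ _ hlt (by omega) fun _ =>
        ⟨hcl j hj b1 hjβ, by omega⟩
      rw [hTl i hsi, hTl j hsj]
      refine disjoint_strata hr h5 (Set.union_subset (hout2 _ hi) (hout2 _ hMi))
        (hsS _ _) E3 (Set.union_subset (hout2 _ hj) (hout2 _ hMj)) (hsS _ _) E3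
        (Set.disjoint_union_left.2 ⟨Set.disjoint_union_right.2 ⟨hstubs _ _ ?_ ?_ ?_,
          hstubs _ _ ?_ ?_ ?_⟩, Set.disjoint_union_right.2 ⟨hstubs _ _ ?_ ?_ ?_,
          hstubs _ _ ?_ ?_ ?_⟩⟩) (disjoint_secondSeg hr h5 key) (by simp) <;> omega
  -- the sets of the pair `{β, α}` avoid those of the other pairs
  have hTdeep : ∀ X₂ X₃ Y₂ Y₃ : Set (ℕ × ℕ), X₂ ⊆ layerVerts r 2 → X₃ ⊆ window r 3 →
      Y₂ ⊆ layerVerts r 2 → Y₃ ⊆ window r 3 → (∀ i < n, i < M i → i ≠ β → M i ≠ i + 1 →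
        Disjoint X₂ (secondSeg r (t' i) (t' (M i))) ∧
        Disjoint Y₂ (secondSeg r (t' i) (t' (M i)))) →
      ∀ i < n, i < M i → i ≠ β → Disjoint (T i) (stub r (p β) ∪ X₂ ∪ X₃) ∧
        Disjoint (T i) (SB₀ ∪ Y₂ ∪ Y₃) := by
    intro X₂ X₃ Y₂ Y₃ hX₂ hX₃ hY₂ hY₃ hXY i hi hiM hiβ
    have hiα : i ≠ α := fun h => by rw [h, hMα] at hiM; omega
    have hMi := hM.lt i hi
    by_cases hsi : M i = i + 1
    · have h1 : i + 1 ≠ β := fun h => by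
        have := hM.inv i hi
        rw [hsi, h, hMβ] at this
        omega
      have h2 : i + 1 ≠ α := fun h => by
        have := hM.inv i hi
        rw [hsi, h, hMα] at this
        omega
      rw [hTs i hsi]
      exact ⟨disjoint_strata hr h5 (hfS _ _) E2 E3 (hout2 β (by omega)) hX₂ hX₃
        (hshort i β (by omega) (by omega) hiβ.symm h1.symm).symm (by simp) (by simp),
        disjoint_strata hr h5 (hfS _ _) E2 E3 hSB₀ hY₂ hY₃
        (hfirst' i (by omega) hiα h2) (by simp) (by simp)⟩
    · obtain ⟨a1, a2, a3, a4, a5, a6⟩ := hlen i hi hiM hiβ hsi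
      obtain ⟨b1, b2⟩ := hXY i hi hiM hiβ hsi
      rw [hTl i hsi]
      exact ⟨disjoint_strata hr h5 (Set.union_subset (hout2 _ hi) (hout2 _ hMi))
        (hsS _ _) E3 (hout2 β (by omega)) hX₂ hX₃ (Set.disjoint_union_left.2
          ⟨(hstubs _ _ (by omega) (by omega) a4).symm,
            (hstubs _ _ (by omega) (by omega) (by omega)).symm⟩) b1.symm (by simp),
        disjoint_strata hr h5 (Set.union_subset (hout2 _ hi) (hout2 _ hMi))
        (hsS _ _) E3 hSB₀ hY₂ hY₃ (Set.disjoint_union_left.2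
          ⟨(hstub' i (by omega)).2, (hstub' _ a3).2⟩) b2.symm (by simp)⟩
  obtain ⟨s, q, hs, hls, hq, hadj⟩ := (hrk β (by omega)).exists_onSecond hr h5
  have hbβ := (hrk β (by omega)).bounds h5
  have htβα := (hstub' β hβα).1
  -- it remains to link `β` and `α`
  suffices hdeep : ∃ (X₂ X₃ Y₂ Y₃ SQ : Set (ℕ × ℕ)) (a x y b : ℕ × ℕ), X₂ ⊆ layerVerts r 2 ∧
      X₃ ⊆ window r 3 ∧ Y₂ ⊆ layerVerts r 2 ∧ Y₃ ⊆ window r 3 ∧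
      X₂ ⊆ outerVerts r (k + 1) ∧ X₃ ⊆ outerVerts r (k + 1) ∧ Y₂ ⊆ outerVerts r (k + 1) ∧
      Y₃ ⊆ outerVerts r (k + 1) ∧ Disjoint X₂ Y₂ ∧ Disjoint X₃ Y₃ ∧
      (∀ i < n, i < M i → i ≠ β → M i ≠ i + 1 →
        Disjoint X₂ (secondSeg r (t' i) (t' (M i))) ∧
        Disjoint Y₂ (secondSeg r (t' i) (t' (M i)))) ∧
      SQ ⊆ layerVerts r (k + 1) ∧
      a ∈ stub r (p β) ∪ X₂ ∪ X₃ ∧ b ∈ SB₀ ∪ Y₂ ∪ Y₃ ∧ x ∈ SQ ∧ y ∈ SQ ∧ x ≠ y ∧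
      Linked r (stub r (p β) ∪ X₂ ∪ X₃) (p β) a ∧ (elementaryWall r).Adj a x ∧ Linked r SQ x y ∧
      (elementaryWall r).Adj y b ∧ Linked r (SB₀ ∪ Y₂ ∪ Y₃) b (p α) by
    obtain ⟨X₂, X₃, Y₂, Y₃, SQ, a, x, y, b, hX₂, hX₃, hY₂, hY₃, oX₂, oX₃, oY₂, oY₃, d₂, d₃, hd,
      hSQ, ha, hb, hx, hy, hxy, hla, hax, hxyl, hyb, hlb⟩ := hdeep
    have ho2 := outerVerts_mono hr (show 1 ≤ 2 by omega) (show 2 ≤ k + 1 by omega) (by omega)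
    have hk2 : ∀ i < n, i < M i → i ≠ β → M i ≠ i + 1 → 2 ≤ k := by
      intro i hi hiM hiβ hne
      rcases hpairs i hi hiM hiβ with h | h <;> omega
    have hTo : ∀ i < n, i < M i → i ≠ β → T i ⊆ outerVerts r (k + 1) := by
      intro i hi hiM hiβ
      by_cases hsi : M i = i + 1
      · rw [hT, if_pos hsi]
        exact (hfS _ _).trans ho2
      · rw [hTl i hsi]
        have := hk2 i hi hiM hiβ hsi
        exact Set.union_subset (Set.union_subset (Set.union_subset ((hout2 _ hi).trans ho2)
          ((hout2 _ (hM.lt i hi)).trans ho2)) ((hsS _ _).trans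
          (layerVerts_subset_outerVerts hr (by omega) (by omega) (by omega)))) (Set.empty_subset _)
    have hTd := hTdeep X₂ X₃ Y₂ Y₃ hX₂ hX₃ hY₂ hY₃ hd
    have hmin : ∀ i < n, i ≠ β → i ≠ M β → min i (M i) < n ∧
        min i (M i) < M (min i (M i)) ∧ min i (M i) ≠ β := by
      intro i hi h1 h2
      have h3 := hM.lt i hi
      have h4 := hM.ne i hi
      have h5 := hM.inv i hi
      have h6 : M i ≠ β := fun h => h2 (by rw [← h, h5])
      rcases lt_or_gt_of_ne h4 with h | h
      · rw [min_eq_right h.le, h5]; exact ⟨h3, h, h6⟩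
      · rw [min_eq_left h.le]; exact ⟨hi, h, h1⟩
    refine ⟨M, β, fun i => T (min i (M i)), stub r (p β) ∪ X₂ ∪ X₃, SQ, SB₀ ∪ Y₂ ∪ Y₃, a, x, y, b,
      hM, hconn, by omega, fun i hi h1 h2 => ?_, ?_, ?_, hSQ, ?_, ?_, ha, hb, ?_, hx, hy, hxy,
      hla, hax, hxyl, hyb, ?_⟩
    · obtain ⟨m1, m2, m3⟩ := hmin i hi h1 h2
      refine ⟨?_, hTo _ m1 m2 m3, ?_, ?_, (hTd _ m1 m2 m3).1, (hTd _ m1 m2 m3).2, ?_⟩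
      · simp only [hM.inv i hi, min_comm]
      · obtain ⟨k1, k2, -⟩ := hTprop _ m1 m2 m3
        rcases lt_or_gt_of_ne (hM.ne i hi) with h | h
        · simp only [min_eq_right h.le] at k2 ⊢
          rwa [hM.inv i hi] at k2
        · simp only [min_eq_left h.le] at k1 ⊢
          exact k1
      · obtain ⟨-, -, k3⟩ := hTprop _ m1 m2 m3
        rcases lt_or_gt_of_ne (hM.ne i hi) with h | h
        · simp only [min_eq_right h.le] at k3 ⊢
          rw [hM.inv i hi] at k3
          exact k3.symm
        · simp only [min_eq_left h.le] at k3 ⊢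
          exact k3
      · intro j hj j1 j2 j3 j4
        obtain ⟨l1, l2, l3⟩ := hmin j hj j1 j2
        have hne : min i (M i) ≠ min j (M j) := by
          have e1 : M j ≠ i := fun h => j4 (by rw [← h, hM.inv j hj])
          have e2 : M j ≠ M i := fun h => j3 (hM.inj hj hi h)
          omega
        rcases lt_or_gt_of_ne hne with h | h
        · exact hTT' _ _ m1 m2 m3 l1 l2 l3 h
        · exact (hTT' _ _ l1 l2 l3 m1 m2 m3 h).symm
    · exact Set.union_subset (Set.union_subset ((hout2 β (by omega)).trans ho2) oX₂) oX₃
    · exact Set.union_subset (Set.union_subset (hSB₀.trans ho2) oY₂) oY₃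
    · exact disjoint_strata hr h5 (hout2 β (by omega)) hX₂ hX₃ hSB₀ hY₂ hY₃ (hstub' β hβα).2 d₂ d₃
    · exact Or.inl (Or.inl (hmem β))
    · rw [hMβ]; exact Or.inl (Or.inl hα₀)
    · rw [hMβ]; exact hlb
  have h34 : OnSecond r 3 4 8 := by
    by_cases h : r = 5
    · exact Or.inr (Or.inl (by omega))
    · exact Or.inl (by omega)
  have h33 : OnSecond r 3 3 (8 * r - 19) := Or.inr (Or.inr (Or.inr (Or.inr (by omega))))
  rcases eq_or_lt_of_le hk with rfl | hk
  · refine ⟨∅, ∅, ∅, ∅, secondSeg r 8 (t' β) ∪ secondSeg r tα (8 * r - 19), s, q, q', s', E2, E3,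
      E2, E3, Set.empty_subset _, Set.empty_subset _, Set.empty_subset _, Set.empty_subset _,
      by simp, by simp, by simp, Set.union_subset (hsS _ _) (hsS _ _), Or.inl (Or.inl hs),
      Or.inl (Or.inl hs'), Or.inl ⟨_, hq, by omega, le_rfl⟩, Or.inr ⟨_, hq', le_rfl, by omega⟩,
      ?_, linked_union_left (linked_union_left hls), hadj, ?_, hadj'.symm,
      linked_union_left (linked_union_left hls'.symm)⟩
    · rintro rfl
      have := hq.rank_eq hr h5 hq'
      omega
    · have sub := layerVerts_subset_one hr (i := 2) (by omega) (by omega)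
      refine ((linked_secondSeg hr h5 le_rfl (by omega) h34 hq).symm.mono
        Set.subset_union_left).trans ((Linked.of_adj (q := (3, 3)) ?_ ?_ ?_).trans
        ((linked_secondSeg hr h5 (by omega) (by omega) hq' h33).symm.mono
          Set.subset_union_right))
      · exact ⟨sub (h34.mem_layerVerts hr h5), sub (h33.mem_layerVerts hr h5),
          brickGraph_adj.2 (by omega)⟩
      · exact Or.inl ⟨8, h34, le_rfl, by omega⟩
      · exact Or.inr ⟨_, h33, by omega, le_rfl⟩
  · obtain ⟨A, B, a, x, y, b, hA, hB, hAo, hBo, hAB, h44A, ha, hb, h43B, hlA, hlB, hax, hyb, hx, hy,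
      hxy, hlxy⟩ := exists_core hr hk hkr
    have h44 : OnSecond r 4 4 9 := Or.inl (by omega)
    have h43 : OnSecond r 4 3 (8 * r - 20) := Or.inr (Or.inr (Or.inr (Or.inr (by omega))))
    have hl2o := layerVerts_subset_outerVerts hr (show 1 ≤ 2 by omega) (show 2 < k + 1 by omega)
      (by omega)
    have htα10 := htα.2 (by omega)
    have m1 : (4, 4) ∈ secondSeg r 8 (max 9 (t' β)) := ⟨9, h44, by omega, by omega⟩
    have m2 : (4, 3) ∈ secondSeg r (min tα (8 * r - 20)) (8 * r - 19) :=
      ⟨8 * r - 20, h43, by omega, by omega⟩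
    have sA : A ⊆ stub r (p β) ∪ secondSeg r 8 (max 9 (t' β)) ∪ (A ∩ window r 3) := by
      intro z hz
      rcases hA hz with rfl | h
      · exact Or.inl (Or.inr m1)
      · exact Or.inr ⟨hz, h⟩
    have sB : B ⊆ SB₀ ∪ secondSeg r (min tα (8 * r - 20)) (8 * r - 19) ∪ (B ∩ window r 3) := by
      intro z hz
      rcases hB hz with rfl | h
      · exact Or.inl (Or.inr m2)
      · exact Or.inr ⟨hz, h⟩
    refine ⟨secondSeg r 8 (max 9 (t' β)), A ∩ window r 3,
      secondSeg r (min tα (8 * r - 20)) (8 * r - 19), B ∩ window r 3, layerVerts r (k + 1),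
      a, x, y, b, hsS _ _, Set.inter_subset_right, hsS _ _, Set.inter_subset_right,
      (hsS _ _).trans hl2o, Set.inter_subset_left.trans hAo, (hsS _ _).trans hl2o,
      Set.inter_subset_left.trans hBo, disjoint_secondSeg hr h5 (by omega),
      hAB.mono Set.inter_subset_left Set.inter_subset_left, fun i hi hiM hiβ hne => ?_,
      le_rfl, sA ha, sB hb, hx, hy, hxy, ?_, hax, hlxy, hyb, ?_⟩
    · obtain ⟨a1, a2, a3, a4, a5, a6⟩ := hlen i hi hiM hiβ hne
      have h1 := (hrk i (by omega)).ten_le (by omega)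
        (hbβ.1.trans_lt (hmono β i a2 hi))
      have h2 := (hstub' _ a3).1
      have h3 := (hrk (M i) (by omega)).bounds h5
      exact ⟨disjoint_secondSeg hr h5 (by omega), (disjoint_secondSeg hr h5 (by omega)).symm⟩
    · have hq2 : q ∈ secondSeg r 8 (max 9 (t' β)) := ⟨_, hq, by omega, by omega⟩
      refine ((linked_union_left (linked_union_left hls)).trans (Linked.of_adj hadj
        (Or.inl (Or.inl hs)) (Or.inl (Or.inr hq2)))).trans
        (Linked.trans (q := (4, 4)) ?_ (hlA.mono sA))
      refine Linked.mono (S := secondSeg r 8 (max 9 (t' β)))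
        (fun z hz => Or.inl (Or.inr hz)) ?_
      rcases le_total 9 (t' β) with h | h
      · rw [max_eq_right h]
        exact (linked_secondSeg hr h5 (by omega) h h44 hq).symm.mono
          (secondSeg_mono (by omega) (by omega))
      · rw [max_eq_left h]
        exact (linked_secondSeg hr h5 (by omega) h hq h44).mono
          (secondSeg_mono (by omega) (by omega))
    · have hq2 : q' ∈ secondSeg r (min tα (8 * r - 20)) (8 * r - 19) :=
        ⟨_, hq', by omega, by omega⟩
      refine (hlB.mono sB).trans (Linked.trans (q := q') ?_ ((Linked.of_adj hadj'.symm
        (Or.inl (Or.inr hq2)) (Or.inl (Or.inl hs'))).trans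
        (linked_union_left (linked_union_left hls'.symm))))
      refine Linked.mono (S := secondSeg r (min tα (8 * r - 20)) (8 * r - 19))
        (fun z hz => Or.inl (Or.inr hz)) ?_
      rcases le_total tα (8 * r - 20) with h | h
      · exact (linked_secondSeg hr h5 (by omega) h hq' h43).symm.mono
          (secondSeg_mono (by omega) (by omega))
      · exact (linked_secondSeg hr h5 (by omega) h h43 hq').mono
          (secondSeg_mono (by omega) (by omega))

/-! ### Concatenating disjoint paths along a single cycle -/

namespace SimpleGraph

variable {V : Type*} {G : SimpleGraph V}

theorem exists_path_of_pairings {n : ℕ} {M E : ℕ → ℕ} (hM : IsPairing n M) (hE : IsPairing n E)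
    (hconn : ∀ C ⊆ Finset.range n, C.Nonempty → (∀ i ∈ C, M i ∈ C) → (∀ i ∈ C, E i ∈ C) →
      C = Finset.range n) {tok : ℕ → V} {a : ℕ} (ha : a < n)
    (hadj : ∀ i < n, i ≠ a → i ≠ E a → G.Adj (tok i) (tok (E i))) {A : ℕ → Set V}
    {F : ℕ → Set (Sym2 V)} (hF : ∀ i < n, F (M i) = F i)
    (hA : ∀ i < n, ∀ j < n, j ≠ i → j ≠ M i → Disjoint (A i) (A j))
    (hw : ∀ i < n, ∃ w : G.Walk (tok i) (tok (M i)), w.IsPath ∧ (∀ v ∈ w.support, v ∈ A i) ∧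
      ∀ e, e ∈ w.edges ↔ e ∈ F i) :
    ∃ P : G.Walk (tok a) (tok (E a)), P.IsPath ∧ (∀ v ∈ P.support, ∃ i < n, v ∈ A i) ∧
      (∀ e ∈ P.edges, (∃ i < n, e ∈ F i) ∨ ∃ i < n, e = s(tok i, tok (E i))) ∧
      (∀ i < n, ∀ e ∈ F i, e ∈ P.edges) ∧
      ∀ i < n, i ≠ a → i ≠ E a → s(tok i, tok (E i)) ∈ P.edges := by
  have main : ∀ m, ∀ C : Finset ℕ, n - C.card = m → ∀ z, ∀ P : G.Walk (tok a) (tok z),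
      C ⊆ Finset.range n → a ∈ C → z ∈ C → z ≠ a → (∀ i ∈ C, M i ∈ C) →
      (∀ i ∈ C, i ≠ a → i ≠ z → E i ∈ C ∧ E i ≠ a ∧ E i ≠ z) → P.IsPath →
      (∀ v ∈ P.support, ∃ i ∈ C, v ∈ A i) →
      (∀ e ∈ P.edges, (∃ i < n, e ∈ F i) ∨ ∃ i < n, e = s(tok i, tok (E i))) →
      (∀ i ∈ C, ∀ e ∈ F i, e ∈ P.edges) →
      (∀ i ∈ C, i ≠ a → i ≠ z → s(tok i, tok (E i)) ∈ P.edges) →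
      ∃ P : G.Walk (tok a) (tok (E a)), P.IsPath ∧ (∀ v ∈ P.support, ∃ i < n, v ∈ A i) ∧
      (∀ e ∈ P.edges, (∃ i < n, e ∈ F i) ∨ ∃ i < n, e = s(tok i, tok (E i))) ∧
      (∀ i < n, ∀ e ∈ F i, e ∈ P.edges) ∧
      ∀ i < n, i ≠ a → i ≠ E a → s(tok i, tok (E i)) ∈ P.edges := by
    intro m
    induction m using Nat.strong_induction_on with
    | _ m ih =>
      intro C hm z P hC haC hzC hza hCM hCE hP hPA hPe hPF hPE
      have hzn : z < n := Finset.mem_range.1 (hC hzC)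
      by_cases hEz : E z ∈ C
      · have hEza : E z = a := by
          by_contra hne
          exact (hCE _ hEz hne (hE.ne z hzn)).2.2 (hE.inv z hzn)
        have hzE : z = E a := by rw [← hEza, hE.inv z hzn]
        have hCn := hconn C hC ⟨a, haC⟩ hCM fun i hi => by
          by_cases hia : i = a
          · rw [hia, ← hzE]; exact hzC
          · by_cases hiz : i = z
            · rw [hiz]; exact hEz
            · exact (hCE i hi hia hiz).1
        have hmem : ∀ i < n, i ∈ C := fun i hi => hCn ▸ Finset.mem_range.2 hi
        subst hzE
        exact ⟨P, hP, fun v hv => (hPA v hv).imp fun i hi => ⟨Finset.mem_range.1 (hC hi.1), hi.2⟩,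
          hPe, fun i hi => hPF i (hmem i hi), fun i hi => hPE i (hmem i hi)⟩
      · set y := E z with hy
        have hyn : y < n := hE.lt z hzn
        have hya : y ≠ a := fun h => hEz (h ▸ haC)
        have hEy : E y = z := hE.inv z hzn
        have hzE : z ≠ E a := fun h => hya (by rw [hy, h, hE.inv a ha])
        have hMyC : M y ∉ C := fun h => hEz (hM.inv y hyn ▸ hCM _ h)
        have hMyn := hM.lt y hyn
        have hMy := hM.ne y hyn
        obtain ⟨w, hwp, hwA, hwF⟩ := hw y hyn
        have hdisj : ∀ v ∈ P.support, v ∉ w.support := by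
          intro v hv hv'
          obtain ⟨i, hi, hvi⟩ := hPA v hv
          refine Set.disjoint_left.1 (hA i (Finset.mem_range.1 (hC hi)) y hyn ?_ ?_) hvi (hwA v hv')
          · exact fun h => hEz (h ▸ hi)
          · exact fun h => hEz (h ▸ hCM i hi)
        have hcard : (insert (M y) (insert y C)).card = C.card + 2 := by
          rw [Finset.card_insert_of_notMem, Finset.card_insert_of_notMem hEz]
          simp [hMy, hMyC]
        have hsub : insert (M y) (insert y C) ⊆ Finset.range n := by
          intro i hi
          simp only [Finset.mem_insert] at hi
          rcases hi with rfl | rfl | hi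
          · exact Finset.mem_range.2 hMyn
          · exact Finset.mem_range.2 hyn
          · exact hC hi
        have hle := Finset.card_le_card hsub
        rw [hcard, Finset.card_range] at hle
        refine ih (n - (C.card + 2)) (by omega) (insert (M y) (insert y C)) (by rw [hcard]) (M y)
          (P.append (.cons (hadj z hzn hza hzE) w)) hsub (by simp [haC]) (by simp)
          (fun h => hMyC (h ▸ haC)) ?_ ?_ ?_ ?_ ?_ ?_ ?_
        · intro i hi
          simp only [Finset.mem_insert] at hi ⊢
          rcases hi with rfl | rfl | hi
          · rw [hM.inv y hyn]; simp
          · simp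
          · exact Or.inr (Or.inr (hCM i hi))
        · intro i hi hia hiy
          simp only [Finset.mem_insert] at hi ⊢
          rcases hi with rfl | rfl | hi
          · exact absurd rfl hiy
          · rw [hEy]
            exact ⟨Or.inr (Or.inr hzC), hza, fun h => hMyC (h ▸ hzC)⟩
          · by_cases hiz : i = z
            · rw [hiz, ← hy]
              exact ⟨Or.inr (Or.inl rfl), hya, hMy.symm⟩
            · obtain ⟨h1, h2, h3⟩ := hCE i hi hia hiz
              exact ⟨Or.inr (Or.inr h1), h2, fun h => hMyC (h ▸ h1)⟩
        · refine hP.append_of_inter (hwp.cons (hdisj _ P.end_mem_support)) fun v hv hv' => ?_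
          rw [Walk.support_cons, List.mem_cons] at hv'
          exact hv'.resolve_right (hdisj v hv)
        · intro v hv
          rw [Walk.mem_support_append_iff, Walk.support_cons, List.mem_cons] at hv
          have hold : v ∈ P.support → ∃ i ∈ insert (M y) (insert y C), v ∈ A i := fun hv => by
            obtain ⟨i, hi, hvi⟩ := hPA v hv
            exact ⟨i, by simp [hi], hvi⟩
          rcases hv with hv | rfl | hv
          · exact hold hv
          · exact hold P.end_mem_support
          · exact ⟨y, by simp, hwA v hv⟩
        · intro e he
          rw [Walk.edges_append, Walk.edges_cons, List.mem_append, List.mem_cons] at he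
          rcases he with he | rfl | he
          · exact hPe e he
          · exact Or.inr ⟨z, hzn, rfl⟩
          · exact Or.inl ⟨y, hyn, (hwF e).1 he⟩
        · intro i hi e he
          rw [Walk.edges_append, Walk.edges_cons, List.mem_append, List.mem_cons]
          simp only [Finset.mem_insert] at hi
          rcases hi with rfl | rfl | hi
          · rw [hF y hyn] at he
            exact Or.inr (Or.inr ((hwF e).2 he))
          · exact Or.inr (Or.inr ((hwF e).2 he))
          · exact Or.inl (hPF i hi e he)
        · intro i hi hia hiy
          rw [Walk.edges_append, Walk.edges_cons, List.mem_append, List.mem_cons]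
          simp only [Finset.mem_insert] at hi
          rcases hi with rfl | rfl | hi
          · exact absurd rfl hiy
          · rw [hEy, Sym2.eq_swap]; exact Or.inr (Or.inl rfl)
          · by_cases hiz : i = z
            · rw [hiz]; exact Or.inr (Or.inl rfl)
            · exact Or.inl (hPE i hi hia hiz)
  obtain ⟨w, hwp, hwA, hwF⟩ := hw a ha
  refine main _ {a, M a} rfl (M a) w ?_ (by simp) (by simp) (hM.ne a ha) ?_ ?_ hwp ?_ ?_ ?_ ?_
  · intro i hi
    simp only [Finset.mem_insert, Finset.mem_singleton] at hi
    rcases hi with rfl | rfl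
    · exact Finset.mem_range.2 ha
    · exact Finset.mem_range.2 (hM.lt a ha)
  · intro i hi
    simp only [Finset.mem_insert, Finset.mem_singleton] at hi ⊢
    rcases hi with rfl | rfl
    · exact Or.inr rfl
    · exact Or.inl (hM.inv a ha)
  · intro i hi h1 h2
    simp only [Finset.mem_insert, Finset.mem_singleton] at hi
    rcases hi with rfl | rfl
    · exact absurd rfl h1
    · exact absurd rfl h2
  · exact fun v hv => ⟨a, by simp, hwA v hv⟩
  · exact fun e he => Or.inl ⟨a, ha, (hwF e).1 he⟩
  · intro i hi e he
    simp only [Finset.mem_insert, Finset.mem_singleton] at hi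
    rcases hi with rfl | rfl
    · exact (hwF e).2 he
    · rw [hF a ha] at he; exact (hwF e).2 he
  · intro i hi h1 h2
    simp only [Finset.mem_insert, Finset.mem_singleton] at hi
    rcases hi with rfl | rfl
    · exact absurd rfl h1
    · exact absurd rfl h2

end SimpleGraph

namespace Wall

open SimpleGraph

variable {V : Type*} {G : SimpleGraph V} {r : ℕ} (W : Wall G r)

theorem perim_subset_compass (i : ℕ) : (W.perim i).verts ⊆ (W.compass i).verts :=
  fun _ h => Or.inr h

theorem nested_subset_compass (i : ℕ) : (W.nested i).verts ⊆ (W.compass i).verts := by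
  intro v hv
  by_cases h : v ∈ (W.perim i).verts
  · exact Or.inr h
  · exact Or.inl ⟨v, hv, .nil, by simpa using h⟩

theorem part_mono {S T : Set (ℕ × ℕ)} (h : S ⊆ T) : (W.part S).verts ⊆ (W.part T).verts := by
  intro v hv
  obtain ⟨p, q, hpq, hp, hq, hv⟩ := W.mem_part_verts.1 hv
  exact W.mem_part_verts.2 ⟨p, q, hpq, h hp, h hq, hv⟩

theorem hull_subset_compass {S : Set (ℕ × ℕ)} (hS : S ⊆ wallVerts r 1) :
    W.hull S ⊆ (W.compass 1).verts := by
  have hr := W.odd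
  have h3 := W.three_le
  refine (W.hull_mono hS).trans ((W.hull_subset_part ?_).trans (W.nested_subset_compass 1))
  rintro ⟨x, y⟩ h
  have h' := (wallVerts_one hr h3).1 h
  by_cases hx : (x + 1, y) ∈ wallVerts r 1
  · exact ⟨_, hx, elementaryWall_adj_right h hx⟩
  · have hx' : (x - 1 + 1, y) ∈ wallVerts r 1 := by
      rw [wallVerts_one hr h3] at hx ⊢; omega
    have hx'' : (x - 1, y) ∈ wallVerts r 1 := by
      rw [wallVerts_one hr h3] at hx ⊢; omega
    have e := elementaryWall_adj_right hx'' hx'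
    rw [Nat.sub_add_cancel (by omega)] at e
    exact ⟨_, hx'', e.symm⟩

/-- A path from the outside to the `i`-th layer, along that layer, and back to the outside. -/
theorem exists_deep_path (D : PlaneDrawing G) {i : ℕ} (hi : 2 ≤ i) (hir : 2 * i + 1 ≤ r)
    {SA SQ SB : Set (ℕ × ℕ)} {p a x y b q : ℕ × ℕ} (hSA : SA ⊆ outerVerts r i)
    (hSB : SB ⊆ outerVerts r i) (hSQ : SQ ⊆ layerVerts r i) (hAB : Disjoint SA SB) (hp : p ∈ SA)
    (ha : a ∈ SA) (hb : b ∈ SB) (hx : x ∈ SQ) (hy : y ∈ SQ) (hxy : x ≠ y)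
    (hpa : Linked r SA p a) (hax : (elementaryWall r).Adj a x) (hlxy : Linked r SQ x y)
    (hyb : (elementaryWall r).Adj y b) (hbq : Linked r SB b q) :
    ∃ (w : G.Walk (W.branch p) (W.branch q)) (Q : G.Walk (W.branch x) (W.branch y)), w.IsPath ∧
      Q.IsPath ∧ W.branch x ≠ W.branch y ∧ (∀ v ∈ w.support, v ∈ W.hull (SA ∪ SQ ∪ SB)) ∧
      Q.toSubgraph ≤ W.perim i ∧ (∀ e ∈ Q.edges, e ∈ w.edges) ∧
      ∀ e ∈ w.edges, e ∉ Q.edges → ∀ v ∈ e, v ∈ (W.compass i).verts →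
        (v = W.branch x ∨ v = W.branch y) ∧ ∃ v' ∈ e, v' ∉ (W.compass i).verts := by
  have hr := W.odd
  have hi1 : 1 ≤ i := by omega
  have hL := layerVerts_subset_one hr hi1 hir
  have hO : outerVerts r i ⊆ wallVerts r 1 := Set.sdiff_subset
  have hOL : ∀ z ∈ outerVerts r i, z ∉ layerVerts r i := fun z h h' => h.2 h'.1
  have hSA1 := hSA.trans hO
  have hSB1 := hSB.trans hO
  have hSQ1 := hSQ.trans hL
  have hSAQ : ∀ z ∈ SA, z ∉ SQ := fun z h h' => hOL z (hSA h) (hSQ h')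
  have hSBQ : ∀ z ∈ SB, z ∉ SQ := fun z h h' => hOL z (hSB h) (hSQ h')
  have hSAB : ∀ z ∈ SA, z ∉ SB := fun z hz => Set.disjoint_left.1 hAB hz
  have hne : W.branch x ≠ W.branch y := fun h => hxy (W.branch_injOn (hSQ1 hx) (hSQ1 hy) h)
  have pair : ∀ {p q : ℕ × ℕ}, p ∈ wallVerts r 1 → q ∈ wallVerts r 1 →
      ({p, q} : Set (ℕ × ℕ)) ⊆ wallVerts r 1 := by
    rintro p q hp hq z (rfl | rfl) <;> assumption
  have hax1 := pair hax.1 hax.2.1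
  have hyb1 := pair hyb.1 hyb.2.1
  obtain ⟨wA, pA, hwA, -⟩ := W.exists_path hp hpa
  obtain ⟨wB, pB, hwB, -⟩ := W.exists_path hb hbq
  obtain ⟨Q, pQ, hwQ, hQe, hQv⟩ := W.exists_path hx hlxy
  have hwax : ∀ v ∈ (W.seg a x hax).support, v ∈ W.hull {a, x} := fun v hv =>
    W.seg_mem_hull hax (by simp) (by simp) hv
  have hwyb : ∀ v ∈ (W.seg y b hyb).support, v ∈ W.hull {y, b} := fun v hv =>
    W.seg_mem_hull hyb (by simp) (by simp) hv
  have meet : ∀ {S T : Set (ℕ × ℕ)} (c : ℕ × ℕ), S ⊆ wallVerts r 1 → T ⊆ wallVerts r 1 →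
      (∀ z ∈ S, z ∈ T → z = c) → ∀ v ∈ W.hull S, v ∈ W.hull T → v = W.branch c :=
    fun c hS hT h v hv hv' => W.eq_branch_of_mem_hull hS hT (fun z hz => h z hz.1 hz.2) hv hv'
  have away : ∀ {S T : Set (ℕ × ℕ)}, S ⊆ wallVerts r 1 → T ⊆ wallVerts r 1 →
      (∀ z ∈ S, z ∉ T) → ∀ v ∈ W.hull S, v ∉ W.hull T :=
    fun hS hT h v hv hv' => Set.disjoint_left.1 (W.disjoint_hull hS hT
      (Set.disjoint_left.2 h)) hv hv'
  have p1 : ((W.seg y b hyb).append wB).IsPath :=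
    (W.seg_isPath y b hyb).append_of_inter pB fun v hv hv' =>
      meet b hyb1 hSB1 (by
        rintro z (rfl | rfl) h
        · exact absurd hy (hSBQ _ h)
        · rfl) v (hwyb v hv) (hwB v hv')
  have p2 : (Q.append ((W.seg y b hyb).append wB)).IsPath :=
    pQ.append_of_inter p1 fun v hv hv' => by
      rcases (Walk.mem_support_append_iff _ _).1 hv' with hv' | hv'
      · refine meet y hSQ1 hyb1 ?_ v (hwQ v hv) (hwyb v hv')
        rintro z h (rfl | rfl)
        · rfl
        · exact absurd h (hSBQ _ hb)
      · exact absurd (hwB v hv') (away hSQ1 hSB1 (fun z h h' => hSBQ z h' h) v (hwQ v hv))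
  have p3 : ((W.seg a x hax).append (Q.append ((W.seg y b hyb).append wB))).IsPath :=
    (W.seg_isPath a x hax).append_of_inter p2 fun v hv hv' => by
      rcases (Walk.mem_support_append_iff _ _).1 hv' with hv' | hv'
      · refine meet x hax1 hSQ1 ?_ v (hwax v hv) (hwQ v hv')
        rintro z (rfl | rfl) h
        · exact absurd h (hSAQ _ ha)
        · rfl
      · exfalso
        rcases (Walk.mem_support_append_iff _ _).1 hv' with hv' | hv'
        · refine away hax1 hyb1 ?_ v (hwax v hv) (hwyb v hv')
          rintro z (rfl | rfl) (h | h)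
          · exact hSAQ _ ha (h ▸ hy)
          · exact hSAB _ ha (h ▸ hb)
          · exact hxy h
          · exact hSBQ _ hb (h ▸ hx)
        · refine away hax1 hSB1 ?_ v (hwax v hv) (hwB v hv')
          rintro z (rfl | rfl)
          · exact hSAB _ ha
          · exact fun h => hSBQ _ h hx
  have p4 : (wA.append ((W.seg a x hax).append (Q.append ((W.seg y b hyb).append wB)))).IsPath :=
    pA.append_of_inter p3 fun v hv hv' => by
      rcases (Walk.mem_support_append_iff _ _).1 hv' with hv' | hv'
      · refine meet a hSA1 hax1 ?_ v (hwA v hv) (hwax v hv')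
        rintro z h (rfl | rfl)
        · rfl
        · exact absurd hx (hSAQ _ h)
      · exfalso
        rcases (Walk.mem_support_append_iff _ _).1 hv' with hv' | hv'
        · exact away hSA1 hSQ1 hSAQ v (hwA v hv) (hwQ v hv')
        · rcases (Walk.mem_support_append_iff _ _).1 hv' with hv' | hv'
          · refine away hSA1 hyb1 ?_ v (hwA v hv) (hwyb v hv')
            rintro z h (rfl | rfl)
            · exact hSAQ _ h hy
            · exact hSAB _ h hb
          · exact away hSA1 hSB1 hSAB v (hwA v hv) (hwB v hv')
  refine ⟨_, Q, p4, pQ, hne, fun v hv => ?_, ⟨fun v hv => ?_, fun u v huv => ?_⟩, fun e he => ?_,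
    fun e he heQ v hv hvc => ?_⟩
  · simp only [Walk.mem_support_append_iff] at hv
    have sub : ∀ c d (h : (elementaryWall r).Adj c d), c ∈ SA ∪ SQ ∪ SB → d ∈ SA ∪ SQ ∪ SB →
        v ∈ (W.seg c d h).support → v ∈ W.hull (SA ∪ SQ ∪ SB) := fun c d h h1 h2 h3 =>
      W.seg_mem_hull h h1 h2 h3
    rcases hv with hv | hv | hv | hv | hv
    · exact W.hull_mono (fun z hz => Or.inl (Or.inl hz)) (hwA v hv)
    · exact sub a x hax (Or.inl (Or.inl ha)) (Or.inl (Or.inr hx)) hv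
    · exact W.hull_mono (fun z hz => Or.inl (Or.inr hz)) (hwQ v hv)
    · exact sub y b hyb (Or.inl (Or.inr hy)) (Or.inr hb) hv
    · exact W.hull_mono (fun z hz => Or.inr hz) (hwB v hv)
  · exact W.part_mono hSQ (hQv hne v (Q.mem_verts_toSubgraph.1 hv))
  · rw [Walk.adj_toSubgraph_iff_mem_edges] at huv
    obtain ⟨c, d, hcd, hc, hd, h⟩ := W.part_adj.1 (hQe _ huv)
    exact W.part_adj.2 ⟨c, d, hcd, hSQ hc, hSQ hd, h⟩
  · simp only [Walk.edges_append, List.mem_append]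
    exact Or.inr (Or.inr (Or.inl he))
  · simp only [Walk.edges_append, List.mem_append] at he
    have hmem : ∀ {u u' : V} (w : G.Walk u u'), e ∈ w.edges → ∀ z ∈ e, z ∈ w.support :=
      fun w he z hz => Walk.mem_support_of_mem_edges he hz
    have hnA : ∀ {S : Set (ℕ × ℕ)}, S ⊆ outerVerts r i → v ∉ W.hull S := fun hS h =>
      W.notMem_compass_of_mem_hull D hi hir (W.hull_mono hS h) hvc
    have key : ∀ c d (h : (elementaryWall r).Adj c d), c ∈ outerVerts r i →
        e ∈ (W.seg c d h).edges →
        v = W.branch d ∧ ∃ v' ∈ e, v' ∉ (W.compass i).verts := by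
      intro c d h hc he'
      have h1 : v = W.branch d := by
        by_contra h1
        exact W.notMem_compass_of_mem_seg D hi hir h hc (hmem _ he' v hv) h1 hvc
      obtain ⟨v', rfl⟩ := Sym2.mem_iff_exists.1 hv
      refine ⟨h1, v', by simp, W.notMem_compass_of_mem_seg D hi hir h hc
        (hmem _ he' v' (by simp)) fun h2 => ?_⟩
      exact (Walk.adj_of_mem_edges _ he').ne (h1.trans h2.symm)
    rcases he with he | he | he | he | he
    · exact absurd (hwA v (hmem _ he v hv)) (hnA hSA)
    · obtain ⟨h1, h2⟩ := key a x hax (hSA ha) he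
      exact ⟨Or.inl h1, h2⟩
    · exact absurd he heQ
    · have he' : e ∈ (W.seg b y hyb.symm).edges := by
        rw [W.seg_symm y b hyb, Walk.edges_reverse, List.mem_reverse]; exact he
      obtain ⟨h1, h2⟩ := key b y hyb.symm (hSB hb) he'
      exact ⟨Or.inr h1, h2⟩
    · exact absurd (hwB v (hmem _ he v hv)) (hnA hSB)

theorem exists_extension {i : ℕ} {s t a b x y : V} (hst : s ≠ t) (hs : s ∉ (W.compass i).verts)
    (ht : t ∉ (W.compass i).verts) {P : G.Walk a b} {Q : G.Walk x y} (hP : P.IsPath)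
    (hxy : x ≠ y) (has : G.Adj a s) (hbt : G.Adj b t) (hsP : s ∉ P.support) (htP : t ∉ P.support)
    (hQ : Q.toSubgraph ≤ W.perim i) (hQP : ∀ e ∈ Q.edges, e ∈ P.edges)
    (hPQ : ∀ e ∈ P.edges, e ∉ Q.edges → ∀ v ∈ e, v ∈ (W.compass i).verts →
      v ∈ Q.support ∧ ∃ v' ∈ e, v' ∉ (W.compass i).verts) :
    ∃ P' : G.Walk s t, P'.IsPath ∧ (∀ e ∈ P.edges, e ∈ P'.edges) ∧ s(a, s) ∈ P'.edges ∧
      s(b, t) ∈ P'.edges ∧ P'.toSubgraph ⊓ W.compass i = Q.toSubgraph := by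
  have hedges : ∀ v ∈ Q.support, ∃ e ∈ Q.edges, v ∈ e := fun v hv =>
    (Walk.mem_support_iff_exists_mem_edges_of_not_nil (fun h => hxy h.eq)).1 hv
  have hQc : ∀ v ∈ Q.support, v ∈ (W.compass i).verts := fun v hv =>
    W.perim_subset_compass i (hQ.1 (Q.mem_verts_toSubgraph.2 hv))
  have hab : a ≠ b := by
    rintro rfl
    have := Walk.isPath_iff_nil.1 hP
    obtain ⟨e, he, -⟩ := hedges x Q.start_mem_support
    have he' := hQP e he
    rw [this.eq_nil] at he'
    simp at he'
  refine ⟨.cons has.symm (P.append (.cons hbt .nil)), ?_, fun e he => ?_, ?_, ?_, ?_⟩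
  · refine Walk.IsPath.cons (hP.append_of_inter (by simp [hbt.ne]) fun v hv hv' => ?_) ?_
    · simp only [Walk.support_cons, Walk.support_nil, List.mem_cons, List.not_mem_nil,
        or_false] at hv'
      exact hv'.resolve_right fun h => htP (h ▸ hv)
    · rw [Walk.mem_support_append_iff]
      simp only [Walk.support_cons, Walk.support_nil, List.mem_cons, List.not_mem_nil, or_false]
      rintro (h | h | h)
      · exact hsP h
      · exact hsP (h ▸ P.end_mem_support)
      · exact hst h
  · simp [he]
  · rw [Sym2.eq_swap]; simp
  · simp
  · have hV : ∀ v ∈ P.support, v ∈ (W.compass i).verts → v ∈ Q.support := by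
      intro v hv hvc
      obtain ⟨e, he, hve⟩ := (Walk.mem_support_iff_exists_mem_edges_of_not_nil
        (fun h => hab h.eq)).1 hv
      by_cases heQ : e ∈ Q.edges
      · exact Walk.mem_support_of_mem_edges heQ hve
      · exact (hPQ e he heQ v hve hvc).1
    ext u v
    · simp only [Subgraph.verts_inf, Set.mem_inter_iff, Walk.mem_verts_toSubgraph,
        Walk.support_cons, Walk.support_nil, List.mem_cons, Walk.mem_support_append_iff,
        List.not_mem_nil, or_false]
      constructor
      · rintro ⟨rfl | h | rfl | rfl, hc⟩
        · exact absurd hc hs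
        · exact hV u h hc
        · exact hV _ P.end_mem_support hc
        · exact absurd hc ht
      · intro h
        obtain ⟨e, he, hue⟩ := hedges u h
        exact ⟨Or.inr (Or.inl (Walk.mem_support_of_mem_edges (hQP e he) hue)), hQc u h⟩
    · rw [Subgraph.inf_adj, Walk.adj_toSubgraph_iff_mem_edges, Walk.adj_toSubgraph_iff_mem_edges]
      simp only [Walk.edges_cons, Walk.edges_append, Walk.edges_nil, List.mem_cons,
        List.mem_append, List.not_mem_nil, or_false]
      constructor
      · rintro ⟨h, hc⟩
        have hu : u ∈ (W.compass i).verts := hc.1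
        have hv : v ∈ (W.compass i).verts := hc.2.1
        rcases h with h | h | h
        · rcases Sym2.eq_iff.1 h with ⟨rfl, rfl⟩ | ⟨rfl, rfl⟩
          · exact absurd hu hs
          · exact absurd hv hs
        · by_contra hQ'
          obtain ⟨-, v', hv', hvc⟩ := hPQ _ h hQ' u (by simp) hu
          rcases Sym2.mem_iff.1 hv' with rfl | rfl
          · exact hvc hu
          · exact hvc hv
        · rcases Sym2.eq_iff.1 h with ⟨rfl, rfl⟩ | ⟨rfl, rfl⟩
          · exact absurd hv ht
          · exact absurd hu ht
      · intro h
        exact ⟨Or.inr (Or.inl (hQP _ h)), hQc u (Walk.fst_mem_support_of_mem_edges _ h),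
          hQc v (Walk.snd_mem_support_of_mem_edges _ h), Walk.adj_of_mem_edges _ h⟩

end Wall

theorem exists_equiv_strictMono {ι : Type*} [Fintype ι] {n : ℕ} (hn : Fintype.card ι = n)
    {f : ι → ℕ} (hf : Function.Injective f) : ∃ e : Fin n ≃ ι, StrictMono (f ∘ e) := by
  let _ : LinearOrder ι := LinearOrder.lift' f hf
  exact ⟨(monoEquivOfFin ι hn).toEquiv, fun i j h => (monoEquivOfFin ι hn).strictMono h⟩

namespace Wall

open SimpleGraph

variable {V : Type*} {G : SimpleGraph V} {r : ℕ} (W : Wall G r)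

theorem notMem_compass_of_adj (D : PlaneDrawing G) {i : ℕ} (hi : 2 ≤ i) (hir : 2 * i + 1 ≤ r)
    {p : ℕ × ℕ} (hp : p ∈ outerVerts r i) {s : V} (h : G.Adj (W.branch p) s)
    (hs : s ∉ (W.compass 1).verts) : s ∉ (W.compass i).verts := by
  have hi1 : 1 ≤ i := by omega
  have hL := layerVerts_subset_one W.odd hi1 hir
  refine W.notMem_compass D hi hir hp (.cons h .nil) fun z hz => ?_
  rw [← W.hull_layerVerts hi1 hir]
  simp only [Walk.support_cons, Walk.support_nil, List.mem_cons, List.not_mem_nil, or_false] at hz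
  rcases hz with rfl | rfl
  · rw [W.branch_mem_hull_iff hL hp.1]
    exact fun h => hp.2 h.1
  · exact fun h => hs (W.hull_subset_compass hL h)

/-- The case `k ≥ 1`, with the pegs `p 0, …, p (n - 1)` in the order of the perimeter and the edges
given by the pairing `E`, which also pairs the pegs `a` and `E a` at `s` and `t`. -/
theorem exists_path_through (D : PlaneDrawing G) {k n : ℕ} (hk : 1 ≤ k) (hkr : 2 * k + 3 ≤ r)
    (hn : n = 2 * k + 2) {p : ℕ → ℕ × ℕ} (hpeg : ∀ i < n, IsPeg r (p i)) {t : ℕ → ℕ}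
    (hon : ∀ i < n, OnFirst r (p i).1 (p i).2 (t i)) (hmono : ∀ i j, i < j → j < n → t i < t j)
    {E : ℕ → ℕ} (hE : IsPairing n E) {a : ℕ} (ha : a < n)
    (hadj : ∀ i < n, i ≠ a → i ≠ E a → G.Adj (W.branch (p i)) (W.branch (p (E i))))
    {s s' : V} (hss' : s ≠ s') (hs : s ∉ (W.compass 1).verts) (hs' : s' ∉ (W.compass 1).verts)
    (has : G.Adj (W.branch (p a)) s) (has' : G.Adj (W.branch (p (E a))) s') :
    ∃ P : G.Walk s s', P.IsPath ∧
      (∀ i < n, i ≠ a → i ≠ E a → s(W.branch (p i), W.branch (p (E i))) ∈ P.edges) ∧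
      s(W.branch (p a), s) ∈ P.edges ∧ s(W.branch (p (E a)), s') ∈ P.edges ∧
      ∃ (x y : V) (Q : G.Walk x y), Q.IsPath ∧ x ≠ y ∧
        x ∈ W.branchVerts ∧ y ∈ W.branchVerts ∧
        Q.toSubgraph ≤ W.perim (k + 1) ∧
        P.toSubgraph ⊓ W.compass (k + 1) = Q.toSubgraph := by
  have hr := W.odd
  have hi : 2 ≤ k + 1 := by omega
  have hir : 2 * (k + 1) + 1 ≤ r := by omega
  obtain ⟨M, β, S, SA, SQ, SB, c, x, y, d, hM, hconn, hβ, hS, hSA, hSB, hSQ, hAB, hp, hc, hd, hqB,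
    hx, hy, hxy, hlc, hcx, hlxy, hyd, hld⟩ :=
    exists_linkage hr hk hkr hn hpeg hon hmono hE
  have hMβ := hM.lt β hβ
  have hMM := hM.inv β hβ
  have hL := layerVerts_subset_one hr (show 1 ≤ k + 1 by omega) hir
  have hO : outerVerts r (k + 1) ⊆ wallVerts r 1 := Set.sdiff_subset
  have hpout : ∀ i < n, p i ∈ outerVerts r (k + 1) := fun i hi' =>
    layerVerts_subset_outerVerts hr le_rfl (by omega) hir ((hpeg i hi').mem_layerVerts hr (by omega))
  obtain ⟨w, Q, hwp, hQp, hne, hwh, hQP, hQw, hwQ⟩ :=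
    W.exists_deep_path D hi hir hSA hSB hSQ hAB hp hc hd hx hy hxy hlc hcx hlxy hyd hld
  have hSO : ∀ i < n, i ≠ β → i ≠ M β → S i ⊆ outerVerts r (k + 1) := fun i h1 h2 h3 =>
    (hS i h1 h2 h3).2.1
  have hD1 : SA ∪ SQ ∪ SB ⊆ wallVerts r 1 :=
    Set.union_subset (Set.union_subset (hSA.trans hO) (hSQ.trans hL)) (hSB.trans hO)
  have hother : ∀ i, ∃ F : Set (Sym2 V), i < n → i ≠ β → i ≠ M β →
      (∃ w : G.Walk (W.branch (p i)) (W.branch (p (M i))), w.IsPath ∧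
        (∀ v ∈ w.support, v ∈ W.hull (S i)) ∧ ∀ e, e ∈ w.edges ↔ e ∈ F) ∧
      ∀ e ∈ F, ∀ v ∈ e, v ∈ W.hull (S i) := by
    intro i
    by_cases h : i < n ∧ i ≠ β ∧ i ≠ M β
    · obtain ⟨-, -, h3, h4, -⟩ := hS i h.1 h.2.1 h.2.2
      obtain ⟨w, h5, h6, -⟩ := W.exists_path h3 h4
      exact ⟨{e | e ∈ w.edges}, fun _ _ _ => ⟨⟨w, h5, h6, fun _ => Iff.rfl⟩,
        fun e he v hv => h6 v (Walk.mem_support_of_mem_edges he hv)⟩⟩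
    · exact ⟨∅, fun h1 h2 h3 => absurd ⟨h1, h2, h3⟩ h⟩
  choose F₀ hF₀ using hother
  obtain ⟨F, hFd, hFo⟩ : ∃ F : ℕ → Set (Sym2 V),
      (∀ i, i = β ∨ i = M β → F i = {e | e ∈ w.edges}) ∧
      (∀ i, ¬ (i = β ∨ i = M β) → F i = F₀ (min i (M i))) :=
    ⟨fun i => if i = β ∨ i = M β then {e | e ∈ w.edges} else F₀ (min i (M i)),
      fun i h => if_pos h, fun i h => if_neg h⟩
  obtain ⟨A, hAd, hAo⟩ : ∃ A : ℕ → Set V,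
      (∀ i, i = β ∨ i = M β → A i = W.hull (SA ∪ SQ ∪ SB)) ∧
      (∀ i, ¬ (i = β ∨ i = M β) → A i = W.hull (S i)) :=
    ⟨fun i => if i = β ∨ i = M β then W.hull (SA ∪ SQ ∪ SB) else W.hull (S i),
      fun i h => if_pos h, fun i h => if_neg h⟩
  have hMdeep : ∀ i < n, (M i = β ∨ M i = M β) ↔ (i = β ∨ i = M β) := by
    intro i hi'
    constructor
    · rintro (h | h)
      · exact Or.inr (by rw [← h, hM.inv i hi'])
      · exact Or.inl (hM.inj hi' hβ h)
    · rintro (h | h)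
      · exact Or.inr (by rw [h])
      · exact Or.inl (by rw [h, hMM])
  have hmin : ∀ i < n, ¬ (i = β ∨ i = M β) → min i (M i) < n ∧ min i (M i) ≠ β ∧
      min i (M i) ≠ M β ∧ S (min i (M i)) = S i := by
    intro i hi' h
    have h' := (hMdeep i hi').not.2 h
    push Not at h h'
    rcases le_total i (M i) with hle | hle
    · rw [min_eq_left hle]; exact ⟨hi', h.1, h.2, rfl⟩
    · rw [min_eq_right hle]; exact ⟨hM.lt i hi', h'.1, h'.2, (hS i hi' h.1 h.2).1⟩
  have hFv : ∀ i < n, ¬ (i = β ∨ i = M β) → ∀ e ∈ F i, ∀ v ∈ e, v ∉ (W.compass (k + 1)).verts := by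
    intro i hi' h e he v hv
    obtain ⟨m1, m2, m3, m4⟩ := hmin i hi' h
    rw [hFo i h] at he
    have := (hF₀ _ m1 m2 m3).2 e he v hv
    exact W.notMem_compass_of_mem_hull D hi hir (W.hull_mono (hSO _ m1 m2 m3) this)
  have hA : ∀ i < n, ∀ j < n, j ≠ i → j ≠ M i → Disjoint (A i) (A j) := by
    have key : ∀ i < n, ∀ j, ¬ (i = β ∨ i = M β) → (j = β ∨ j = M β) →
        Disjoint (A i) (A j) := by
      intro i hi' j h h'
      rw [hAo i h, hAd j h']
      push Not at h
      obtain ⟨-, h1, -, -, h2, h3, -⟩ := hS i hi' h.1 h.2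
      refine W.disjoint_hull (h1.trans hO) hD1 (Set.disjoint_union_right.2
        ⟨Set.disjoint_union_right.2 ⟨h2, ?_⟩, h3⟩)
      exact Set.disjoint_left.2 fun z hz hz' => (h1 hz).2 (hSQ hz').1
    intro i hi' j hj h1 h2
    by_cases hid : i = β ∨ i = M β <;> by_cases hjd : j = β ∨ j = M β
    · exfalso
      rcases hid with rfl | rfl <;> rcases hjd with rfl | rfl
      · exact h1 rfl
      · exact h2 rfl
      · exact h2 hMM.symm
      · exact h1 rfl
    · exact (key j hj i hjd hid).symm
    · exact key i hi' j hid hjd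
    · rw [hAo i hid, hAo j hjd]
      push Not at hid hjd
      obtain ⟨-, h3, -, -, -, -, h4⟩ := hS i hi' hid.1 hid.2
      exact W.disjoint_hull (h3.trans hO) ((hSO j hj hjd.1 hjd.2).trans hO)
        (h4 j hj hjd.1 hjd.2 h1 h2)
  have hF : ∀ i < n, F (M i) = F i := by
    intro i hi'
    by_cases h : i = β ∨ i = M β
    · rw [hFd i h, hFd _ ((hMdeep i hi').2 h)]
    · rw [hFo i h, hFo _ ((hMdeep i hi').not.2 h), hM.inv i hi', min_comm]
  have hw : ∀ i < n, ∃ w : G.Walk (W.branch (p i)) (W.branch (p (M i))), w.IsPath ∧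
      (∀ v ∈ w.support, v ∈ A i) ∧ ∀ e, e ∈ w.edges ↔ e ∈ F i := by
    intro i hi'
    by_cases h : i = β ∨ i = M β
    · rw [hFd i h, hAd i h]
      rcases h with rfl | rfl
      · exact ⟨w, hwp, hwh, fun _ => Iff.rfl⟩
      · rw [hMM]
        exact ⟨w.reverse, hwp.reverse, fun v hv => hwh v (by simpa using hv), fun e => by simp⟩
    · rw [hFo i h, hAo i h]
      obtain ⟨m1, m2, m3, m4⟩ := hmin i hi' h
      obtain ⟨w', h1, h2, h3⟩ := (hF₀ _ m1 m2 m3).1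
      rw [m4] at h2
      generalize F₀ (min i (M i)) = F' at h3 ⊢
      revert w'
      rcases le_total i (M i) with hle | hle
      · rw [min_eq_left hle]
        exact fun w' h1 h2 h3 => ⟨w', h1, h2, h3⟩
      · rw [min_eq_right hle, hM.inv i hi']
        exact fun w' h1 h2 h3 => ⟨w'.reverse, h1.reverse, fun v hv => h2 v (by simpa using hv),
          fun e => by simpa using h3 e⟩
  obtain ⟨P, hP, hPA, hPe, hPF, hPE⟩ := exists_path_of_pairings hM hE hconn ha hadj hF hA hw
  have hPc : ∀ v ∈ P.support, v ∈ (W.compass 1).verts := by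
    intro v hv
    obtain ⟨i, hi', hvi⟩ := hPA v hv
    by_cases h : i = β ∨ i = M β
    · rw [hAd i h] at hvi
      exact W.hull_subset_compass hD1 hvi
    · rw [hAo i h] at hvi
      push Not at h
      exact W.hull_subset_compass ((hSO i hi' h.1 h.2).trans hO) hvi
  have hEa := hE.lt a ha
  obtain ⟨P', h1, h2, h3, h4, h5⟩ := W.exists_extension (i := k + 1) hss'
    (W.notMem_compass_of_adj D hi hir (hpout a ha) has hs)
    (W.notMem_compass_of_adj D hi hir (hpout _ hEa) has' hs') hP hne has has'
    (fun h => hs (hPc s h)) (fun h => hs' (hPc s' h)) hQP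
    (fun e he => hPF β hβ e (by rw [hFd β (Or.inl rfl)]; exact hQw e he)) (by
      intro e he heQ v hv hvc
      rcases hPe e he with ⟨i, hi', hei⟩ | ⟨i, hi', rfl⟩
      · by_cases h : i = β ∨ i = M β
        · rw [hFd i h] at hei
          obtain ⟨h1, h2⟩ := hwQ e hei heQ v hv hvc
          refine ⟨?_, h2⟩
          rcases h1 with rfl | rfl
          · exact Q.start_mem_support
          · exact Q.end_mem_support
        · exact absurd hvc (hFv i hi' h e hei v hv)
      · exfalso
        have key : ∀ j < n, W.branch (p j) ∉ (W.compass (k + 1)).verts := fun j hj =>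
          W.notMem_compass_of_mem_hull D hi hir (W.branch_mem_hull (hpout j hj))
        rcases Sym2.mem_iff.1 hv with rfl | rfl
        · exact key i hi' hvc
        · exact key _ (hE.lt i hi') hvc)
  exact ⟨P', h1, fun i hi' hia hiE => h2 _ (hPE i hi' hia hiE), h3, h4, _, _, Q, hQp, hne,
    ⟨x, hL (hSQ hx), rfl⟩, ⟨y, hL (hSQ hy), rfl⟩, hQP, h5⟩

/-- The case `k = 0`. -/
theorem exists_path_along {s s' : V} {p p' : ℕ × ℕ} (hss' : s ≠ s')
    (hs : s ∉ (W.compass 1).verts) (hs' : s' ∉ (W.compass 1).verts) (hp : p ∈ layerVerts r 1)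
    (hp' : p' ∈ layerVerts r 1) (hpp' : p ≠ p') (has : G.Adj (W.branch p) s)
    (has' : G.Adj (W.branch p') s') :
    ∃ P : G.Walk s s', P.IsPath ∧
      s(W.branch p, s) ∈ P.edges ∧ s(W.branch p', s') ∈ P.edges ∧
      ∃ (x y : V) (Q : G.Walk x y), Q.IsPath ∧ x ≠ y ∧
        x ∈ W.branchVerts ∧ y ∈ W.branchVerts ∧
        Q.toSubgraph ≤ W.perim 1 ∧ P.toSubgraph ⊓ W.compass 1 = Q.toSubgraph := by
  obtain ⟨Q, h1, h2, h3, h4⟩ := W.exists_path hp (linked_layerVerts_one W.odd W.three_le hp hp')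
  have hne : W.branch p ≠ W.branch p' := fun h => hpp' (W.branch_injOn hp.1 hp'.1 h)
  have hQP : Q.toSubgraph ≤ W.perim 1 := by
    refine ⟨fun v hv => h4 hne v (Q.mem_verts_toSubgraph.1 hv), fun u v huv => ?_⟩
    rw [Walk.adj_toSubgraph_iff_mem_edges] at huv
    exact h3 _ huv
  have hQc : ∀ v ∈ Q.support, v ∈ (W.compass 1).verts := fun v hv =>
    W.perim_subset_compass 1 (h4 hne v hv)
  obtain ⟨P, g1, g2, g3, g4, g5⟩ := W.exists_extension (P := Q) (Q := Q) hss' hs hs' h1 hne has has'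
    (fun h => hs (hQc s h)) (fun h => hs' (hQc s' h)) hQP (fun _ h => h)
    (fun e he he' => absurd he he')
  exact ⟨P, g1, g3, g4, _, _, Q, h1, hne, ⟨p, hp.1, rfl⟩, ⟨p', hp'.1, rfl⟩, hQP, g5⟩

end Wall

/-- The pairing of the ends of the edges `eᵢ`, and of the two ends `vs` and `vt`. -/
def edgePairing (k : ℕ) : Fin 2 ⊕ (Fin k ⊕ Fin k) → Fin 2 ⊕ (Fin k ⊕ Fin k) :=
  Sum.elim (fun i => Sum.inl (1 - i))
    (Sum.elim (fun i => Sum.inr (Sum.inr i)) (fun i => Sum.inr (Sum.inl i)))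

/-- `v i`, `u i` are the ends of the edge `eᵢ` for `i ≤ k`, and `vs`, `vt` are the ends in `X` of
the two edges at `s` and `t`. The `k + 2` edges have no end in common. -/
theorem lemma3p1 {V : Type*} [Finite V] (G : SimpleGraph V) (hG : IsPlanar G)
    (k r : ℕ) (hr : 2 * k + 3 ≤ r) (W : Wall G r)
    (s t : V) (hst : s ≠ t) (hs : s ∉ (W.compass 1).verts) (ht : t ∉ (W.compass 1).verts)
    (v u : Fin k → V) (vs vt : V)
    (hinj : Function.Injective (Sum.elim ![vs, vt] (Sum.elim v u)))
    (he : ∀ i, G.Adj (v i) (u i)) (hes : G.Adj vs s) (het : G.Adj vt t)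
    (hv : ∀ i, W.IsInPeg (v i)) (hu : ∀ i, W.IsInPeg (u i))
    (hvs : W.IsInPeg vs) (hvt : W.IsInPeg vt) :
    ∃ P : G.Walk s t, P.IsPath ∧
      (∀ i, s(v i, u i) ∈ P.edges) ∧ s(vs, s) ∈ P.edges ∧ s(vt, t) ∈ P.edges ∧
      ∃ (x y : V) (Q : G.Walk x y), Q.IsPath ∧ x ≠ y ∧
        x ∈ W.branchVerts ∧ y ∈ W.branchVerts ∧
        Q.toSubgraph ≤ W.perim (k + 1) ∧
        P.toSubgraph ⊓ W.compass (k + 1) = Q.toSubgraph := by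
  have h3 := W.three_le
  set X := Sum.elim ![vs, vt] (Sum.elim v u) with hX
  have hXpeg : ∀ j, ∃ p, IsPeg r p ∧ X j = W.branch p := by
    rintro (j | j | j)
    · fin_cases j
      · exact Wall.IsInPeg.exists_isPeg W hvs
      · exact Wall.IsInPeg.exists_isPeg W hvt
    · exact Wall.IsInPeg.exists_isPeg W (hv j)
    · exact Wall.IsInPeg.exists_isPeg W (hu j)
  choose peg hpeg hXb using hXpeg
  have hpeginj : Function.Injective peg := fun i j h => hinj (by rw [hXb, hXb, h])
  have e0 : vs = W.branch (peg (Sum.inl 0)) := hXb (Sum.inl 0)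
  have e1 : vt = W.branch (peg (Sum.inl 1)) := hXb (Sum.inl 1)
  rcases Nat.eq_zero_or_pos k with rfl | hk
  · obtain ⟨P, h1, h2, h4, h5⟩ := W.exists_path_along hst hs ht
      ((hpeg (Sum.inl 0)).mem_layerVerts W.odd h3) ((hpeg (Sum.inl 1)).mem_layerVerts W.odd h3)
      (fun h => by simpa using hpeginj h) (e0 ▸ hes) (e1 ▸ het)
    exact ⟨P, h1, fun i => i.elim0, e0 ▸ h2, e1 ▸ h4, h5⟩
  obtain ⟨D⟩ := hG
  have h5 : 5 ≤ r := by omega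
  have hrk : ∀ j, ∃ t, OnFirst r (peg j).1 (peg j).2 t := by
    intro j
    rcases (hpeg j).exists_pegRank h5 with ⟨h, h'⟩ | ⟨t, t', h⟩
    · rw [h, h']
      exact ⟨8 * r - 4, Or.inr (Or.inr (Or.inr (Or.inr (by omega))))⟩
    · exact ⟨t, h.onFirst W.odd h5⟩
  choose rk hrk using hrk
  have hrkinj : Function.Injective rk := fun i j h => hpeginj (by
    obtain ⟨h1, h2⟩ := (hrk i).eq W.odd h5 (h ▸ hrk j)
    exact Prod.ext h1 h2)
  obtain ⟨n, hn⟩ : ∃ n, n = 2 * k + 2 := ⟨_, rfl⟩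
  obtain ⟨e, hmono⟩ := exists_equiv_strictMono (n := n) (by simp [hn]; ring) hrkinj
  -- transfer to natural numbers
  obtain ⟨σ, hσ⟩ : ∃ σ : ℕ → Fin 2 ⊕ (Fin k ⊕ Fin k), ∀ i (h : i < n), σ i = e ⟨i, h⟩ :=
    ⟨fun i => if h : i < n then e ⟨i, h⟩ else Sum.inl 0, fun i h => dif_pos h⟩
  have hτn : ∀ j, (e.symm j).1 < n := fun j => (e.symm j).2
  have hστ : ∀ j, σ (e.symm j).1 = j := fun j => by rw [hσ _ (hτn j)]; simp
  have hτσ : ∀ i < n, (e.symm (σ i)).1 = i := fun i hi => by rw [hσ i hi]; simp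
  have hinvol : ∀ j, edgePairing k (edgePairing k j) = j := by
    rintro (j | j | j)
    · fin_cases j <;> rfl
    · rfl
    · rfl
  have hnofix : ∀ j, edgePairing k j ≠ j := by
    rintro (j | j | j)
    · fin_cases j <;> simp [edgePairing]
    · simp [edgePairing]
    · simp [edgePairing]
  set E : ℕ → ℕ := fun i => (e.symm (edgePairing k (σ i))).1 with hEdef
  have hσE : ∀ i, σ (E i) = edgePairing k (σ i) := fun i => hστ _
  have hE : IsPairing n E := by
    refine ⟨fun i _ => hτn _, fun i hi => ?_, fun i hi h => ?_⟩
    · simp only [hEdef, hστ, hinvol, hτσ i hi]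
    · exact hnofix (σ i) (by rw [← hσE, h])
  set a := (e.symm (Sum.inl 0)).1 with ha
  have hσa : σ a = Sum.inl 0 := hστ _
  have hσEa : σ (E a) = Sum.inl 1 := by rw [hσE, hσa]; rfl
  have hne : ∀ i < n, ∀ i', σ i = σ i' → i' < n → i = i' := fun i hi i' h hi' => by
    rw [← hτσ i hi, h, hτσ i' hi']
  have hadj : ∀ j, j ≠ Sum.inl 0 → j ≠ Sum.inl 1 → G.Adj (X j) (X (edgePairing k j)) := by
    rintro (j | j | j) h0 h1
    · fin_cases j
      · exact absurd rfl h0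
      · exact absurd rfl h1
    · exact he j
    · exact (he j).symm
  obtain ⟨P, h1, h2, h4, h6, h7⟩ := W.exists_path_through D (p := fun i => peg (σ i))
    (t := fun i => rk (σ i)) hk hr hn (fun i _ => hpeg _) (fun i _ => hrk _)
    (fun i j hij hj => by
      simp only [hσ i (hij.trans hj), hσ j hj]
      exact hmono (show (⟨i, hij.trans hj⟩ : Fin n) < ⟨j, hj⟩ from hij))
    hE (a := a) (hτn _)
    (fun i hi h0 h1 => by
      rw [← hXb, ← hXb, hσE]
      refine hadj _ (fun h => h0 (hne i hi a (h.trans hσa.symm) (hτn _))) fun h => h1 ?_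
      exact hne i hi (E a) (h.trans hσEa.symm) (hτn _))
    hst hs ht (by rw [hσa, ← e0]; exact hes) (by rw [hσEa, ← e1]; exact het)
  refine ⟨P, h1, fun i => ?_, ?_, ?_, h7⟩
  · have := h2 (e.symm (Sum.inr (Sum.inl i))).1 (hτn _) (fun h => ?_) (fun h => ?_)
    · rw [hσE, hστ, ← hXb, ← hXb] at this
      exact this
    · have h' := congrArg σ h
      rw [hστ, hσa] at h'
      exact absurd h' (by simp)
    · have h' := congrArg σ h
      rw [hστ, hσEa] at h'
      exact absurd h' (by simp)
  · rw [hσa, ← e0] at h4; exact h4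
  · rw [hσEa, ← e1] at h6; exact h6
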